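/- Let $M\ge 4$, $p\ge 0$ be integers with $4(p+1)\le M$, and let $\mathfrak{so}(M)$ be the complex orthogonal Lie algebra spanned by $A_{i,j}=\mathcal E_{i,j}-\mathcal E_{\bar\jmath,\bar\imath}$, where $\mathcal E_{i,j}$ are the $M\times M$ matrix units and $\bar\imath=M+1-i$. Put $H_i=\frac12 A_{i,i}$, and for $0\le k\le p$, with $a=2k+1$, $b=2k+2$ and $2k+3\le m\le M-2k-2$, $$H^k_{1\pm2}=H_a\pm H_b,\quad E^k_{1+2}=-A_{a,\bar b},\quad E^k_{1-2}=-A_{a,b},\quad X^k_m=-A_{a,m},\quad Y^k_m=-A_{b,m}$$ (the $X^k_m,Y^k_m$ are the root vectors $E^k_{1\pm l},E^k_{2\pm l}$ and, for odd $M$, $E^k_1,E^k_2$). Put $$I_{(k)}^{1}=\tfrac12\sum_m X^k_mX^k_{\bar m},\qquad I_{(k)}^{1\otimes2}=\sum_m X^k_m\otimes Y^k_{\bar m},\qquad I_{(k)}^{1\wedge2}=\sum_m X^k_m\wedge Y^k_{\bar m},\qquad x\wedge y=x\otimes y-y\otimes x .$$ Let $\eta_k,\vartheta_k\in\mathbb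 C$ $(0\le k\le p)$ be arbitrary parameters (one may write $\vartheta_k=\eta_k\xi_k$), let $h$ be a formal parameter, and work in $U(\mathfrak{so}(M))[[h]]$ with its usual coproduct $\Delta$ and counit $\epsilon$, and in the $h$-adically completed tensor powers. Define $$\sigma^k_{1+2}=\ln\bigl(1+h\eta_kE^k_{1+2}\bigr),\qquad \sigma^k_G=\ln\bigl(1+h\vartheta_kG^k_{1-2}\bigr),\quad G^k_{1-2}=E^k_{1-2}-h\eta_kI^1_{(k)},$$ and the full chain $$\mathcal F=\prod_{k=p}^{0}\exp\bigl(H^k_{1-2}\otimes\sigma^k_G\bigr)\,\exp\bigl(h\eta_kI^{1\otimes2}_{(k)}(1\otimes e^{-\frac12\sigma^k_{1+2}})\bigr)\,\exp\bigl(H^k_{1+2}\otimes\sigma^k_{1+2}\bigr)$$ (the factor $k=p$ on the left). An invertible element $F$ is a twist if $F_{12}(\Delta\otimes\mathrm{id})F=F_{23}(\mathrm{id}\otimes\Delta)F$ and $(\epsilon\otimes\mathrm{id})F=(\mathrm{id}\otimes\epsilon)F=1$; then $\Delta_F=F\Delta F^{-1}$ and $\mathcal R_F=F_{21}F^{-1}$.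 Let the index $i$ run over the $2(p+1)$ labels of the pairs $(H_i,E_i)\in\{(H^k_{1+2},E^k_{1+2}),(H^k_{1-2},E^k_{1-2})\}_{k=0}^p$, let $\sigma_i$ be $\sigma^k_{1+2}$, resp. $\sigma^k_G$, and $c_i$ be $\eta_k$, resp. $\vartheta_k$. Let $\zeta_{ij}\in\mathbb C$ be arbitrary and $\Phi_{\mathcal R}=\exp\bigl(h^{-1}\sum_{i,j}\zeta_{ij}\,\sigma_i\otimes\sigma_j\bigr)$. Then: 1. $\mathcal F$ is a twist, the elements $\sigma_i$ commute pairwise, and they are primitive for the twisted coproduct: $\Delta_{\mathcal F}(\sigma_i)=\sigma_i\otimes1+1\otimes\sigma_i$. 2. $\Phi_{\mathcal R}\mathcal F$ is a twist of $U(\mathfrak{so}(M))$, and $\mathcal R=(\Phi_{\mathcal R}\mathcal F)_{21}(\Phi_{\mathcal R}\mathcal F)^{-1}$ is a triangular universal R-matrix for the coproduct $\Delta_{\Phi_{\mathcal R}\mathcal F}$: this coproduct is coassociative with counit $\epsilon$, $\mathcal R\,\Delta_{\Phi_{\mathcal R}\mathcal F}(x)=\Delta_{\Phi_{\mathcal R}\mathcal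 F}(x)_{21}\,\mathcal R$, $(\Delta_{\Phi_{\mathcal R}\mathcal F}\otimes\mathrm{id})\mathcal R=\mathcal R_{13}\mathcal R_{23}$, $(\mathrm{id}\otimes\Delta_{\Phi_{\mathcal R}\mathcal F})\mathcal R=\mathcal R_{13}\mathcal R_{12}$ and $\mathcal R_{21}\mathcal R=1$. 3. $\mathcal R\equiv1-h\,r \pmod{h^2}$ with the classical r-matrix $$r=\sum_{k=0}^p\Bigl(\eta_k\bigl(H^k_{1+2}\wedge E^k_{1+2}+I^{1\wedge2}_{(k)}\bigr)+\vartheta_kH^k_{1-2}\wedge E^k_{1-2}\Bigr)+\sum_{i\ne j}\zeta_{ij}\,(c_iE_i)\wedge(c_jE_j).$$ 4. Let $L$ be the span of all $H^k_{1+2},E^k_{1+2},X^k_m,Y^k_m$ with $\eta_k\ne0$ and all $H^k_{1-2},E^k_{1-2}$ with $\vartheta_k\ne0$. Put $\gamma_k=-1/\eta_k$, $\delta_k=1/\vartheta_k$ (read as $0$ if the denominator is $0$), and let $(\cdot)^*$ denote coordinate functionals in the basis of root vectors, the $H_i$, and the remaining diagonal generators. Then $L$ is a Lie subalgebra, and $$\omega(x,y)=\sum_{k=0}^p\bigl(\gamma_k(E^k_{1+2})^*-\delta_k(E^k_{1-2})^*\bigr)([x,y])+\sum_{i\ne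 j}\zeta_{ij}\,(H_i^*\wedge H_j^*)(x,y)$$ restricts to a non-degenerate 2-cocycle on $L$, with inverse $r$: $r\in L\otimes L$ and $(\omega(x,\cdot)\otimes\mathrm{id})(r)=x$ for all $x\in L$. If $\zeta_{ij}\ne\zeta_{ji}$ for some $i,j$ with $c_i,c_j\ne0$, then $\omega|_L$ is not a coboundary. -/

import Mathlib

open scoped TensorProduct PowerSeries

namespace FullChain

noncomputable section

/-! ### The orthogonal Lie algebra and its generators -/

section LieAlgebra

attribute [local instance 100] LieRing.ofAssociativeRing

/-- The matrix of the symmetric bilinear form with ones on the anti-diagonal. -/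
def antiDiag (M : ℕ) : Matrix (Fin M) (Fin M) ℂ :=
  Matrix.of fun i j => if j = Fin.rev i then 1 else 0

/-- The complex orthogonal Lie algebra `so(M)`: the matrices that are skew-adjoint with respect to
the anti-diagonal form. It is spanned by the elements `A i j` below. -/
abbrev so (M : ℕ) : Type :=
  ↥(skewAdjointMatricesLieSubalgebra (antiDiag M))

theorem A_mem {M : ℕ} (i j : Fin M) :
    Matrix.single i j 1 - Matrix.single (Fin.rev j) (Fin.rev i) 1 ∈
      skewAdjointMatricesLieSubalgebra (antiDiag M) := by
  rw [mem_skewAdjointMatricesLieSubalgebra, mem_skewAdjointMatricesSubmodule]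
  change (_ - _ : Matrix (Fin M) (Fin M) ℂ).transpose * antiDiag M = antiDiag M * (-(_ - _))
  ext a b
  have h1 : ∀ c : Fin M, b = Fin.rev c ↔ c = Fin.rev b := by
    intro c
    constructor <;> (rintro rfl; simp)
  simp only [antiDiag, Matrix.mul_apply, Matrix.transpose_apply, Matrix.sub_apply,
    Matrix.of_apply, h1, mul_ite, mul_one, mul_zero, ite_mul, one_mul, zero_mul,
    Finset.sum_ite_eq', Finset.mem_univ, if_true, Matrix.single_apply, neg_sub]
  have h2 : (Fin.rev j = Fin.rev b ∧ Fin.rev i = a) ↔ (i = Fin.rev a ∧ j = b) := by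
    rw [Fin.rev_inj]
    constructor <;> (rintro ⟨rfl, rfl⟩; simp)
  have h3 : (i = Fin.rev b ∧ j = a) ↔ (Fin.rev j = Fin.rev a ∧ Fin.rev i = b) := by
    rw [Fin.rev_inj]
    constructor <;> (rintro ⟨rfl, rfl⟩; simp)
  simp only [h2, h3]

/-- `A i j = 𝓔 i j - 𝓔 (rev j) (rev i)` with `𝓔` the matrix units; `rev` is `i ↦ M + 1 - i` when
indices are counted from `1`. -/
def A {M : ℕ} (i j : Fin M) : so M :=
  ⟨Matrix.single i j 1 - Matrix.single (Fin.rev j) (Fin.rev i) 1, A_mem i j⟩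

/-- The matrix entry `(i, j)` as a linear functional on `so(M)`. -/
def entry {M : ℕ} (i j : Fin M) : so M →ₗ[ℂ] ℂ :=
  (Matrix.entryLinearMap ℂ ℂ i j).comp
    (skewAdjointMatricesLieSubalgebra (antiDiag M)).toSubmodule.subtype

end LieAlgebra

/-- The Cartan generator `H_i = (𝓔 i i - 𝓔 (rev i) (rev i)) / 2`. -/
def H {M : ℕ} (i : Fin M) : so M := (1 / 2 : ℂ) • A i i

/-- The row `e₁` of the `k`-th link (row `2k+1` when rows are counted from `1`). -/
def row1 {M p : ℕ} (hM : 4 * (p + 1) ≤ M) (k : Fin (p + 1)) : Fin M :=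
  ⟨2 * k, by omega⟩

/-- The row `e₂` of the `k`-th link (row `2k+2` when rows are counted from `1`). -/
def row2 {M p : ℕ} (hM : 4 * (p + 1) ≤ M) (k : Fin (p + 1)) : Fin M :=
  ⟨2 * k + 1, by omega⟩

/-- The matrix indices of the subalgebra `so(M - 4(k+1))` inside `so(M)`. -/
def window (M k : ℕ) : Finset (Fin M) :=
  Finset.univ.filter fun m => 2 * k + 2 ≤ m.val ∧ m.val + (2 * k + 2) < M

/-- The root vector with index `m` in row `i`. For `m = l` (upper half) it is `E_{i-l}`, for
`m = rev l` it is `E_{i+l}`, and for the middle index of an odd `M` it is the short root vector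
`E_i`. -/
def rootVec {M : ℕ} (i m : Fin M) : so M := -A i m

/-- `H_{1+2}^k`. -/
def Hplus {M p : ℕ} (hM : 4 * (p + 1) ≤ M) (k : Fin (p + 1)) : so M :=
  H (row1 hM k) + H (row2 hM k)

/-- `H_{1-2}^k`. -/
def Hminus {M p : ℕ} (hM : 4 * (p + 1) ≤ M) (k : Fin (p + 1)) : so M :=
  H (row1 hM k) - H (row2 hM k)

/-- `E_{1+2}^k`, the root vector of the initial root of the `k`-th link. -/
def Eplus {M p : ℕ} (hM : 4 * (p + 1) ≤ M) (k : Fin (p + 1)) : so M :=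
  rootVec (row1 hM k) (Fin.rev (row2 hM k))

/-- `E_{1-2}^k`. -/
def Eminus {M p : ℕ} (hM : 4 * (p + 1) ≤ M) (k : Fin (p + 1)) : so M :=
  rootVec (row1 hM k) (row2 hM k)

/-! ### The carrier algebra, the 2-cocycle and the classical r-matrix -/

/-- Labels of the `2(p+1)` pairs `(H_i, E_i)`: `inl k` is `(H_{1+2}^k, E_{1+2}^k)` and `inr k` is
`(H_{1-2}^k, E_{1-2}^k)`. -/
abbrev Idx (p : ℕ) : Type := Fin (p + 1) ⊕ Fin (p + 1)

/-- `E_i` for a label `i`. -/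
def Egen {M p : ℕ} (hM : 4 * (p + 1) ≤ M) : Idx p → so M :=
  Sum.elim (Eplus hM) (Eminus hM)

/-- The linear functional `H_i^*`: the coefficient of `H_i` in the basis of `so(M)` consisting of
root vectors, the `H_i`, and the remaining diagonal generators. -/
def Hdual {M p : ℕ} (hM : 4 * (p + 1) ≤ M) : Idx p → so M →ₗ[ℂ] ℂ :=
  Sum.elim
    (fun k => entry (row1 hM k) (row1 hM k) + entry (row2 hM k) (row2 hM k))
    (fun k => entry (row1 hM k) (row1 hM k) - entry (row2 hM k) (row2 hM k))

/-- The linear functional `(E_{1+2}^k)^*`: the coefficient of `E_{1+2}^k` in the same basis. -/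
def EplusDual {M p : ℕ} (hM : 4 * (p + 1) ≤ M) (k : Fin (p + 1)) : so M →ₗ[ℂ] ℂ :=
  -entry (row1 hM k) (Fin.rev (row2 hM k))

/-- The linear functional `(E_{1-2}^k)^*`: the coefficient of `E_{1-2}^k` in the same basis. -/
def EminusDual {M p : ℕ} (hM : 4 * (p + 1) ≤ M) (k : Fin (p + 1)) : so M →ₗ[ℂ] ℂ :=
  -entry (row1 hM k) (row2 hM k)

/-- The carrier space: the `k`-th link contributes `H_{1+2}^k`, `E_{1+2}^k` and all its constituent
root vectors if `η k ≠ 0`, and `H_{1-2}^k`, `E_{1-2}^k` if `ϑ k ≠ 0`. -/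
def carrier {M p : ℕ} (hM : 4 * (p + 1) ≤ M) (η ϑ : Fin (p + 1) → ℂ) : Submodule ℂ (so M) :=
  Submodule.span ℂ
    ({x | ∃ k, η k ≠ 0 ∧ (x = Hplus hM k ∨ x = Eplus hM k ∨
        ∃ m ∈ window M k, x = rootVec (row1 hM k) m ∨ x = rootVec (row2 hM k) m)} ∪
     {x | ∃ k, ϑ k ≠ 0 ∧ (x = Hminus hM k ∨ x = Eminus hM k)})

/-- The bilinear form `(x, y) ↦ f ⁅x, y⁆` of a linear functional `f`. -/
def coboundary {M : ℕ} (f : so M →ₗ[ℂ] ℂ) : so M →ₗ[ℂ] so M →ₗ[ℂ] ℂ :=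
  LinearMap.mk₂ ℂ (fun x y => f ⁅x, y⁆) (by simp) (by simp) (by simp) (by simp)

/-- The bilinear form `f ∧ g`, `(x, y) ↦ f x * g y - g x * f y`. -/
def wedgeForm {M : ℕ} (f g : so M →ₗ[ℂ] ℂ) : so M →ₗ[ℂ] so M →ₗ[ℂ] ℂ :=
  LinearMap.mk₂ ℂ (fun x y => f x * g y - g x * f y)
    (by intros; simp; ring) (by intros; simp; ring) (by intros; simp; ring) (by intros; simp; ring)

/-- `∑_k (γ_k (E_{1+2}^k)^* - δ_k (E_{1-2}^k)^*)([ , ]) + ∑_{i ≠ j} ζ_{ij} H_i^* ∧ H_j^*`. -/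
def omega {M p : ℕ} (hM : 4 * (p + 1) ≤ M) (γ δ : Fin (p + 1) → ℂ) (ζ : Idx p → Idx p → ℂ) :
    so M →ₗ[ℂ] so M →ₗ[ℂ] ℂ :=
  coboundary (∑ k, (γ k • EplusDual hM k - δ k • EminusDual hM k)) +
    ∑ i, ∑ j, if i ≠ j then ζ i j • wedgeForm (Hdual hM i) (Hdual hM j) else 0

/-- `ω` restricts to a non-degenerate 2-cocycle (with trivial coefficients) on the subspace `L`,
which is a Lie subalgebra. -/
structure IsNondegenerateCocycle {M : ℕ} (L : Submodule ℂ (so M))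
    (ω : so M →ₗ[ℂ] so M →ₗ[ℂ] ℂ) : Prop where
  lie_mem : ∀ x ∈ L, ∀ y ∈ L, ⁅x, y⁆ ∈ L
  alternating : ∀ x ∈ L, ω x x = 0
  cocycle : ∀ x ∈ L, ∀ y ∈ L, ∀ z ∈ L, ω ⁅x, y⁆ z + ω ⁅y, z⁆ x + ω ⁅z, x⁆ y = 0
  nondegenerate : ∀ x ∈ L, (∀ y ∈ L, ω x y = 0) → x = 0

/-- `ω` restricted to `L` is the coboundary of a linear functional. -/
def IsCoboundaryOn {M : ℕ} (L : Submodule ℂ (so M)) (ω : so M →ₗ[ℂ] so M →ₗ[ℂ] ℂ) : Prop :=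
  ∃ f : so M →ₗ[ℂ] ℂ, ∀ x ∈ L, ∀ y ∈ L, ω x y = f ⁅x, y⁆

/-- `x ∧ y = x ⊗ y - y ⊗ x`. -/
def wedge {M : ℕ} (x y : so M) : so M ⊗[ℂ] so M := x ⊗ₜ[ℂ] y - y ⊗ₜ[ℂ] x

/-- The antisymmetric invariant `I_{M-4k}^{1∧2}` of the `k`-th link. Since `rev` exchanges the
indices of `E_{i-l}` and `E_{i+l}` and fixes that of `E_i`, this is
`E_1 ∧ E_2 + ∑_l (E_{1+l} ∧ E_{2-l} + E_{1-l} ∧ E_{2+l})`, the first term being present only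
for odd `M`. -/
def Iwedge {M p : ℕ} (hM : 4 * (p + 1) ≤ M) (k : Fin (p + 1)) : so M ⊗[ℂ] so M :=
  ∑ m ∈ window M k, wedge (rootVec (row1 hM k) m) (rootVec (row2 hM k) (Fin.rev m))

/-- The classical r-matrix
`∑_k (η_k (H_{1+2}^k ∧ E_{1+2}^k + I_{M-4k}^{1∧2}) + ϑ_k H_{1-2}^k ∧ E_{1-2}^k)
  + ∑_{i ≠ j} ζ_{ij} (c_i E_i) ∧ (c_j E_j)`,
where `c_i` is `η_k` for `E_i = E_{1+2}^k` and `ϑ_k` for `E_i = E_{1-2}^k`. -/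
def classicalR {M p : ℕ} (hM : 4 * (p + 1) ≤ M) (η ϑ : Fin (p + 1) → ℂ)
    (ζ : Idx p → Idx p → ℂ) : so M ⊗[ℂ] so M :=
  (∑ k, (η k • (wedge (Hplus hM k) (Eplus hM k) + Iwedge hM k) +
      ϑ k • wedge (Hminus hM k) (Eminus hM k))) +
    ∑ i, ∑ j, if i ≠ j then
      ζ i j • wedge (Sum.elim η ϑ i • Egen hM i) (Sum.elim η ϑ j • Egen hM j) else 0

/-! ### Formal power series over an associative algebra -/

/-- The exponential of a power series in the formal parameter, for a series without constant term
(over a possibly noncommutative coefficient algebra): the `n`-th coefficient of `∑_k f ^ k / k!`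
only involves the terms `k ≤ n`. -/
def fexp {B : Type*} [Ring B] [Algebra ℂ B] (f : B⟦X⟧) : B⟦X⟧ :=
  PowerSeries.mk fun n =>
    ∑ k ∈ Finset.range (n + 1), ((k.factorial : ℂ)⁻¹) • PowerSeries.coeff n (f ^ k)

/-- `ln (1 + f)` for a power series `f` without constant term. -/
def flog1p {B : Type*} [Ring B] [Algebra ℂ B] (f : B⟦X⟧) : B⟦X⟧ :=
  PowerSeries.mk fun n =>
    ∑ k ∈ Finset.Icc 1 n, ((-1 : ℂ) ^ (k + 1) / (k : ℂ)) • PowerSeries.coeff n (f ^ k)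

/-- Division of a power series without constant term by the formal parameter. -/
def divX {B : Type*} [Ring B] (f : B⟦X⟧) : B⟦X⟧ :=
  PowerSeries.mk fun n => PowerSeries.coeff (n + 1) f

/-! ### The Hopf structure of `U(so(M))⟦h⟧` -/

/-- `U(so(M))`. -/
abbrev U (M : ℕ) : Type := UniversalEnvelopingAlgebra ℂ (so M)

/-- `U(so(M)) ⊗ U(so(M))`; power series over it are the completed tensor square of `U(so(M))⟦h⟧`. -/
abbrev U2 (M : ℕ) : Type := U M ⊗[ℂ] U M

/-- The threefold tensor power of `U(so(M))`. -/
abbrev U3 (M : ℕ) : Type := U M ⊗[ℂ] (U M ⊗[ℂ] U M)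

section Coproduct

attribute [local instance 100] LieRing.ofAssociativeRing

/-- The canonical linear map `so(M) → U(so(M))`. -/
def ι {M : ℕ} : so M →ₗ[ℂ] U M := (UniversalEnvelopingAlgebra.ι ℂ : so M →ₗ⁅ℂ⁆ U M).toLinearMap

/-- The Lie algebra morphism `x ↦ x ⊗ 1 + 1 ⊗ x`. -/
def comulLie (M : ℕ) : so M →ₗ⁅ℂ⁆ U2 M :=
  { toFun := fun x => ι x ⊗ₜ[ℂ] 1 + 1 ⊗ₜ[ℂ] ι x
    map_add' := by
      intro x y
      simp only [map_add, TensorProduct.add_tmul, TensorProduct.tmul_add]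
      abel
    map_smul' := by
      intro c x
      simp [TensorProduct.smul_tmul']
    map_lie' := by
      intro x y
      simp only [ι, LieHom.coe_toLinearMap, LieHom.map_lie, LieRing.of_associative_ring_bracket, mul_add, add_mul,
        Algebra.TensorProduct.tmul_mul_tmul, one_mul, mul_one, TensorProduct.sub_tmul,
        TensorProduct.tmul_sub]
      abel }

/-- The coproduct of `U(so(M))`, with `Δ x = x ⊗ 1 + 1 ⊗ x` on `so(M)`. -/
def comul (M : ℕ) : U M →ₐ[ℂ] U2 M := UniversalEnvelopingAlgebra.lift ℂ (comulLie M)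

/-- The counit of `U(so(M))`, with `ε x = 0` on `so(M)`. -/
def counit (M : ℕ) : U M →ₐ[ℂ] ℂ := UniversalEnvelopingAlgebra.lift ℂ (0 : so M →ₗ⁅ℂ⁆ ℂ)

end Coproduct

/-- The `h`-linear extension of an algebra morphism to power series. -/
def hExt {B C : Type*} [Ring B] [Algebra ℂ B] [Ring C] [Algebra ℂ C] (φ : B →ₐ[ℂ] C) :
    B⟦X⟧ →ₐ[ℂ] C⟦X⟧ :=
  PowerSeries.mapAlgHom φ

/-- The coproduct `Δ` of `U(so(M))⟦h⟧`. -/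
def Delta (M : ℕ) : (U M)⟦X⟧ →ₐ[ℂ] (U2 M)⟦X⟧ := hExt (comul M)

/-- `Δ ⊗ id`. -/
def DeltaId (M : ℕ) : (U2 M)⟦X⟧ →ₐ[ℂ] (U3 M)⟦X⟧ :=
  hExt ((Algebra.TensorProduct.assoc ℂ ℂ ℂ (U M) (U M) (U M)).toAlgHom.comp
    (Algebra.TensorProduct.map (comul M) (AlgHom.id ℂ (U M))))

/-- `id ⊗ Δ`. -/
def idDelta (M : ℕ) : (U2 M)⟦X⟧ →ₐ[ℂ] (U3 M)⟦X⟧ :=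
  hExt (Algebra.TensorProduct.map (AlgHom.id ℂ (U M)) (comul M))

/-- `ε ⊗ id`. -/
def epsId (M : ℕ) : (U2 M)⟦X⟧ →ₐ[ℂ] (U M)⟦X⟧ :=
  hExt ((Algebra.TensorProduct.lid ℂ (U M)).toAlgHom.comp
    (Algebra.TensorProduct.map (counit M) (AlgHom.id ℂ (U M))))

/-- `id ⊗ ε`. -/
def idEps (M : ℕ) : (U2 M)⟦X⟧ →ₐ[ℂ] (U M)⟦X⟧ :=
  hExt ((Algebra.TensorProduct.rid ℂ ℂ (U M)).toAlgHom.comp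
    (Algebra.TensorProduct.map (AlgHom.id ℂ (U M)) (counit M)))

/-- `F ↦ F₂₁`, the flip of the tensor factors. -/
def flip21 (M : ℕ) : (U2 M)⟦X⟧ →ₐ[ℂ] (U2 M)⟦X⟧ :=
  hExt (Algebra.TensorProduct.comm ℂ (U M) (U M)).toAlgHom

/-- `F ↦ F₁₂ = F ⊗ 1`. -/
def leg12 (M : ℕ) : (U2 M)⟦X⟧ →ₐ[ℂ] (U3 M)⟦X⟧ :=
  hExt (Algebra.TensorProduct.map (AlgHom.id ℂ (U M))
    (Algebra.TensorProduct.includeLeft : U M →ₐ[ℂ] U2 M))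

/-- `F ↦ F₂₃ = 1 ⊗ F`. -/
def leg23 (M : ℕ) : (U2 M)⟦X⟧ →ₐ[ℂ] (U3 M)⟦X⟧ :=
  hExt (Algebra.TensorProduct.includeRight : U2 M →ₐ[ℂ] U3 M)

/-- `F ↦ F₁₃`, `a ⊗ b ↦ a ⊗ 1 ⊗ b`. -/
def leg13 (M : ℕ) : (U2 M)⟦X⟧ →ₐ[ℂ] (U3 M)⟦X⟧ :=
  hExt (Algebra.TensorProduct.map (AlgHom.id ℂ (U M))
    (Algebra.TensorProduct.includeRight : U M →ₐ[ℂ] U2 M))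

/-- The element `f ⊗ g` of the completed tensor square. -/
def tens {M : ℕ} (f g : (U M)⟦X⟧) : (U2 M)⟦X⟧ :=
  hExt (Algebra.TensorProduct.includeLeft : U M →ₐ[ℂ] U2 M) f *
    hExt (Algebra.TensorProduct.includeRight : U M →ₐ[ℂ] U2 M) g

/-- `F` is a twisting element: it is invertible and
`F₁₂ (Δ ⊗ id) F = F₂₃ (id ⊗ Δ) F`, `(ε ⊗ id) F = (id ⊗ ε) F = 1`. -/
structure IsTwist {M : ℕ} (F : (U2 M)⟦X⟧) : Prop where
  isUnit : IsUnit F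
  twist_eq : leg12 M F * DeltaId M F = leg23 M F * idDelta M F
  eps_left : epsId M F = 1
  eps_right : idEps M F = 1

/-- The twisted coproduct `Δ_F x = F Δ(x) F⁻¹`. -/
def twistedDelta {M : ℕ} (F : (U2 M)⟦X⟧) (x : (U M)⟦X⟧) : (U2 M)⟦X⟧ :=
  F * Delta M x * Ring.inverse F

/-- `Δ_F ⊗ id`. -/
def twistedDeltaId {M : ℕ} (F y : (U2 M)⟦X⟧) : (U3 M)⟦X⟧ :=
  leg12 M F * DeltaId M y * leg12 M (Ring.inverse F)

/-- `id ⊗ Δ_F`. -/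
def idTwistedDelta {M : ℕ} (F y : (U2 M)⟦X⟧) : (U3 M)⟦X⟧ :=
  leg23 M F * idDelta M y * leg23 M (Ring.inverse F)

/-- The R-matrix `F₂₁ F⁻¹` of a twist. -/
def universalR {M : ℕ} (F : (U2 M)⟦X⟧) : (U2 M)⟦X⟧ := flip21 M F * Ring.inverse F

/-- `U(so(M))⟦h⟧` with the coproduct `Δ_F`, the undeformed counit and the element `R` is a
triangular bialgebra. -/
structure IsTriangular {M : ℕ} (F R : (U2 M)⟦X⟧) : Prop where
  coassoc : ∀ x, twistedDeltaId F (twistedDelta F x) = idTwistedDelta F (twistedDelta F x)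
  counit_left : ∀ x, epsId M (twistedDelta F x) = x
  counit_right : ∀ x, idEps M (twistedDelta F x) = x
  intertwine : ∀ x, R * twistedDelta F x = flip21 M (twistedDelta F x) * R
  hexagon_left : twistedDeltaId F R = leg13 M R * leg23 M R
  hexagon_right : idTwistedDelta F R = leg13 M R * leg12 M R
  unitary : flip21 M R * R = 1

/-! ### The full chain and the Reshetikhin factor -/

/-- The constant power series of an element of `so(M)`. -/
def gen {M : ℕ} (x : so M) : (U M)⟦X⟧ := PowerSeries.C (ι x)

/-- `σ_{1+2}^k = ln (1 + h η_k E_{1+2}^k)`. -/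
def sigmaPlus {M p : ℕ} (hM : 4 * (p + 1) ≤ M) (η : Fin (p + 1) → ℂ) (k : Fin (p + 1)) :
    (U M)⟦X⟧ :=
  flog1p (PowerSeries.X * (η k • gen (Eplus hM k)))

/-- The invariant `I_{M-4k}^1 = E_1² / 2 + ∑_l E_{1+l} E_{1-l}` of the `k`-th link, the first
term being present only for odd `M` (`E_{1+l}` and `E_{1-l}` commute and both orders occur in the
sum over the window). -/
def I1 {M p : ℕ} (hM : 4 * (p + 1) ≤ M) (k : Fin (p + 1)) : U M :=
  (1 / 2 : ℂ) • ∑ m ∈ window M k,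
    ι (rootVec (row1 hM k) m) * ι (rootVec (row1 hM k) (Fin.rev m))

/-- The invariant
`I_{M-4k}^{1⊗2} = E_1 ⊗ E_2 + ∑_l (E_{1+l} ⊗ E_{2-l} + E_{1-l} ⊗ E_{2+l})` of the `k`-th link,
the first term being present only for odd `M`. -/
def I12 {M p : ℕ} (hM : 4 * (p + 1) ≤ M) (k : Fin (p + 1)) : U2 M :=
  ∑ m ∈ window M k,
    ι (rootVec (row1 hM k) m) ⊗ₜ[ℂ] ι (rootVec (row2 hM k) (Fin.rev m))

/-- The deformed generator `G_{1-2}^k = E_{1-2}^k - h η_k I_{M-4k}^1`. -/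
def G {M p : ℕ} (hM : 4 * (p + 1) ≤ M) (η : Fin (p + 1) → ℂ) (k : Fin (p + 1)) : (U M)⟦X⟧ :=
  gen (Eminus hM k) - PowerSeries.X * (η k • PowerSeries.C (I1 hM k))

/-- `σ_G^k = ln (1 + h ϑ_k G_{1-2}^k)`. -/
def sigmaG {M p : ℕ} (hM : 4 * (p + 1) ≤ M) (η ϑ : Fin (p + 1) → ℂ) (k : Fin (p + 1)) :
    (U M)⟦X⟧ :=
  flog1p (PowerSeries.X * (ϑ k • G hM η k))

/-- The family of all `σ_{1+2}^k` and `σ_G^k`. -/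
def sigma {M p : ℕ} (hM : 4 * (p + 1) ≤ M) (η ϑ : Fin (p + 1) → ℂ) : Idx p → (U M)⟦X⟧ :=
  Sum.elim (sigmaPlus hM η) (sigmaG hM η ϑ)

/-- The jordanian factor `exp (H_{1+2}^k ⊗ σ_{1+2}^k)`. -/
def jordanian {M p : ℕ} (hM : 4 * (p + 1) ≤ M) (η : Fin (p + 1) → ℂ) (k : Fin (p + 1)) :
    (U2 M)⟦X⟧ :=
  fexp (tens (gen (Hplus hM k)) (sigmaPlus hM η k))

/-- The extension `exp (h η_k I_{M-4k}^{1⊗2} (1 ⊗ exp (-σ_{1+2}^k / 2)))`. -/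
def extension {M p : ℕ} (hM : 4 * (p + 1) ≤ M) (η : Fin (p + 1) → ℂ) (k : Fin (p + 1)) :
    (U2 M)⟦X⟧ :=
  fexp (PowerSeries.X * (η k • PowerSeries.C (I12 hM k)) *
    tens 1 (fexp (-(1 / 2 : ℂ) • sigmaPlus hM η k)))

/-- The jordanian factor on the deformed carrier space, `exp (H_{1-2}^k ⊗ σ_G^k)`. -/
def deformedJordanian {M p : ℕ} (hM : 4 * (p + 1) ≤ M) (η ϑ : Fin (p + 1) → ℂ)
    (k : Fin (p + 1)) : (U2 M)⟦X⟧ :=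
  fexp (tens (gen (Hminus hM k)) (sigmaG hM η ϑ k))

/-- The `k`-th link of the full chain. -/
def link {M p : ℕ} (hM : 4 * (p + 1) ≤ M) (η ϑ : Fin (p + 1) → ℂ) (k : Fin (p + 1)) :
    (U2 M)⟦X⟧ :=
  deformedJordanian hM η ϑ k * extension hM η k * jordanian hM η k

/-- The full chain: the product of the links, from `k = p` on the left to `k = 0` on the right. -/
def fullChain {M p : ℕ} (hM : 4 * (p + 1) ≤ M) (η ϑ : Fin (p + 1) → ℂ) : (U2 M)⟦X⟧ :=
  (List.ofFn (link hM η ϑ)).reverse.prod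

/-- The Reshetikhin factor `exp (h⁻¹ ∑_{i,j} ζ_{ij} σ_i ⊗ σ_j)`; as every `σ_i` is divisible by
`h`, the exponent is a power series without constant term. -/
def reshetikhin {M p : ℕ} (hM : 4 * (p + 1) ≤ M) (η ϑ : Fin (p + 1) → ℂ)
    (ζ : Idx p → Idx p → ℂ) : (U2 M)⟦X⟧ :=
  fexp (divX (∑ i, ∑ j, ζ i j • tens (sigma hM η ϑ i) (sigma hM η ϑ j)))

end

end FullChain

open FullChain

/-! Twists of a cocommutative Hopf algebra compose: if F is a twist and Φ satisfies the twist
equation for the coproduct Δ_F, then ΦF is a twist (`IsTwist.mul`). The chain is built in this way,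
three factors per link, and the work lies in knowing which elements keep a simple coproduct after
each factor. A statement Δ_F(x) = y is stored as the intertwining relation F Δ(x) = y F
(`SemiconjBy`), which passes to products and exponentials.

Within a link, a primitive pair with [H,E] = E gives the Jordanian twist exp(H ⊗ σ), σ = ln(1+hcE);
after it 1+hcE is group-like, so σ is primitive (`JordanianPair.isTwist`,
`JordanianPair.isPrim_jlog`). The root vectors X_m and the elements z_m = hη Y_{rev m} e^{-σ/2} then
have coproducts X⊗e^{σ/2} + 1⊗X and z⊗1 + e^{-σ/2}⊗z, and [z_m, X_n] = δ_{mn}(e^{-σ/2} - e^{σ/2});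
these relations alone make exp(∑ X_m⊗z_m) a twist (`ExtensionData.isTwist`). The extension destroys
primitivity of E_{1-2}, but subtracting hη I^1 restores it (`ExtensionData.isPrim_sub_hscale`),
while H_{1-2} stays primitive because X and Y have opposite weights. So (H_{1-2}, G) is again a
Jordanian pair. Finally, the smaller algebra so(M-4(k+1)) commutes with H_{1±2} and E_{1±2} and
leaves I^1 and I^{1⊗2} invariant, so its generators remain primitive and the next link starts from
the same situation (`isTwist_link_mul`, `partialChain`). The same invariance makes each σ commute
with all later links, so all σ_i commute and stay primitive.

For commuting primitive elements the Reshetikhin factor is an abelian twist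
(`isTwist_mul_of_commute_prim`), and triangularity of F₂₁F⁻¹ holds for every twist
(`isTriangular_universalR`). If t is the first-order term of the twist, then F₂₁F⁻¹ has first-order
term t₂₁ - t, which is -r.

For the carrier L, brackets land in the span of the root vectors of L (`carrier_lie_mem`), where
every H_i^* vanishes; the cocycle identity thus reduces to Jacobi. Contraction with r inverts ω on
generators (`contract_form`), and since r ∈ L⊗L this yields non-degeneracy. The H_i commute, so
ω(H_i,H_j) = ζ_ij - ζ_ji obstructs being a coboundary. -/

namespace FullChain
-- Exponential and logarithm of power series over a noncommutative algebra.
section PowerSeriesCalculus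

open PowerSeries Finset

variable {B C : Type*} [Ring B] [Ring C]

/-- Equality of power series up to terms of order `N`. -/
def EqMod (N : ℕ) (f g : B⟦X⟧) : Prop := ∀ n < N, coeff n f = coeff n g

theorem EqMod.symm {N : ℕ} {f g : B⟦X⟧} (h : EqMod N f g) : EqMod N g f :=
  fun n hn => (h n hn).symm

theorem EqMod.trans {N : ℕ} {f g k : B⟦X⟧} (h : EqMod N f g) (h' : EqMod N g k) : EqMod N f k :=
  fun n hn => (h n hn).trans (h' n hn)

theorem EqMod.mul {N : ℕ} {f g f' g' : B⟦X⟧} (h : EqMod N f g) (h' : EqMod N f' g') :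
    EqMod N (f * f') (g * g') := by
  intro n hn
  rw [coeff_mul, coeff_mul]
  refine sum_congr rfl fun p hp => ?_
  rw [HasAntidiagonal.mem_antidiagonal] at hp
  rw [h _ (by omega), h' _ (by omega)]

theorem EqMod.add {N : ℕ} {f g f' g' : B⟦X⟧} (h : EqMod N f g) (h' : EqMod N f' g') :
    EqMod N (f + f') (g + g') := by
  intro n hn
  rw [map_add, map_add, h n hn, h' n hn]

theorem eq_of_eqMod {f g : B⟦X⟧} (h : ∀ N, EqMod N f g) : f = g := by
  ext n
  exact h (n + 1) n n.lt_succ_self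

theorem coeff_pow_eq_zero {f : B⟦X⟧} (hf : constantCoeff f = 0) {n k : ℕ} (hnk : n < k) :
    coeff n (f ^ k) = 0 := by
  obtain ⟨g, rfl⟩ := X_dvd_iff.2 hf
  rw [((commute_X g).symm).mul_pow]
  exact X_pow_dvd_iff.1 (dvd_mul_right _ _) n hnk

/-- The k-th terms are divisible by h^k, so the pairs with k + l ≥ N, which separate the square from
the triangle, contribute nothing below order N. -/
theorem sum_mul_sum_eqMod (u v : ℕ → B⟦X⟧) (hu : ∀ n k, n < k → coeff n (u k) = 0)
    (hv : ∀ n k, n < k → coeff n (v k) = 0) (N : ℕ) :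
    EqMod N ((∑ k ∈ range N, u k) * ∑ l ∈ range N, v l)
      (∑ n ∈ range N, ∑ p ∈ antidiagonal n, u p.1 * v p.2) := by
  intro m hm
  simp only [Finset.Nat.sum_antidiagonal_eq_sum_range_succ_mk]
  rw [Finset.sum_range_diag_flip N (fun k l => u k * v l), sum_mul_sum, map_sum, map_sum]
  refine sum_congr rfl fun k _ => ?_
  rw [map_sum, map_sum]
  symm
  refine sum_subset (range_subset_range.2 (by omega)) fun l _ hl => ?_
  rw [coeff_mul]
  refine sum_eq_zero fun p hp => ?_
  rw [HasAntidiagonal.mem_antidiagonal] at hp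
  rw [mem_range, not_lt] at hl
  rcases lt_or_ge p.1 k with h | h
  · rw [hu _ _ h, zero_mul]
  · rw [hv _ _ (by omega), mul_zero]

variable [Algebra ℂ B] [Algebra ℂ C]

theorem coeff_smul_complex (c : ℂ) (f : B⟦X⟧) (n : ℕ) : coeff n (c • f) = c • coeff n f := rfl

@[simp] theorem constantCoeff_smul_complex (c : ℂ) (f : B⟦X⟧) :
    constantCoeff (c • f) = c • constantCoeff f := rfl

/-- The substitution of `f` into the power series with coefficients `a`. -/
noncomputable def fsub (a : ℕ → ℂ) (f : B⟦X⟧) : B⟦X⟧ :=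
  PowerSeries.mk fun n => ∑ k ∈ range (n + 1), a k • coeff n (f ^ k)

theorem flog1p_eq_fsub (f : B⟦X⟧) :
    flog1p f = fsub (fun k => (-1 : ℂ) ^ (k + 1) / (k : ℂ)) f := by
  ext n
  rw [flog1p, fsub, coeff_mk, coeff_mk, range_eq_Ico,
    Finset.sum_eq_sum_Ico_succ_bot (Nat.succ_pos n)]
  simp
  rfl

theorem fsub_eqMod (a : ℕ → ℂ) {f : B⟦X⟧} (hf : constantCoeff f = 0) {N K : ℕ} (h : N ≤ K) :
    EqMod N (fsub a f) (∑ k ∈ range K, a k • f ^ k) := by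
  intro n hn
  rw [fsub, coeff_mk, map_sum]
  simp only [coeff_smul_complex]
  refine sum_subset (range_subset_range.2 (by omega)) fun k _ hk => ?_
  rw [coeff_pow_eq_zero hf (by simpa using hk), smul_zero]

theorem fexp_eqMod {f : B⟦X⟧} (hf : constantCoeff f = 0) {N K : ℕ} (h : N ≤ K) :
    EqMod N (fexp f) (∑ k ∈ range K, ((k.factorial : ℂ)⁻¹) • f ^ k) :=
  fsub_eqMod _ hf h

theorem coeff_smul_pow_eq_zero (a : ℕ → ℂ) {f : B⟦X⟧} (hf : constantCoeff f = 0) (n k : ℕ)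
    (h : n < k) : coeff n (a k • f ^ k) = 0 := by
  rw [coeff_smul_complex, coeff_pow_eq_zero hf h, smul_zero]

@[simp] theorem constantCoeff_fexp (f : B⟦X⟧) : constantCoeff (fexp f) = 1 := by
  rw [← coeff_zero_eq_constantCoeff_apply, fexp, coeff_mk]
  simp

@[simp] theorem constantCoeff_flog1p (f : B⟦X⟧) : constantCoeff (flog1p f) = 0 := by
  rw [← coeff_zero_eq_constantCoeff_apply, flog1p, coeff_mk]
  simp

theorem coeff_one_fexp (f : B⟦X⟧) : coeff 1 (fexp f) = coeff 1 f := by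
  simp [fexp, sum_range_succ, coeff_one]

theorem coeff_one_flog1p (f : B⟦X⟧) : coeff 1 (flog1p f) = coeff 1 f := by
  simp [flog1p]

theorem fexp_add {f g : B⟦X⟧} (hf : constantCoeff f = 0) (hg : constantCoeff g = 0)
    (h : Commute f g) : fexp (f + g) = fexp f * fexp g := by
  refine eq_of_eqMod fun N => ?_
  refine (fexp_eqMod (by simp [hf, hg]) le_rfl).trans (EqMod.trans ?_
    ((fexp_eqMod hf le_rfl).mul (fexp_eqMod hg le_rfl)).symm)
  refine EqMod.trans ?_ (sum_mul_sum_eqMod _ _ (coeff_smul_pow_eq_zero _ hf)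
    (coeff_smul_pow_eq_zero _ hg) N).symm
  intro n _
  congr 1
  refine sum_congr rfl fun k _ => ?_
  rw [h.add_pow', smul_sum]
  refine sum_congr rfl fun p hp => ?_
  rw [HasAntidiagonal.mem_antidiagonal] at hp
  subst hp
  rw [smul_mul_smul_comm, ← Nat.cast_smul_eq_nsmul ℂ, smul_smul]
  congr 1
  have h1 : ((p.1 + p.2).choose p.1 : ℂ) * p.1.factorial * p.2.factorial =
      (p.1 + p.2).factorial := by
    rw [← Nat.add_choose_mul_factorial_mul_factorial p.1 p.2, Nat.choose_symm_add]
    push_cast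
    rfl
  have h2 : (p.1.factorial : ℂ) ≠ 0 := by exact_mod_cast p.1.factorial_ne_zero
  have h3 : (p.2.factorial : ℂ) ≠ 0 := by exact_mod_cast p.2.factorial_ne_zero
  have h4 : ((p.1 + p.2).factorial : ℂ) ≠ 0 := by exact_mod_cast (p.1 + p.2).factorial_ne_zero
  field_simp
  linear_combination h1

@[simp] theorem fexp_zero : fexp (0 : B⟦X⟧) = 1 := by
  refine eq_of_eqMod fun N => (fexp_eqMod (by simp) (Nat.le_succ N)).trans ?_
  rw [sum_range_succ']
  simp [EqMod]

theorem fexp_mul_fexp_neg {f : B⟦X⟧} (hf : constantCoeff f = 0) : fexp f * fexp (-f) = 1 := by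
  rw [← fexp_add hf (by simp [hf]) (Commute.refl f).neg_right, add_neg_cancel, fexp_zero]

theorem fexp_neg_mul_fexp {f : B⟦X⟧} (hf : constantCoeff f = 0) : fexp (-f) * fexp f = 1 := by
  simpa using fexp_mul_fexp_neg (f := -f) (by simp [hf])

theorem isUnit_fexp {f : B⟦X⟧} (hf : constantCoeff f = 0) : IsUnit (fexp f) :=
  ⟨⟨_, _, fexp_mul_fexp_neg hf, fexp_neg_mul_fexp hf⟩, rfl⟩

/-- A relation a f = g a passes to all powers and so to the truncated exponentials; a need not be
invertible. This is how coproducts are pushed through the factors of the chain. -/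
theorem semiconjBy_fexp {a f g : B⟦X⟧} (hf : constantCoeff f = 0) (hg : constantCoeff g = 0)
    (h : SemiconjBy a f g) : SemiconjBy a (fexp f) (fexp g) := by
  refine eq_of_eqMod fun N => ?_
  have r (x : B⟦X⟧) : EqMod N x x := fun _ _ => rfl
  refine ((r a).mul (fexp_eqMod hf le_rfl)).trans
    (EqMod.trans ?_ ((fexp_eqMod hg le_rfl).mul (r a)).symm)
  intro n _
  congr 1
  rw [mul_sum, sum_mul]
  refine sum_congr rfl fun k _ => ?_
  rw [mul_smul_comm, smul_mul_assoc, (h.pow_right k).eq]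

theorem commute_fexp {a f : B⟦X⟧} (hf : constantCoeff f = 0) (h : Commute a f) :
    Commute a (fexp f) :=
  semiconjBy_fexp hf hf h

theorem commute_fsub (c : ℕ → ℂ) {a f : B⟦X⟧} (hf : constantCoeff f = 0) (h : Commute a f) :
    Commute a (fsub c f) := by
  refine eq_of_eqMod fun N => ?_
  have r (x : B⟦X⟧) : EqMod N x x := fun _ _ => rfl
  refine ((r a).mul (fsub_eqMod c hf le_rfl)).trans
    (EqMod.trans ?_ ((fsub_eqMod c hf le_rfl).mul (r a)).symm)
  intro n _
  congr 1
  rw [mul_sum, sum_mul]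
  refine sum_congr rfl fun k _ => ?_
  rw [mul_smul_comm, smul_mul_assoc, (h.pow_right k).eq]

theorem commute_flog1p {a f : B⟦X⟧} (hf : constantCoeff f = 0) (h : Commute a f) :
    Commute a (flog1p f) := by
  rw [flog1p_eq_fsub]
  exact commute_fsub _ hf h

/-- Here c = [f,x], d = [f,c] and [f,d] = 0, so f^n x = x f^n + n c f^(n-1) + (n choose 2) d
f^(n-2). Dividing by n! turns the three terms into consecutive terms of the exponential series. -/
theorem pow_mul_unipotent {f x c d : B⟦X⟧} (hx : f * x = x * f + c) (hc : f * c = c * f + d)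
    (hd : Commute f d) (n : ℕ) :
    (((n + 2).factorial : ℂ)⁻¹) • f ^ (n + 2) * x =
      x * (((n + 2).factorial : ℂ)⁻¹) • f ^ (n + 2) +
        c * (((n + 1).factorial : ℂ)⁻¹) • f ^ (n + 1) +
        ((1 / 2 : ℂ) • d) * ((n.factorial : ℂ)⁻¹) • f ^ n := by
  have key : ∀ n : ℕ, f ^ (n + 2) * x = x * f ^ (n + 2) + ((n : ℂ) + 2) • (c * f ^ (n + 1)) +
      ((((n : ℂ) + 2) * (n + 1)) / 2) • (d * f ^ n) := by
    intro n
    have hxn : ∀ n : ℕ, f * (x * f ^ n) = x * f ^ (n + 1) + c * f ^ n := by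
      intro n
      rw [← mul_assoc, hx, add_mul, mul_assoc, ← pow_succ']
    have hcn : ∀ n : ℕ, f * (c * f ^ n) = c * f ^ (n + 1) + d * f ^ n := by
      intro n
      rw [← mul_assoc, hc, add_mul, mul_assoc, ← pow_succ']
    have hdn : ∀ n : ℕ, f * (d * f ^ n) = d * f ^ (n + 1) := by
      intro n
      rw [← mul_assoc, hd.eq, mul_assoc, ← pow_succ']
    induction n with
    | zero =>
      have := hxn 1
      have h2 := hcn 0
      simp only [pow_zero, mul_one, zero_add, pow_one, Nat.reduceAdd] at this h2 ⊢
      rw [pow_two, mul_assoc, hx, mul_add, this, h2, ← pow_two]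
      simp only [Nat.cast_zero, zero_add, mul_one]
      rw [div_self two_ne_zero, one_smul, two_smul]
      abel
    | succ n ih =>
      rw [pow_succ' f (n + 2), mul_assoc, ih, mul_add, mul_add, hxn, mul_smul_comm, hcn,
        mul_smul_comm, hdn, ← pow_succ']
      push_cast
      module
  rw [smul_mul_assoc, key]
  simp only [mul_smul_comm, smul_mul_assoc, smul_add, smul_smul]
  have h0 : (n.factorial : ℂ) ≠ 0 := by exact_mod_cast n.factorial_ne_zero
  have h1 : ((n : ℂ) + 1) ≠ 0 := by exact_mod_cast n.succ_ne_zero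
  have h2 : ((n : ℂ) + 2) ≠ 0 := by exact_mod_cast (n + 1).succ_ne_zero
  have e1 : ((n + 1).factorial : ℂ) = (n + 1) * n.factorial := by
    rw [Nat.factorial_succ]; push_cast; ring
  have e2 : ((n + 2).factorial : ℂ) = (n + 2) * ((n + 1) * n.factorial) := by
    rw [Nat.factorial_succ, Nat.cast_mul, e1]; push_cast; ring
  rw [e1, e2, show (((n : ℂ) + 2) * ((n + 1) * n.factorial))⁻¹ * (n + 2) =
      ((n + 1) * n.factorial : ℂ)⁻¹ by field_simp,
    show (((n : ℂ) + 2) * ((n + 1) * n.factorial))⁻¹ * ((n + 2) * (n + 1) / 2) =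
      (n.factorial : ℂ)⁻¹ * (1 / 2) by field_simp]

/-- The Hadamard formula for exp(ad f) x, which stops after the quadratic term because (ad f)³ x =
0. -/
theorem fexp_mul_unipotent {f x c d : B⟦X⟧} (hf : constantCoeff f = 0)
    (hx : f * x = x * f + c) (hc : f * c = c * f + d) (hd : Commute f d) :
    fexp f * x = (x + c + (1 / 2 : ℂ) • d) * fexp f := by
  refine eq_of_eqMod fun N => ?_
  have r (x : B⟦X⟧) : EqMod N x x := fun _ _ => rfl
  rw [add_mul, add_mul]
  -- The truncation lengths N+2, N+1 and N absorb the index shifts, so the two truncated sides agree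
  -- exactly and not only below order N.
  refine ((fexp_eqMod hf (K := N + 2) (by omega)).mul (r x)).trans (EqMod.trans ?_
    ((((r x).mul (fexp_eqMod hf (K := N + 2) (by omega))).add
      ((r c).mul (fexp_eqMod hf (K := N + 1) (by omega)))).add
      ((r _).mul (fexp_eqMod hf (K := N) le_rfl))).symm)
  intro n _
  congr 1
  rw [sum_range_succ', sum_range_succ', sum_range_succ' _ N]
  simp only [add_mul, mul_add, sum_mul, mul_sum, Nat.reduceAdd, zero_add, add_assoc]
  simp only [show ∀ n, n + (1 + 1) = n + 2 from fun _ => rfl, pow_mul_unipotent hx hc hd,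
    sum_add_distrib]
  simp [hx]
  abel

theorem fexp_mul_of_commutator {f x c : B⟦X⟧} (hf : constantCoeff f = 0)
    (hx : f * x = x * f + c) (hc : Commute f c) : fexp f * x = (x + c) * fexp f := by
  simpa using fexp_mul_unipotent (d := 0) hf hx (by simpa using hc.eq) (Commute.zero_right f)

/-- Induction on the order: as the constant terms vanish, a coefficient of f^k with k ≥ 2 involves
only coefficients of f of smaller order, so each coefficient of exp f determines the linear term. -/
theorem fexp_injective {f g : B⟦X⟧} (hf : constantCoeff f = 0) (hg : constantCoeff g = 0)
    (h : fexp f = fexp g) : f = g := by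
  have pw : ∀ N, EqMod N f g → ∀ k, 2 ≤ k → EqMod (N + 1) (f ^ k) (g ^ k) := by
    intro N hN k hk
    have hp : ∀ k, EqMod N (f ^ k) (g ^ k) := by
      intro k
      induction k with
      | zero => intro n _; simp
      | succ k ih => rw [pow_succ, pow_succ]; exact ih.mul hN
    obtain ⟨k, rfl⟩ := Nat.exists_eq_add_of_le' hk
    intro n hn
    rw [pow_succ, pow_succ g, coeff_mul, coeff_mul]
    refine sum_congr rfl fun p hpm => ?_
    rw [HasAntidiagonal.mem_antidiagonal] at hpm
    by_cases h0 : p.2 = 0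
    · rw [h0, coeff_zero_eq_constantCoeff_apply, coeff_zero_eq_constantCoeff_apply, hf, hg,
        mul_zero, mul_zero]
    · by_cases h1 : p.1 = 0
      · rw [h1, coeff_pow_eq_zero hf (by omega), coeff_pow_eq_zero hg (by omega),
          zero_mul, zero_mul]
      · rw [hp _ _ (by omega), hN _ (by omega)]
  refine eq_of_eqMod fun N => ?_
  induction N with
  | zero => intro n hn; omega
  | succ N ih =>
    intro n hn
    have e := congrArg (coeff n) h
    rcases Nat.eq_zero_or_pos n with rfl | hpos
    · simp [hf, hg]
    obtain ⟨n, rfl⟩ := Nat.exists_eq_add_of_le' hpos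
    rw [fexp, fexp, coeff_mk, coeff_mk, sum_range_succ', sum_range_succ', sum_range_succ' _ (n + 1),
      sum_range_succ' _ n, sum_congr rfl fun k _ => by
        rw [pw N ih (k + 1 + 1) (by omega) (n + 1) hn]] at e
    simpa using e

theorem map_fexp (φ : B →ₐ[ℂ] C) (f : B⟦X⟧) : hExt φ (fexp f) = fexp (hExt φ f) := by
  ext n
  have hc (g : B⟦X⟧) (m : ℕ) : coeff m (hExt φ g) = φ (coeff m g) := by
    rw [hExt, mapAlgHom_apply]; exact coeff_map _ _ _
  rw [hc]
  simp only [fexp, coeff_mk, map_sum, map_smul, ← map_pow, hc]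

theorem coeff_hExt (φ : B →ₐ[ℂ] C) (f : B⟦X⟧) (n : ℕ) : coeff n (hExt φ f) = φ (coeff n f) := by
  rw [hExt, mapAlgHom_apply]
  exact coeff_map _ _ _

@[simp] theorem constantCoeff_hExt (φ : B →ₐ[ℂ] C) (f : B⟦X⟧) :
    constantCoeff (hExt φ f) = φ (constantCoeff f) := by
  simpa using coeff_hExt φ f 0

theorem map_flog1p (φ : B →ₐ[ℂ] C) (f : B⟦X⟧) : hExt φ (flog1p f) = flog1p (hExt φ f) := by
  ext n
  rw [coeff_hExt]
  simp only [flog1p, coeff_mk, map_sum, map_smul, ← map_pow, coeff_hExt]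

@[simp] theorem hExt_X (φ : B →ₐ[ℂ] C) : hExt φ (X : B⟦X⟧) = X := by
  rw [hExt, mapAlgHom_apply]
  exact PowerSeries.map_X _

@[simp] theorem hExt_C (φ : B →ₐ[ℂ] C) (b : B) : hExt φ (PowerSeries.C b) = PowerSeries.C (φ b) := by
  rw [hExt, mapAlgHom_apply]
  exact PowerSeries.map_C _ _

theorem hExt_hExt {D : Type*} [Ring D] [Algebra ℂ D] (ψ : C →ₐ[ℂ] D) (φ : B →ₐ[ℂ] C) (f : B⟦X⟧) :
    hExt ψ (hExt φ f) = hExt (ψ.comp φ) f := by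
  ext n
  simp [coeff_hExt]

/-- Substituting f is multiplicative in the scalar series, since powers of one element commute.
Identities between scalar series therefore transfer to noncommutative coefficients. -/
theorem fsub_mul (a b : ℂ⟦X⟧) {f : B⟦X⟧} (hf : constantCoeff f = 0) :
    fsub (fun k => coeff k (a * b)) f =
      fsub (fun k => coeff k a) f * fsub (fun k => coeff k b) f := by
  refine eq_of_eqMod fun N => (fsub_eqMod _ hf le_rfl).trans (EqMod.trans ?_
    ((fsub_eqMod _ hf le_rfl).mul (fsub_eqMod _ hf le_rfl)).symm)
  refine EqMod.trans ?_ (sum_mul_sum_eqMod _ _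
    (coeff_smul_pow_eq_zero (fun k => coeff k a) hf)
    (coeff_smul_pow_eq_zero (fun k => coeff k b) hf) N).symm
  intro n _
  congr 1
  refine sum_congr rfl fun k _ => ?_
  rw [coeff_mul, sum_smul]
  refine sum_congr rfl fun p hp => ?_
  rw [HasAntidiagonal.mem_antidiagonal] at hp
  rw [smul_mul_smul_comm, ← pow_add, hp]

theorem fsub_one (f : B⟦X⟧) : fsub (fun k => coeff k (1 : ℂ⟦X⟧)) f = 1 := by
  ext n
  simp [fsub, coeff_one]

theorem fsub_pow (a : ℂ⟦X⟧) {f : B⟦X⟧} (hf : constantCoeff f = 0) (n : ℕ) :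
    fsub (fun k => coeff k (a ^ n)) f = fsub (fun k => coeff k a) f ^ n := by
  induction n with
  | zero => simpa using fsub_one f
  | succ n ih => rw [pow_succ, fsub_mul _ _ hf, ih, pow_succ]

theorem fexp_fsub (b : ℂ⟦X⟧) (hb : constantCoeff b = 0) {f : B⟦X⟧} (hf : constantCoeff f = 0) :
    fexp (fsub (fun k => coeff k b) f) = fsub (fun k => coeff k (fexp b)) f := by
  ext n
  rw [fexp, coeff_mk]
  simp only [← fsub_pow b hf]
  simp only [fsub, coeff_mk, smul_sum, smul_smul]
  rw [sum_comm]
  refine sum_congr rfl fun j hj => ?_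
  rw [← sum_smul, fexp_eqMod hb (N := j + 1) (K := n + 1) (by simpa using hj) j j.lt_succ_self,
    map_sum]
  simp

theorem derivative_fexp (b : ℂ⟦X⟧) (hb : constantCoeff b = 0) :
    PowerSeries.derivative ℂ (fexp b) = PowerSeries.derivative ℂ b * fexp b := by
  refine eq_of_eqMod fun N => ?_
  have h : EqMod N (PowerSeries.derivative ℂ (fexp b))
      (PowerSeries.derivative ℂ (∑ k ∈ range (N + 1), ((k.factorial : ℂ)⁻¹) • b ^ k)) := by
    intro n hn
    rw [coeff_derivative, coeff_derivative, fexp_eqMod hb (N := N + 1) le_rfl _ (by omega)]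
  refine h.trans (EqMod.trans ?_ (EqMod.mul (fun _ _ => rfl) (fexp_eqMod hb le_rfl)).symm)
  intro n _
  congr 1
  rw [sum_range_succ', map_add, map_sum, mul_sum]
  simp only [pow_zero, Nat.factorial_zero, Nat.cast_one, inv_one, one_smul]
  have : PowerSeries.derivative ℂ (1 : ℂ⟦X⟧) = 0 := Derivation.map_one_eq_zero _
  rw [this, add_zero]
  refine sum_congr rfl fun k _ => ?_
  have h0 : (k.factorial : ℂ) ≠ 0 := by exact_mod_cast k.factorial_ne_zero
  have h1 : ((k : ℂ) + 1) ≠ 0 := by exact_mod_cast k.succ_ne_zero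
  rw [(PowerSeries.derivative ℂ).map_smul, Derivation.leibniz_pow,
    ← Nat.cast_smul_eq_nsmul ℂ, smul_smul, Nat.factorial_succ, mul_smul_comm]
  simp only [smul_eq_mul, Nat.add_sub_cancel]
  rw [mul_comm (b ^ k)]
  congr 1
  push_cast
  field_simp

/-- The power series of `ln (1 + X)`. -/
noncomputable def logSeries : ℂ⟦X⟧ := PowerSeries.mk fun k => (-1 : ℂ) ^ (k + 1) / (k : ℂ)

/-- The series y = exp(ln(1+X)) solves (1+X) y' = y; comparing coefficients kills everything from
degree 2 on. -/
theorem fexp_logSeries : fexp logSeries = 1 + X := by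
  have h0 : constantCoeff logSeries = 0 := by
    rw [← coeff_zero_eq_constantCoeff_apply, logSeries, coeff_mk]
    simp
  have hd : (1 + X) * PowerSeries.derivative ℂ logSeries = 1 := by
    ext n
    rw [add_mul, one_mul, map_add]
    cases n with
    | zero => simp [logSeries, coeff_derivative, coeff_zero_X_mul]
    | succ n =>
      rw [coeff_succ_X_mul, coeff_derivative, coeff_derivative, logSeries, coeff_mk, coeff_mk]
      have h1 : ((n : ℂ) + 1) ≠ 0 := by exact_mod_cast n.succ_ne_zero
      have h2 : ((n : ℂ) + 1 + 1) ≠ 0 := by exact_mod_cast (n + 1).succ_ne_zero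
      push_cast
      rw [div_mul_cancel₀ _ h1, div_mul_cancel₀ _ h2, coeff_one, if_neg (by omega)]
      ring
  have he : (1 + X) * PowerSeries.derivative ℂ (fexp logSeries) = fexp logSeries := by
    rw [derivative_fexp _ h0, ← mul_assoc, hd, one_mul]
  have hrec : ∀ n : ℕ, coeff (n + 2) (fexp logSeries) * (n + 2) + coeff (n + 1) (fexp logSeries) * n
      = 0 := by
    intro n
    have := congrArg (coeff (n + 1)) he
    rw [add_mul, one_mul, map_add, coeff_succ_X_mul, coeff_derivative, coeff_derivative] at this
    push_cast at this
    linear_combination this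
  have h2 : ∀ n : ℕ, coeff (n + 2) (fexp logSeries) = 0 := by
    intro n
    induction n with
    | zero =>
      have := hrec 0
      simpa using this
    | succ n ih =>
      have := hrec (n + 1)
      have hn : (((n + 1 : ℕ) : ℂ) + 2) ≠ 0 := by exact_mod_cast (n + 2).succ_ne_zero
      rw [ih, zero_mul, add_zero] at this
      exact (mul_eq_zero.1 this).resolve_right hn
  ext n
  match n with
  | 0 => simp
  | 1 => rw [coeff_one_fexp]; simp [logSeries, coeff_one]
  | n + 2 => rw [h2]; simp [coeff_one, coeff_X]

theorem fexp_flog1p {f : B⟦X⟧} (hf : constantCoeff f = 0) : fexp (flog1p f) = 1 + f := by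
  have h0 : constantCoeff logSeries = 0 := by
    rw [← coeff_zero_eq_constantCoeff_apply, logSeries, coeff_mk]
    simp
  have : flog1p f = fsub (fun k => coeff k logSeries) f := by
    rw [flog1p_eq_fsub]
    simp [logSeries]
  rw [this, fexp_fsub _ h0 hf, fexp_logSeries]
  ext n
  cases n with
  | zero => simp [fsub, coeff_one, coeff_X, hf]
  | succ n =>
    rw [fsub, coeff_mk, sum_range_succ', sum_range_succ']
    simp [coeff_X, coeff_one]

end PowerSeriesCalculus
-- Structure maps on the completed tensor powers and permutations of the tensor legs.
section HopfStructure

open PowerSeries Algebra.TensorProduct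

variable {M : ℕ}

theorem commute_hExt {B C D : Type*} [Ring B] [Algebra ℂ B] [Ring C] [Algebra ℂ C] [Ring D]
    [Algebra ℂ D] {φ : B →ₐ[ℂ] D} {ψ : C →ₐ[ℂ] D} (h : ∀ b c, Commute (φ b) (ψ c))
    (f : B⟦X⟧) (g : C⟦X⟧) : Commute (hExt φ f) (hExt ψ g) := by
  ext n
  rw [coeff_mul, coeff_mul, ← Finset.Nat.sum_antidiagonal_swap]
  refine Finset.sum_congr rfl fun p _ => ?_
  simp only [Prod.fst_swap, Prod.snd_swap, coeff_hExt]
  exact (h _ _).eq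

section UniversalProperty

attribute [local instance 100] LieRing.ofAssociativeRing

theorem U_hom_ext {D : Type*} [Ring D] [Algebra ℂ D] {φ ψ : U M →ₐ[ℂ] D}
    (h : ∀ x, φ (ι x) = ψ (ι x)) : φ = ψ :=
  UniversalEnvelopingAlgebra.hom_ext ℂ (LieHom.ext h)

theorem ι_mul_ι_sub (x y : so M) : ι x * ι y - ι y * ι x = ι ⁅x, y⁆ := by
  simp [ι, LieRing.of_associative_ring_bracket]

@[simp] theorem comul_ι (x : so M) : comul M (ι x) = ι x ⊗ₜ[ℂ] 1 + 1 ⊗ₜ[ℂ] ι x :=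
  UniversalEnvelopingAlgebra.lift_ι_apply ℂ (comulLie M) x

@[simp] theorem counit_ι (x : so M) : counit M (ι x) = 0 :=
  UniversalEnvelopingAlgebra.lift_ι_apply ℂ (0 : so M →ₗ⁅ℂ⁆ ℂ) x

end UniversalProperty

/-- By the universal property, identities between structure maps need only be checked on elements of
the Lie algebra placed in one leg. -/
theorem U2_hom_ext {D : Type*} [Ring D] [Algebra ℂ D] {φ ψ : U2 M →ₐ[ℂ] D}
    (h : ∀ x, φ (ι x ⊗ₜ 1) = ψ (ι x ⊗ₜ 1)) (h' : ∀ x, φ (1 ⊗ₜ ι x) = ψ (1 ⊗ₜ ι x)) : φ = ψ := by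
  refine Algebra.TensorProduct.ext ?_ ?_
  · exact U_hom_ext h
  · exact U_hom_ext h'

/-- `f ↦ f ⊗ 1`. -/
noncomputable def inc1 : (U M)⟦X⟧ →ₐ[ℂ] (U2 M)⟦X⟧ :=
  hExt (includeLeft : U M →ₐ[ℂ] U2 M)

/-- `f ↦ 1 ⊗ f`. -/
noncomputable def inc2 : (U M)⟦X⟧ →ₐ[ℂ] (U2 M)⟦X⟧ :=
  hExt (includeRight : U M →ₐ[ℂ] U2 M)

/-- `f ↦ f ⊗ 1 ⊗ 1`. -/
noncomputable def pos1 : (U M)⟦X⟧ →ₐ[ℂ] (U3 M)⟦X⟧ :=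
  hExt (includeLeft : U M →ₐ[ℂ] U3 M)

/-- `f ↦ 1 ⊗ f ⊗ 1`. -/
noncomputable def pos2 : (U M)⟦X⟧ →ₐ[ℂ] (U3 M)⟦X⟧ :=
  hExt ((includeRight : U2 M →ₐ[ℂ] U3 M).comp includeLeft)

/-- `f ↦ 1 ⊗ 1 ⊗ f`. -/
noncomputable def pos3 : (U M)⟦X⟧ →ₐ[ℂ] (U3 M)⟦X⟧ :=
  hExt ((includeRight : U2 M →ₐ[ℂ] U3 M).comp includeRight)

theorem tens_eq (f g : (U M)⟦X⟧) : tens f g = inc1 f * inc2 g := rfl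

theorem commute_inc (f g : (U M)⟦X⟧) : Commute (inc1 f) (inc2 g) :=
  commute_hExt (fun b c => by simp [Commute, SemiconjBy]) f g

theorem commute_pos12 (f g : (U M)⟦X⟧) : Commute (pos1 f) (pos2 g) :=
  commute_hExt (fun b c => by simp [Commute, SemiconjBy]) f g

theorem commute_pos13 (f g : (U M)⟦X⟧) : Commute (pos1 f) (pos3 g) :=
  commute_hExt (fun b c => by simp [Commute, SemiconjBy]) f g

theorem commute_pos23 (f g : (U M)⟦X⟧) : Commute (pos2 f) (pos3 g) :=
  commute_hExt (fun b c => by simp [Commute, SemiconjBy]) f g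

theorem commute_leg12_pos3 (f : (U2 M)⟦X⟧) (g : (U M)⟦X⟧) : Commute (leg12 M f) (pos3 g) := by
  refine commute_hExt (fun b c => ?_) f g
  induction b using TensorProduct.induction_on with
  | zero => simp
  | tmul x y => simp [Commute, SemiconjBy]
  | add x y hx hy => rw [map_add]; exact hx.add_left hy

theorem commute_pos1_leg23 (f : (U M)⟦X⟧) (g : (U2 M)⟦X⟧) : Commute (pos1 f) (leg23 M g) :=
  commute_hExt (fun b c => by simp [Commute, SemiconjBy]) f g

@[simp] theorem leg12_inc1 (f : (U M)⟦X⟧) : leg12 M (inc1 f) = pos1 f := by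
  rw [leg12, inc1, pos1, hExt_hExt]
  congr 1

@[simp] theorem leg12_inc2 (f : (U M)⟦X⟧) : leg12 M (inc2 f) = pos2 f := by
  rw [leg12, inc2, pos2, hExt_hExt]
  congr 1

@[simp] theorem leg23_inc1 (f : (U M)⟦X⟧) : leg23 M (inc1 f) = pos2 f := by
  rw [leg23, inc1, pos2, hExt_hExt]

@[simp] theorem leg23_inc2 (f : (U M)⟦X⟧) : leg23 M (inc2 f) = pos3 f := by
  rw [leg23, inc2, pos3, hExt_hExt]

@[simp] theorem DeltaId_inc1 (f : (U M)⟦X⟧) : DeltaId M (inc1 f) = leg12 M (Delta M f) := by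
  rw [DeltaId, inc1, leg12, Delta, hExt_hExt, hExt_hExt]
  congr 1
  refine congrArg _ (U_hom_ext fun x => ?_)
  simp [TensorProduct.add_tmul]

@[simp] theorem DeltaId_inc2 (f : (U M)⟦X⟧) : DeltaId M (inc2 f) = pos3 f := by
  rw [DeltaId, inc2, pos3, hExt_hExt]
  congr 1
  refine congrArg _ (U_hom_ext fun x => ?_)
  simp [one_def]

@[simp] theorem idDelta_inc1 (f : (U M)⟦X⟧) : idDelta M (inc1 f) = pos1 f := by
  rw [idDelta, inc1, pos1, hExt_hExt]
  congr 1
  refine congrArg _ (U_hom_ext fun x => ?_)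
  simp

@[simp] theorem idDelta_inc2 (f : (U M)⟦X⟧) : idDelta M (inc2 f) = leg23 M (Delta M f) := by
  rw [idDelta, inc2, leg23, Delta, hExt_hExt, hExt_hExt]
  congr 1

theorem DeltaId_Delta (f : (U M)⟦X⟧) : DeltaId M (Delta M f) = idDelta M (Delta M f) := by
  rw [DeltaId, idDelta, Delta, hExt_hExt, hExt_hExt]
  refine congrArg (fun φ => hExt φ f) (U_hom_ext fun x => ?_)
  simp [TensorProduct.add_tmul, TensorProduct.tmul_add, one_def, add_assoc]

@[simp] theorem flip21_Delta (f : (U M)⟦X⟧) : flip21 M (Delta M f) = Delta M f := by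
  rw [flip21, Delta, hExt_hExt]
  refine congrArg (fun φ => hExt φ f) (U_hom_ext fun x => ?_)
  simp [add_comm]

theorem flip21_flip21 (f : (U2 M)⟦X⟧) : flip21 M (flip21 M f) = f := by
  ext n
  rw [flip21, hExt_hExt, coeff_hExt]
  exact (Algebra.TensorProduct.comm ℂ (U M) (U M)).symm_apply_apply (coeff n f)

theorem epsId_Delta (f : (U M)⟦X⟧) : epsId M (Delta M f) = f := by
  rw [epsId, Delta, hExt_hExt]
  ext n
  rw [coeff_hExt]
  refine congrArg (fun φ : U M →ₐ[ℂ] U M => φ (coeff n f)) (U_hom_ext (ψ := AlgHom.id ℂ _) fun x => ?_)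
  simp

theorem idEps_Delta (f : (U M)⟦X⟧) : idEps M (Delta M f) = f := by
  rw [idEps, Delta, hExt_hExt]
  ext n
  rw [coeff_hExt]
  refine congrArg (fun φ : U M →ₐ[ℂ] U M => φ (coeff n f)) (U_hom_ext (ψ := AlgHom.id ℂ _) fun x => ?_)
  simp

theorem epsId_inc1 {f : (U M)⟦X⟧} (hf : hExt (counit M) f = 0) : epsId M (inc1 f) = 0 := by
  rw [epsId, inc1, hExt_hExt]
  ext n
  have := congrArg (coeff n) hf
  rw [coeff_hExt] at this ⊢
  simp at this
  simp [this]

theorem idEps_inc2 {f : (U M)⟦X⟧} (hf : hExt (counit M) f = 0) : idEps M (inc2 f) = 0 := by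
  rw [idEps, inc2, hExt_hExt]
  ext n
  have := congrArg (coeff n) hf
  rw [coeff_hExt] at this ⊢
  simp at this
  simp [this]

@[simp] theorem Delta_gen (x : so M) : Delta M (gen x) = inc1 (gen x) + inc2 (gen x) := by
  rw [Delta, inc1, inc2, gen, hExt_C, hExt_C, hExt_C, ← map_add]
  simp

@[simp] theorem counit_gen (x : so M) : hExt (counit M) (gen x) = 0 := by
  simp [gen]

/-- The cyclic permutation `a ⊗ b ⊗ c ↦ b ⊗ c ⊗ a`. -/
noncomputable def cyc : (U3 M)⟦X⟧ →ₐ[ℂ] (U3 M)⟦X⟧ :=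
  hExt ((Algebra.TensorProduct.assoc ℂ ℂ ℂ (U M) (U M) (U M)).toAlgHom.comp
    (Algebra.TensorProduct.comm ℂ (U M) (U2 M)).toAlgHom)

/-- The transposition `a ⊗ b ⊗ c ↦ a ⊗ c ⊗ b`. -/
noncomputable def swap23 : (U3 M)⟦X⟧ →ₐ[ℂ] (U3 M)⟦X⟧ :=
  hExt (Algebra.TensorProduct.map (AlgHom.id ℂ (U M))
    (Algebra.TensorProduct.comm ℂ (U M) (U M)).toAlgHom)

/-- The transposition `a ⊗ b ⊗ c ↦ b ⊗ a ⊗ c`. -/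
noncomputable def swap12 : (U3 M)⟦X⟧ →ₐ[ℂ] (U3 M)⟦X⟧ :=
  hExt (Algebra.TensorProduct.leftComm ℂ (U M) (U M) (U M)).toAlgHom

section Permutations

variable (F : (U2 M)⟦X⟧)

theorem cyc_leg12 : cyc (leg12 M F) = leg13 M (flip21 M F) := by
  rw [cyc, leg12, leg13, flip21, hExt_hExt, hExt_hExt]
  refine congrArg (fun φ => hExt φ F) (U2_hom_ext (fun x => ?_) fun x => ?_) <;> simp

theorem cyc_leg23 : cyc (leg23 M F) = leg12 M F := by
  rw [cyc, leg12, leg23, hExt_hExt]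
  refine congrArg (fun φ => hExt φ F) (U2_hom_ext (fun x => ?_) fun x => ?_) <;> simp

theorem cyc_leg13_flip : cyc (leg13 M (flip21 M F)) = leg23 M F := by
  rw [cyc, leg13, leg23, flip21, hExt_hExt, hExt_hExt]
  refine congrArg (fun φ => hExt φ F) (U2_hom_ext (fun x => ?_) fun x => ?_) <;> simp

theorem cyc_idDelta : cyc (idDelta M F) = DeltaId M (flip21 M F) := by
  rw [cyc, idDelta, DeltaId, flip21, hExt_hExt, hExt_hExt]
  refine congrArg (fun φ => hExt φ F) (U2_hom_ext (fun x => ?_) fun x => ?_) <;>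
    simp [one_def, TensorProduct.tmul_add, TensorProduct.add_tmul]

/-- Cocommutativity: the two permutations differ by exchanging the first two legs of the argument,
which fixes the image of Δ ⊗ id. -/
theorem cyc_DeltaId : cyc (DeltaId M F) = swap23 (DeltaId M F) := by
  rw [cyc, DeltaId, swap23, hExt_hExt, hExt_hExt]
  refine congrArg (fun φ => hExt φ F) (U2_hom_ext (fun x => ?_) fun x => ?_) <;>
    simp [one_def, TensorProduct.add_tmul, add_comm]

theorem cyc_cyc_DeltaId : cyc (cyc (DeltaId M F)) = idDelta M (flip21 M F) := by
  rw [cyc, DeltaId, idDelta, flip21, hExt_hExt, hExt_hExt, hExt_hExt]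
  refine congrArg (fun φ => hExt φ F) (U2_hom_ext (fun x => ?_) fun x => ?_) <;>
    simp [one_def, TensorProduct.tmul_add, TensorProduct.add_tmul]

/-- Again cocommutativity, now in the last two legs. -/
theorem cyc_cyc_idDelta : cyc (cyc (idDelta M F)) = swap12 (idDelta M F) := by
  rw [cyc, idDelta, swap12, hExt_hExt, hExt_hExt, hExt_hExt]
  refine congrArg (fun φ => hExt φ F) (U2_hom_ext (fun x => ?_) fun x => ?_) <;>
    simp [one_def, TensorProduct.tmul_add, add_comm]

theorem swap23_leg12 : swap23 (leg12 M F) = leg13 M F := by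
  rw [swap23, leg12, leg13, hExt_hExt]
  refine congrArg (fun φ => hExt φ F) (U2_hom_ext (fun x => ?_) fun x => ?_) <;> simp

theorem swap23_leg23 : swap23 (leg23 M F) = leg23 M (flip21 M F) := by
  rw [swap23, leg23, flip21, hExt_hExt, hExt_hExt]
  refine congrArg (fun φ => hExt φ F) (U2_hom_ext (fun x => ?_) fun x => ?_) <;> simp

theorem swap23_idDelta : swap23 (idDelta M F) = idDelta M F := by
  rw [swap23, idDelta, hExt_hExt]
  refine congrArg (fun φ => hExt φ F) (U2_hom_ext (fun x => ?_) fun x => ?_) <;>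
    simp [one_def, TensorProduct.tmul_add, add_comm]

theorem swap12_leg12 : swap12 (leg12 M F) = leg12 M (flip21 M F) := by
  rw [swap12, leg12, flip21, hExt_hExt, hExt_hExt]
  refine congrArg (fun φ => hExt φ F) (U2_hom_ext (fun x => ?_) fun x => ?_) <;> simp

theorem swap12_leg23 : swap12 (leg23 M F) = leg13 M F := by
  rw [swap12, leg23, leg13, hExt_hExt]
  refine congrArg (fun φ => hExt φ F) (U2_hom_ext (fun x => ?_) fun x => ?_) <;> simp

theorem swap12_DeltaId : swap12 (DeltaId M F) = DeltaId M F := by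
  rw [swap12, DeltaId, hExt_hExt]
  refine congrArg (fun φ => hExt φ F) (U2_hom_ext (fun x => ?_) fun x => ?_) <;>
    simp [one_def, TensorProduct.add_tmul, add_comm]

end Permutations

end HopfStructure
-- Triangularity of twisted coproducts, composition of twists, and twisted-primitive elements.
section Twists

open PowerSeries

variable {M : ℕ}

/-! ### Consequences of the twist equation -/

theorem mul_inverse_map {B C : Type*} [Ring B] [Ring C] (φ : B →+* C) {a : B} (ha : IsUnit a) :
    φ a * φ (Ring.inverse a) = 1 := by
  rw [← map_mul, Ring.mul_inverse_cancel _ ha, map_one]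

theorem inverse_mul_map {B C : Type*} [Ring B] [Ring C] (φ : B →+* C) {a : B} (ha : IsUnit a) :
    φ (Ring.inverse a) * φ a = 1 := by
  rw [← map_mul, Ring.inverse_mul_cancel _ ha, map_one]

/-- From `a * b = c * d` the corresponding relation between inverses. -/
theorem inverse_mul_inverse_eq {R : Type*} [Ring R] {a b c d a' b' c' d' : R} (h : a * b = c * d)
    (ha : a * a' = 1) (hb : b * b' = 1) (hc : c' * c = 1) (hd : d' * d = 1) :
    b' * a' = d' * c' := by
  calc b' * a' = d' * (c' * c) * d * (b' * a') := by rw [hc, mul_one, hd, one_mul]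
    _ = d' * c' * (c * d) * (b' * a') := by noncomm_ring
    _ = d' * c' * (a * (b * b') * a') := by rw [← h]; noncomm_ring
    _ = d' * c' := by rw [hb, mul_one, ha, mul_one]

/-- Everything follows from the twist equation, its inverse, and the images of the equation under
permutations of the legs, which are again equations in F because Δ is cocommutative. -/
theorem isTriangular_universalR {F : (U2 M)⟦X⟧} (hF : IsTwist F) :
    IsTriangular F (universalR F) := by
  have u := hF.isUnit
  set F' := Ring.inverse F with hF'
  have r (φ : (U2 M)⟦X⟧ →ₐ[ℂ] (U3 M)⟦X⟧) : φ F * φ F' = 1 := mul_inverse_map φ.toRingHom u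
  have l (φ : (U2 M)⟦X⟧ →ₐ[ℂ] (U3 M)⟦X⟧) : φ F' * φ F = 1 := inverse_mul_map φ.toRingHom u
  have r' : F * F' = 1 := Ring.mul_inverse_cancel _ u
  have l' : F' * F = 1 := Ring.inverse_mul_cancel _ u
  have rf : flip21 M F * flip21 M F' = 1 := by rw [← map_mul, r', map_one]
  have lf : flip21 M F' * flip21 M F = 1 := by rw [← map_mul, l', map_one]
  have T := hF.twist_eq
  have Tinv : DeltaId M F' * leg12 M F' = idDelta M F' * leg23 M F' :=
    inverse_mul_inverse_eq T (r _) (r _) (l _) (l _)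
  refine ⟨fun x => ?_, fun x => ?_, fun x => ?_, fun x => ?_, ?_, ?_, ?_⟩
  · simp only [twistedDeltaId, idTwistedDelta, twistedDelta, ← hF', map_mul]
    calc _ = (leg12 M F * DeltaId M F) * DeltaId M (Delta M x) * (DeltaId M F' * leg12 M F') := by
          noncomm_ring
      _ = (leg23 M F * idDelta M F) * idDelta M (Delta M x) * (idDelta M F' * leg23 M F') := by
          rw [T, Tinv, DeltaId_Delta]
      _ = _ := by noncomm_ring
  · rw [twistedDelta, map_mul, map_mul, hF.eps_left, one_mul, epsId_Delta]
    have : epsId M F * epsId M F' = 1 := by rw [← map_mul, r', map_one]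
    rw [hF.eps_left, one_mul] at this
    rw [← hF', this, mul_one]
  · rw [twistedDelta, map_mul, map_mul, hF.eps_right, one_mul, idEps_Delta]
    have : idEps M F * idEps M F' = 1 := by rw [← map_mul, r', map_one]
    rw [hF.eps_right, one_mul] at this
    rw [← hF', this, mul_one]
  · simp only [universalR, twistedDelta, ← hF', map_mul, flip21_Delta]
    calc _ = flip21 M F * (F' * F) * Delta M x * F' := by noncomm_ring
      _ = flip21 M F * Delta M x * (flip21 M F' * flip21 M F) * F' := by rw [l', lf]; noncomm_ring
      _ = _ := by noncomm_ring
  -- The cyclic image trades F₁₂ (Δ ⊗ id)F₂₁ for a product starting with F₃₁; the transposed image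
  -- then eliminates the remaining permuted coproduct in favour of F₁₃⁻¹ F₃₂.
  · have T1 := congrArg cyc T
    rw [map_mul, map_mul, cyc_leg12, cyc_leg23, cyc_idDelta, cyc_DeltaId] at T1
    have T2 := congrArg swap23 T
    rw [map_mul, map_mul, swap23_leg12, swap23_leg23, swap23_idDelta] at T2
    have T3 : swap23 (DeltaId M F) * idDelta M F' = leg13 M F' * leg23 M (flip21 M F) := by
      calc _ = leg13 M F' * leg13 M F * swap23 (DeltaId M F) * idDelta M F' := by
            rw [l, one_mul]
        _ = leg13 M F' * (leg23 M (flip21 M F) * idDelta M F) * idDelta M F' := by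
            rw [← T2]; noncomm_ring
        _ = leg13 M F' * leg23 M (flip21 M F) * (idDelta M F * idDelta M F') := by noncomm_ring
        _ = _ := by rw [r, mul_one]
    simp only [twistedDeltaId, universalR, ← hF', map_mul]
    calc _ = (leg12 M F * DeltaId M (flip21 M F)) * (DeltaId M F' * leg12 M F') := by noncomm_ring
      _ = leg13 M (flip21 M F) * (swap23 (DeltaId M F) * idDelta M F') * leg23 M F' := by
          rw [← T1, Tinv]; noncomm_ring
      _ = _ := by rw [T3]; noncomm_ring
  -- The mirror argument, with the inverse cyclic permutation and the transposition of the first two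
  -- legs.
  · have T1 := congrArg (fun f => cyc (cyc f)) T
    simp only [map_mul, cyc_leg12, cyc_leg23, cyc_leg13_flip, cyc_cyc_DeltaId,
      cyc_cyc_idDelta] at T1
    have T2 := congrArg swap12 T
    rw [map_mul, map_mul, swap12_leg12, swap12_leg23, swap12_DeltaId] at T2
    have T3 : swap12 (idDelta M F) * DeltaId M F' = leg13 M F' * leg12 M (flip21 M F) := by
      calc _ = leg13 M F' * leg13 M F * swap12 (idDelta M F) * DeltaId M F' := by
            rw [l, one_mul]
        _ = leg13 M F' * (leg12 M (flip21 M F) * DeltaId M F) * DeltaId M F' := by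
            rw [T2]; noncomm_ring
        _ = leg13 M F' * leg12 M (flip21 M F) * (DeltaId M F * DeltaId M F') := by noncomm_ring
        _ = _ := by rw [r, mul_one]
    simp only [idTwistedDelta, universalR, ← hF', map_mul]
    calc _ = (leg23 M F * idDelta M (flip21 M F)) * (idDelta M F' * leg23 M F') := by noncomm_ring
      _ = leg13 M (flip21 M F) * (swap12 (idDelta M F) * DeltaId M F') * leg12 M F' := by
          rw [T1, ← Tinv]; noncomm_ring
      _ = _ := by rw [T3]; noncomm_ring
  · simp only [universalR, ← hF', map_mul, flip21_flip21]
    calc _ = F * (flip21 M F' * flip21 M F) * F' := by noncomm_ring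
      _ = 1 := by rw [lf, mul_one, r']

theorem isTwist_one : IsTwist (1 : (U2 M)⟦X⟧) :=
  ⟨isUnit_one, by simp, by simp, by simp⟩

/-- `D` and `E` stand for (Δ_F ⊗ id)Φ and (id ⊗ Δ_F)Φ, so `h` is the twist equation of Φ for the
coproduct Δ_F. -/
theorem IsTwist.mul {F Φ : (U2 M)⟦X⟧} (hF : IsTwist F) (hΦ : IsUnit Φ) {D E : (U3 M)⟦X⟧}
    (hD : SemiconjBy (leg12 M F) (DeltaId M Φ) D) (hE : SemiconjBy (leg23 M F) (idDelta M Φ) E)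
    (h : leg12 M Φ * D = leg23 M Φ * E) (h1 : epsId M Φ = 1) (h2 : idEps M Φ = 1) :
    IsTwist (Φ * F) := by
  refine ⟨hΦ.mul hF.isUnit, ?_, by rw [map_mul, h1, hF.eps_left, one_mul],
    by rw [map_mul, h2, hF.eps_right, one_mul]⟩
  simp only [map_mul]
  calc _ = leg12 M Φ * (leg12 M F * DeltaId M Φ) * DeltaId M F := by noncomm_ring
    _ = leg12 M Φ * D * (leg12 M F * DeltaId M F) := by rw [hD.eq]; noncomm_ring
    _ = leg23 M Φ * (E * leg23 M F) * idDelta M F := by rw [h, hF.twist_eq]; noncomm_ring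
    _ = _ := by rw [← hE.eq]; noncomm_ring

/-! ### Elementary tensors -/

@[simp] theorem constantCoeff_inc1 (f : (U M)⟦X⟧) :
    constantCoeff (inc1 f) = constantCoeff f ⊗ₜ[ℂ] 1 := by simp [inc1]

@[simp] theorem constantCoeff_inc2 (f : (U M)⟦X⟧) :
    constantCoeff (inc2 f) = 1 ⊗ₜ[ℂ] constantCoeff f := by simp [inc2]

theorem tens_mul_tens (a b c d : (U M)⟦X⟧) : tens a b * tens c d = tens (a * c) (b * d) := by
  rw [tens_eq, tens_eq, tens_eq, map_mul, map_mul, mul_assoc, ← mul_assoc (inc2 b),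
    ← (commute_inc c b).eq]
  noncomm_ring

theorem tens_add (a b c : (U M)⟦X⟧) : tens a (b + c) = tens a b + tens a c := by
  simp [tens_eq, mul_add]

theorem add_tens (a b c : (U M)⟦X⟧) : tens (a + b) c = tens a c + tens b c := by
  simp [tens_eq, add_mul]

theorem tens_sub (a b c : (U M)⟦X⟧) : tens a (b - c) = tens a b - tens a c := by
  simp [tens_eq, mul_sub]

theorem sub_tens (a b c : (U M)⟦X⟧) : tens (a - b) c = tens a c - tens b c := by
  simp [tens_eq, sub_mul]

theorem tens_smul (z : ℂ) (a b : (U M)⟦X⟧) : tens a (z • b) = z • tens a b := by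
  rw [tens_eq, tens_eq, map_smul, mul_smul_comm]

theorem smul_tens (z : ℂ) (a b : (U M)⟦X⟧) : tens (z • a) b = z • tens a b := by
  rw [tens_eq, tens_eq, map_smul, smul_mul_assoc]

theorem tens_sum {κ : Type*} (s : Finset κ) (a : (U M)⟦X⟧) (b : κ → (U M)⟦X⟧) :
    tens a (∑ i ∈ s, b i) = ∑ i ∈ s, tens a (b i) := by
  simp [tens_eq, Finset.mul_sum]

theorem sum_tens {κ : Type*} (s : Finset κ) (a : (U M)⟦X⟧) (b : κ → (U M)⟦X⟧) :
    tens (∑ i ∈ s, b i) a = ∑ i ∈ s, tens (b i) a := by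
  simp [tens_eq, Finset.sum_mul]

@[simp] theorem tens_zero (a : (U M)⟦X⟧) : tens a 0 = 0 := by simp [tens_eq]

@[simp] theorem zero_tens (a : (U M)⟦X⟧) : tens 0 a = 0 := by simp [tens_eq]

theorem inc1_eq (a : (U M)⟦X⟧) : inc1 a = tens a 1 := by simp [tens_eq]

theorem inc2_eq (a : (U M)⟦X⟧) : inc2 a = tens 1 a := by simp [tens_eq]

theorem X_mul_tens (a b : (U M)⟦X⟧) : X * tens a b = tens a (X * b) := by
  rw [tens_eq, tens_eq, map_mul, inc2, hExt_X, ← mul_assoc, X_mul, mul_assoc]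

theorem tens_X_mul (a b : (U M)⟦X⟧) : tens (X * a) b = tens a (X * b) := by
  rw [← X_mul_tens, tens_eq, tens_eq, map_mul, inc1, hExt_X, mul_assoc]

theorem constantCoeff_tens {a b : (U M)⟦X⟧} (h : constantCoeff b = 0) :
    constantCoeff (tens a b) = 0 := by
  simp [tens_eq, h]

theorem constantCoeff_tens_left {a b : (U M)⟦X⟧} (h : constantCoeff a = 0) :
    constantCoeff (tens a b) = 0 := by
  simp [tens_eq, h]

/-- The element `a ⊗ b ⊗ c`. -/
noncomputable def tens3 (a b c : (U M)⟦X⟧) : (U3 M)⟦X⟧ := pos1 a * pos2 b * pos3 c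

theorem tens3_mul_tens3 (a b c a' b' c' : (U M)⟦X⟧) :
    tens3 a b c * tens3 a' b' c' = tens3 (a * a') (b * b') (c * c') := by
  simp only [tens3, map_mul]
  calc _ = pos1 a * pos2 b * (pos3 c * pos1 a') * pos2 b' * pos3 c' := by noncomm_ring
    _ = pos1 a * (pos2 b * pos1 a') * (pos3 c * pos2 b') * pos3 c' := by
        rw [← (commute_pos13 a' c).eq]; noncomm_ring
    _ = _ := by
        rw [← (commute_pos12 a' b).eq, ← (commute_pos23 b' c).eq]; noncomm_ring

theorem leg12_tens (a b : (U M)⟦X⟧) : leg12 M (tens a b) = tens3 a b 1 := by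
  simp [tens_eq, tens3]

theorem leg23_tens (a b : (U M)⟦X⟧) : leg23 M (tens a b) = tens3 1 a b := by
  simp [tens_eq, tens3]

theorem pos1_eq (a : (U M)⟦X⟧) : pos1 a = tens3 a 1 1 := by simp [tens3]

theorem pos3_eq (a : (U M)⟦X⟧) : pos3 a = tens3 1 1 a := by simp [tens3]

theorem tens3_sub_middle (a b b' c : (U M)⟦X⟧) :
    tens3 a (b - b') c = tens3 a b c - tens3 a b' c := by
  simp [tens3, mul_sub, sub_mul]

theorem constantCoeff_tens3 {a b c : (U M)⟦X⟧} (h : constantCoeff c = 0) :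
    constantCoeff (tens3 a b c) = 0 := by
  simp [tens3, pos3, h]

theorem constantCoeff_tens3_middle {a b c : (U M)⟦X⟧} (h : constantCoeff b = 0) :
    constantCoeff (tens3 a b c) = 0 := by
  simp [tens3, pos2, h]

theorem epsId_tens {a : (U M)⟦X⟧} (ha : hExt (counit M) a = 0) (b : (U M)⟦X⟧) :
    epsId M (tens a b) = 0 := by
  rw [tens_eq, map_mul, epsId_inc1 ha, zero_mul]

theorem idEps_tens (a : (U M)⟦X⟧) {b : (U M)⟦X⟧} (hb : hExt (counit M) b = 0) :
    idEps M (tens a b) = 0 := by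
  rw [tens_eq, map_mul, idEps_inc2 hb, mul_zero]

theorem semiconjBy_DeltaId_tens {F : (U2 M)⟦X⟧} {a b : (U M)⟦X⟧} {y : (U2 M)⟦X⟧}
    (h : SemiconjBy F (Delta M a) y) :
    SemiconjBy (leg12 M F) (DeltaId M (tens a b)) (leg12 M y * tens3 1 1 b) := by
  rw [tens_eq, map_mul, DeltaId_inc1, DeltaId_inc2, ← pos3_eq]
  exact (h.map (leg12 M)).mul_right (commute_leg12_pos3 F b)

theorem semiconjBy_idDelta_tens {F : (U2 M)⟦X⟧} {a b : (U M)⟦X⟧} {y : (U2 M)⟦X⟧}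
    (h : SemiconjBy F (Delta M b) y) :
    SemiconjBy (leg23 M F) (idDelta M (tens a b)) (tens3 a 1 1 * leg23 M y) := by
  rw [tens_eq, map_mul, idDelta_inc1, idDelta_inc2, ← pos1_eq]
  exact SemiconjBy.mul_right (commute_pos1_leg23 a F).symm (h.map (leg23 M))

theorem semiconjBy_sum {R κ : Type*} [Ring R] {a : R} {x y : κ → R} (s : Finset κ)
    (h : ∀ i ∈ s, SemiconjBy a (x i) (y i)) :
    SemiconjBy a (∑ i ∈ s, x i) (∑ i ∈ s, y i) := by
  rw [SemiconjBy, Finset.mul_sum, Finset.sum_mul]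
  exact Finset.sum_congr rfl fun i hi => (h i hi).eq

/-! ### Primitive elements of a twisted coproduct -/

/-- `x` is primitive for the coproduct twisted by `F`. -/
def IsPrim (F : (U2 M)⟦X⟧) (x : (U M)⟦X⟧) : Prop :=
  SemiconjBy F (Delta M x) (tens x 1 + tens 1 x)

theorem IsPrim.twistedDelta_eq {F : (U2 M)⟦X⟧} (hF : IsUnit F) {x : (U M)⟦X⟧} (h : IsPrim F x) :
    twistedDelta F x = tens x 1 + tens 1 x := by
  rw [twistedDelta, h.eq, mul_assoc, Ring.mul_inverse_cancel _ hF, mul_one]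

theorem isPrim_one_gen (x : so M) : IsPrim 1 (gen x) := by
  rw [IsPrim, Delta_gen, inc1_eq, inc2_eq]
  exact SemiconjBy.one_left _

theorem IsPrim.mul_left {F Φ : (U2 M)⟦X⟧} {x : (U M)⟦X⟧} (h : IsPrim F x)
    (hc : Commute Φ (tens x 1 + tens 1 x)) : IsPrim (Φ * F) x :=
  (show SemiconjBy Φ _ _ from hc).mul_left h

theorem IsPrim.add {F : (U2 M)⟦X⟧} {x y : (U M)⟦X⟧} (hx : IsPrim F x) (hy : IsPrim F y) :
    IsPrim F (x + y) := by
  rw [IsPrim, map_add, add_tens, tens_add, add_add_add_comm]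
  exact hx.add_right hy

theorem IsPrim.smul {F : (U2 M)⟦X⟧} {x : (U M)⟦X⟧} (hx : IsPrim F x) (z : ℂ) :
    IsPrim F (z • x) := by
  rw [IsPrim, map_smul, smul_tens, tens_smul, ← smul_add]
  rw [SemiconjBy, mul_smul_comm, smul_mul_assoc, hx.eq]

theorem IsPrim.zero (F : (U2 M)⟦X⟧) : IsPrim F (0 : (U M)⟦X⟧) := by
  simp [IsPrim]

theorem IsPrim.sum {κ : Type*} {F : (U2 M)⟦X⟧} (s : Finset κ) {x : κ → (U M)⟦X⟧}
    (h : ∀ i ∈ s, IsPrim F (x i)) : IsPrim F (∑ i ∈ s, x i) := by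
  classical
  induction s using Finset.induction_on with
  | empty => simpa using IsPrim.zero F
  | insert i s hi ih =>
    rw [Finset.sum_insert hi]
    exact (h i (by simp)).add (ih fun j hj => h j (by simp [hj]))

theorem X_mul_injective {B : Type*} [Ring B] {f g : B⟦X⟧} (h : X * f = X * g) : f = g := by
  ext n
  simpa [coeff_succ_X_mul] using congrArg (coeff (n + 1)) h

/-- The parameter h is central and not a zero divisor. This is needed for the elements σ_i / h in
the Reshetikhin factor. -/
theorem IsPrim.of_X_mul {F : (U2 M)⟦X⟧} {x : (U M)⟦X⟧} (hx : IsPrim F (X * x)) : IsPrim F x := by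
  have h := hx.eq
  rw [map_mul, Delta, hExt_X, ← Delta, tens_X_mul, ← X_mul_tens, ← X_mul_tens, ← mul_add,
    ← mul_assoc, ← PowerSeries.X_mul, mul_assoc, mul_assoc] at h
  exact X_mul_injective h

theorem flog1p_zero {B : Type*} [Ring B] [Algebra ℂ B] : flog1p (0 : B⟦X⟧) = 0 := by
  refine fexp_injective (by simp) (by simp) ?_
  rw [fexp_flog1p (by simp), fexp_zero, add_zero]

end Twists
-- Abelian (Reshetikhin) twists and Jordanian twists.
section Factors

open PowerSeries

variable {M : ℕ}

theorem hExt_counit_flog1p {f : (U M)⟦X⟧} (h : hExt (counit M) f = 0) :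
    hExt (counit M) (flog1p f) = 0 := by
  rw [map_flog1p, h, flog1p_zero]

/-! ### The Reshetikhin twist -/

/-- Primitivity splits each coproduct into two of the three exponents `p`, `q`, `r` placed in legs
12, 23 and 13. These commute, so both sides of the twist equation are exp(p + q + r). -/
theorem isTwist_mul_of_commute_prim {κ : Type*} (s : Finset κ) {F : (U2 M)⟦X⟧} (hF : IsTwist F)
    {a b : κ → (U M)⟦X⟧} (ha : ∀ i ∈ s, IsPrim F (a i)) (hb : ∀ i ∈ s, IsPrim F (b i))
    (haa : ∀ i ∈ s, ∀ j ∈ s, Commute (a i) (a j)) (hab : ∀ i ∈ s, ∀ j ∈ s, Commute (a i) (b j))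
    (hbb : ∀ i ∈ s, ∀ j ∈ s, Commute (b i) (b j)) (h0 : ∀ i ∈ s, constantCoeff (b i) = 0)
    (hca : ∀ i ∈ s, hExt (counit M) (a i) = 0) (hcb : ∀ i ∈ s, hExt (counit M) (b i) = 0) :
    IsTwist (fexp (∑ i ∈ s, tens (a i) (b i)) * F) := by
  have hc : constantCoeff (∑ i ∈ s, tens (a i) (b i)) = 0 := by
    rw [map_sum]; exact Finset.sum_eq_zero fun i hi => constantCoeff_tens (h0 i hi)
  set p := ∑ i ∈ s, tens3 (a i) (b i) 1 with hp
  set q := ∑ i ∈ s, tens3 1 (a i) (b i) with hq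
  set r := ∑ i ∈ s, tens3 (a i) 1 (b i) with hr
  have p0 : constantCoeff p = 0 := by
    rw [hp, map_sum]; exact Finset.sum_eq_zero fun i hi => constantCoeff_tens3_middle (h0 i hi)
  have q0 : constantCoeff q = 0 := by
    rw [hq, map_sum]; exact Finset.sum_eq_zero fun i hi => constantCoeff_tens3 (h0 i hi)
  have r0 : constantCoeff r = 0 := by
    rw [hr, map_sum]; exact Finset.sum_eq_zero fun i hi => constantCoeff_tens3 (h0 i hi)
  have pq : Commute p q := Commute.sum_left _ _ _ fun i hi => Commute.sum_right _ _ _ fun j hj => by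
    simp only [Commute, SemiconjBy, tens3_mul_tens3, (hab j hj i hi).eq, mul_one, one_mul]
  have pr : Commute p r := Commute.sum_left _ _ _ fun i hi => Commute.sum_right _ _ _ fun j hj => by
    simp only [Commute, SemiconjBy, tens3_mul_tens3, (haa j hj i hi).eq, mul_one, one_mul]
  have qr : Commute q r := Commute.sum_left _ _ _ fun i hi => Commute.sum_right _ _ _ fun j hj => by
    simp only [Commute, SemiconjBy, tens3_mul_tens3, (hbb j hj i hi).eq, mul_one, one_mul]
  have l12 : leg12 M (fexp (∑ i ∈ s, tens (a i) (b i))) = fexp p := by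
    rw [leg12, map_fexp, ← leg12, map_sum]; simp only [leg12_tens, hp]
  have l23 : leg23 M (fexp (∑ i ∈ s, tens (a i) (b i))) = fexp q := by
    rw [leg23, map_fexp, ← leg23, map_sum]; simp only [leg23_tens, hq]
  refine hF.mul (isUnit_fexp hc) (D := fexp (r + q)) (E := fexp (p + r)) ?_ ?_ ?_ ?_ ?_
  · rw [DeltaId, map_fexp, ← DeltaId, map_sum]
    refine semiconjBy_fexp (by rw [← map_sum, DeltaId, constantCoeff_hExt, hc, map_zero])
      (by simp [r0, q0]) ?_
    rw [hr, hq, ← Finset.sum_add_distrib]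
    refine semiconjBy_sum s fun i hi => ?_
    have := semiconjBy_DeltaId_tens (b := b i) (ha i hi)
    simpa only [map_add, leg12_tens, add_mul, tens3_mul_tens3, mul_one, one_mul] using this
  · rw [idDelta, map_fexp, ← idDelta, map_sum]
    refine semiconjBy_fexp (by rw [← map_sum, idDelta, constantCoeff_hExt, hc, map_zero])
      (by simp [r0, p0]) ?_
    rw [hr, hp, ← Finset.sum_add_distrib]
    refine semiconjBy_sum s fun i hi => ?_
    have := semiconjBy_idDelta_tens (a := a i) (hb i hi)
    simpa only [map_add, leg23_tens, mul_add, tens3_mul_tens3, mul_one, one_mul] using this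
  · rw [l12, l23, ← fexp_add p0 (by simp [r0, q0]) (pr.add_right pq),
      ← fexp_add q0 (by simp [r0, p0]) (pq.symm.add_right qr)]
    congr 1
    abel
  · rw [epsId, map_fexp, ← epsId, map_sum, Finset.sum_eq_zero fun i hi => epsId_tens (hca i hi) _,
      fexp_zero]
  · rw [idEps, map_fexp, ← idEps, map_sum, Finset.sum_eq_zero fun i hi => idEps_tens _ (hcb i hi),
      fexp_zero]

/-! ### Jordanian factors -/

/-- A pair `(H, E)` of primitive elements with `[H, E] = E` for the coproduct twisted by `F`,
together with a scalar `c`. -/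
structure JordanianPair (F : (U2 M)⟦X⟧) (H E : (U M)⟦X⟧) : Prop where
  prim_H : IsPrim F H
  prim_E : IsPrim F E
  comm : H * E = E * H + E
  counit_H : hExt (counit M) H = 0
  counit_E : hExt (counit M) E = 0

/-- `ln (1 + h c E)`. -/
noncomputable def jlog (c : ℂ) (E : (U M)⟦X⟧) : (U M)⟦X⟧ := flog1p (X * (c • E))

@[simp] theorem constantCoeff_jlog (c : ℂ) (E : (U M)⟦X⟧) : constantCoeff (jlog c E) = 0 := by
  simp [jlog]

theorem fexp_jlog (c : ℂ) (E : (U M)⟦X⟧) : fexp (jlog c E) = 1 + X * (c • E) :=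
  fexp_flog1p (by simp)

theorem commute_X_mul_smul {x E : (U M)⟦X⟧} (h : Commute x E) (c : ℂ) :
    Commute x (X * (c • E)) :=
  (commute_X x).mul_right (h.smul_right c)

theorem commute_jlog {x E : (U M)⟦X⟧} (h : Commute x E) (c : ℂ) : Commute x (jlog c E) :=
  commute_flog1p (by simp) (commute_X_mul_smul h c)

theorem inc2_fexp (f : (U M)⟦X⟧) : tens 1 (fexp f) = fexp (tens 1 f) := by
  rw [← inc2_eq, ← inc2_eq, inc2, map_fexp]

theorem inc1_fexp (f : (U M)⟦X⟧) : tens (fexp f) 1 = fexp (tens f 1) := by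
  rw [← inc1_eq, ← inc1_eq, inc1, map_fexp]

/-- A vector x of weight w satisfies H x = x (H + w), so x ⊗ 1 intertwines (H + w) ⊗ s with H ⊗ s.
Exponentiating and splitting off the commuting part w ⊗ s produces the factor e^{ws}. -/
theorem jordanian_mul_tens_left {H x s : (U M)⟦X⟧} {w : ℂ} (hs : constantCoeff s = 0)
    (hx : H * x = x * H + w • x) :
    SemiconjBy (fexp (tens H s)) (tens x 1) (tens x (fexp (w • s))) := by
  have h0 : constantCoeff (tens H s) = 0 := constantCoeff_tens hs
  have h1 : constantCoeff (tens 1 (w • s)) = 0 := constantCoeff_tens (by simp [hs])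
  have h : SemiconjBy (tens x 1) (tens 1 (w • s) + tens H s) (tens H s) := by
    rw [SemiconjBy, mul_add]
    simp only [tens_mul_tens, one_mul, mul_one, hx, add_tens, tens_smul, smul_tens, mul_smul_comm]
    abel
  have h2 := (semiconjBy_fexp (by simp [h0, h1]) h0 h).eq
  rw [fexp_add h1 h0 (by
    simp only [Commute, SemiconjBy, tens_mul_tens, one_mul, mul_one, mul_smul_comm,
      smul_mul_assoc]), ← inc2_fexp, ← mul_assoc, tens_mul_tens, one_mul, mul_one] at h2
  exact h2.symm

theorem jordanian_mul_tens_right {H x s : (U M)⟦X⟧} (hs : constantCoeff s = 0)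
    (hx : Commute s x) : Commute (fexp (tens H s)) (tens 1 x) := by
  refine (commute_fexp (constantCoeff_tens hs) ?_).symm
  simp only [Commute, SemiconjBy, tens_mul_tens, one_mul, mul_one, hx.eq]

/-- Used with w = 1 for E itself, w = 1/2 for the constituent root vectors, and w = 0 for elements
that stay primitive. -/
theorem jordanian_semiconjBy {F : (U2 M)⟦X⟧} {H E : (U M)⟦X⟧} (c : ℂ) {x : (U M)⟦X⟧} {w : ℂ} (hp : IsPrim F x) (hx : H * x = x * H + w • x)
    (hE : Commute E x) :
    SemiconjBy (fexp (tens H (jlog c E)) * F) (Delta M x)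
      (tens x (fexp (w • jlog c E)) + tens 1 x) := by
  refine SemiconjBy.mul_left (SemiconjBy.add_right ?_ ?_) hp
  · exact jordanian_mul_tens_left (by simp) hx
  · exact jordanian_mul_tens_right (by simp) (commute_jlog hE.symm c).symm

theorem isPrim_jordanian_mul {F : (U2 M)⟦X⟧} {H E : (U M)⟦X⟧} (c : ℂ) {x : (U M)⟦X⟧} (hp : IsPrim F x) (hx : Commute H x) (hE : Commute E x) :
    IsPrim (fexp (tens H (jlog c E)) * F) x := by
  rw [IsPrim]
  simpa using jordanian_semiconjBy (H := H) c (w := 0) hp (by simpa using hx.eq) hE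

namespace JordanianPair

variable {F : (U2 M)⟦X⟧} {H E : (U M)⟦X⟧} (h : JordanianPair F H E) (c : ℂ)
include h

/-- The twisted coproduct of E is E ⊗ e^σ + 1 ⊗ E, and with e^σ = 1 + hcE this says that e^σ is
group-like. Taking logarithms by `fexp_injective` makes σ primitive. -/
theorem isPrim_jlog (hF : IsUnit F) : IsPrim (fexp (tens H (jlog c E)) * F) (jlog c E) := by
  set s := jlog c E with hs
  have s0 : constantCoeff s = 0 := by simp [hs]
  set J := fexp (tens H s)
  have hJF : IsUnit (J * F) := (isUnit_fexp (constantCoeff_tens s0)).mul hF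
  have h1 : SemiconjBy (J * F) (Delta M E) (tens E (fexp s) + tens 1 E) := by
    simpa using jordanian_semiconjBy (H := H) c (w := 1) h.prim_E (by simpa using h.comm) (Commute.refl E)
  have h2 : SemiconjBy (J * F) (Delta M (fexp s)) (tens (fexp s) (fexp s)) := by
    have fx : fexp s = 1 + X * (c • E) := fexp_jlog c E
    have e1 (g : (U M)⟦X⟧) : tens (fexp s) g = tens 1 g + X * (c • tens E g) := by
      rw [fx, add_tens, tens_X_mul, ← X_mul_tens, smul_tens]
    have e2 : tens 1 (fexp s) = 1 + X * (c • tens 1 E) := by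
      rw [fx, tens_add, ← X_mul_tens, tens_smul, show tens (1 : (U M)⟦X⟧) 1 = 1 by simp [tens_eq]]
    have e3 : tens (fexp s) (fexp s) = 1 + X * (c • (tens E (fexp s) + tens 1 E)) := by
      rw [e1, e2, smul_add, mul_add]
      abel
    have e4 : Delta M (fexp s) = 1 + X * (c • Delta M E) := by
      rw [fx, map_add, map_one, map_mul, Delta, hExt_X, ← Delta, map_smul]
    rw [e3, e4]
    refine SemiconjBy.add_right (SemiconjBy.one_right _) (SemiconjBy.mul_right (commute_X _) ?_)
    rw [SemiconjBy, mul_smul_comm, smul_mul_assoc, h1.eq]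
  have hD0 : constantCoeff (Delta M s) = 0 := by simp [Delta, s0]
  obtain ⟨v, hv⟩ := hJF
  -- The twisted coproduct of σ, written as an honest conjugate: injectivity of the exponential
  -- compares two series, so the unknown side must be named first.
  have hy : SemiconjBy (J * F) (Delta M s) (J * F * Delta M s * ((v⁻¹ : (U2 M)⟦X⟧ˣ) : (U2 M)⟦X⟧)) := by
    rw [SemiconjBy, ← hv, mul_assoc _ _ (v : (U2 M)⟦X⟧), Units.inv_mul, mul_one]
  have hy0 : constantCoeff (J * F * Delta M s * ((v⁻¹ : (U2 M)⟦X⟧ˣ) : (U2 M)⟦X⟧)) = 0 := by simp [hD0]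
  have hp0 : constantCoeff (tens s 1 + tens 1 s) = 0 := by
    simp [constantCoeff_tens s0, constantCoeff_tens_left s0]
  have h3 := semiconjBy_fexp hD0 hy0 hy
  have h4 : Delta M (fexp s) = fexp (Delta M s) := by rw [Delta, map_fexp]
  have h5 : tens (fexp s) (fexp s) = fexp (tens s 1 + tens 1 s) := by
    rw [fexp_add (constantCoeff_tens_left s0) (constantCoeff_tens s0)
      (by simp only [Commute, SemiconjBy, tens_mul_tens, one_mul, mul_one]), ← inc1_fexp,
      ← inc2_fexp, tens_mul_tens, mul_one, one_mul]
  rw [h4, h5] at h2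
  have h6 : fexp (J * F * Delta M s * ((v⁻¹ : (U2 M)⟦X⟧ˣ) : (U2 M)⟦X⟧)) = fexp (tens s 1 + tens 1 s) := by
    have := h3.eq.symm.trans h2.eq
    rw [← hv] at this ⊢
    exact v.isUnit.mul_right_cancel this
  rw [IsPrim, ← fexp_injective hy0 hp0 h6]
  exact hy

/-- Primitivity of H for Δ_F gives (Δ_F ⊗ id)J = exp(H₁σ₃ + H₂σ₃). On the other side σ is primitive
only after J itself, but the J₂₃ of the twist equation supplies exactly that conjugation; both sides
become J₁₂ J₁₃ J₂₃. -/
theorem isTwist (hF : IsTwist F) : IsTwist (fexp (tens H (jlog c E)) * F) := by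
  have hprim := h.isPrim_jlog c hF.isUnit
  have hcs : hExt (counit M) (jlog c E) = 0 := by
    refine hExt_counit_flog1p ?_
    rw [map_mul, map_smul, h.counit_E, smul_zero, mul_zero]
  have hH := h.prim_H
  have hcH := h.counit_H
  generalize hs : jlog c E = s at hprim hcs ⊢
  have s0 : constantCoeff s = 0 := by simp [← hs]
  have t0 : constantCoeff (tens H s) = 0 := constantCoeff_tens s0
  obtain ⟨v, hv⟩ := isUnit_fexp t0
  set p := tens3 H s 1 with hp
  set q := tens3 1 H s with hq
  set r := tens3 H 1 s with hr
  have p0 : constantCoeff p = 0 := constantCoeff_tens3_middle s0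
  have q0 : constantCoeff q = 0 := constantCoeff_tens3 s0
  have r0 : constantCoeff r = 0 := constantCoeff_tens3 s0
  have pr : Commute p r := by
    simp only [hp, hr, Commute, SemiconjBy, tens3_mul_tens3, mul_one, one_mul]
  have qr : Commute q r := by
    simp only [hq, hr, Commute, SemiconjBy, tens3_mul_tens3, mul_one, one_mul]
  have l12 : leg12 M (fexp (tens H s)) = fexp p := by
    rw [leg12, map_fexp, ← leg12, leg12_tens]
  have l23 : leg23 M (fexp (tens H s)) = fexp q := by
    rw [leg23, map_fexp, ← leg23, leg23_tens]
  -- This is Δ_F(σ), recovered from the primitivity of σ for the coproduct twisted by JF by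
  -- conjugating back with J.
  set y := (↑v⁻¹ : (U2 M)⟦X⟧) * (tens s 1 + tens 1 s) * v with hy
  have hy0 : constantCoeff y = 0 := by
    simp [hy, constantCoeff_tens s0, constantCoeff_tens_left s0]
  have hyF : SemiconjBy F (Delta M s) y := by
    have := hprim.eq
    rw [← hv] at this
    calc F * Delta M s = ↑v⁻¹ * (v * F * Delta M s) := by
          rw [mul_assoc, ← mul_assoc, Units.inv_mul, one_mul]
      _ = y * F := by rw [this, hy]; noncomm_ring
  have hyJ : SemiconjBy (fexp (tens H s)) y (tens s 1 + tens 1 s) := by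
    rw [SemiconjBy, ← hv, hy, ← mul_assoc, ← mul_assoc, Units.mul_inv, one_mul]
  refine hF.mul ⟨v, hv⟩ (D := fexp (r + q)) (E := fexp (tens3 H 1 1 * leg23 M y)) ?_ ?_ ?_ ?_ ?_
  · rw [DeltaId, map_fexp, ← DeltaId]
    refine semiconjBy_fexp (by rw [DeltaId, constantCoeff_hExt, t0, map_zero])
      (by simp [r0, q0]) ?_
    have := semiconjBy_DeltaId_tens (b := s) hH
    simpa only [map_add, leg12_tens, add_mul, tens3_mul_tens3, mul_one, one_mul] using this
  · rw [idDelta, map_fexp, ← idDelta]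
    exact semiconjBy_fexp (by rw [idDelta, constantCoeff_hExt, t0, map_zero])
      (by simp [leg23, hy0]) (semiconjBy_idDelta_tens hyF)
  -- Conjugation by J₂₃ undoes the conjugation in `y` and leaves H in the first leg untouched.
  · have h1 : SemiconjBy (fexp q) (tens3 H 1 1 * leg23 M y) (p + r) := by
      have h2 := hyJ.map (leg23 M)
      rw [l23, map_add, leg23_tens, leg23_tens] at h2
      have h3 : Commute (fexp q) (tens3 H 1 1) := (commute_fexp q0 (by
        simp only [hq, Commute, SemiconjBy, tens3_mul_tens3, mul_one, one_mul])).symm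
      have h4 := SemiconjBy.mul_right h3 h2
      simpa only [mul_add, tens3_mul_tens3, mul_one, one_mul] using h4
    rw [l12, l23, (semiconjBy_fexp (by simp [leg23, hy0]) (by simp [p0, r0]) h1).eq,
      fexp_add r0 q0 qr.symm, fexp_add p0 r0 pr, mul_assoc]
  · rw [epsId, map_fexp, ← epsId, epsId_tens hcH, fexp_zero]
  · rw [idEps, map_fexp, ← idEps, idEps_tens _ hcs, fexp_zero]

end JordanianPair

end Factors
-- Extension factors for a Heisenberg-type family of root vectors.
section Extension

open PowerSeries

variable {M : ℕ}

/-- Multiplication by the central element `h c`. -/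
noncomputable def hscale {B : Type*} [Ring B] [Algebra ℂ B] (c : ℂ) : B⟦X⟧ →ₗ[ℂ] B⟦X⟧ :=
  { toFun := fun f => X * (c • f)
    map_add' := by intros; rw [smul_add, mul_add]
    map_smul' := by intro m x; rw [smul_comm, mul_smul_comm, RingHom.id_apply] }

section

variable {B : Type*} [Ring B] [Algebra ℂ B] (c : ℂ)

theorem hscale_apply (f : B⟦X⟧) : hscale c f = X * (c • f) := rfl

theorem hscale_mul (f g : B⟦X⟧) : hscale c f * g = hscale c (f * g) := by
  rw [hscale_apply, hscale_apply, mul_assoc, smul_mul_assoc]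

theorem mul_hscale (f g : B⟦X⟧) : f * hscale c g = hscale c (f * g) := by
  rw [hscale_apply, hscale_apply, ← mul_assoc, ← X_mul, mul_assoc, mul_smul_comm]

@[simp] theorem constantCoeff_hscale (f : B⟦X⟧) : constantCoeff (hscale c f) = 0 := by
  simp [hscale_apply]

theorem hExt_hscale {C : Type*} [Ring C] [Algebra ℂ C] (φ : B →ₐ[ℂ] C) (f : B⟦X⟧) :
    hExt φ (hscale c f) = hscale c (hExt φ f) := by
  rw [hscale_apply, map_mul, hExt_X, map_smul, hscale_apply]

theorem semiconjBy_hscale {a x y : B⟦X⟧} (h : SemiconjBy a x y) :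
    SemiconjBy a (hscale c x) (hscale c y) := by
  rw [SemiconjBy, mul_hscale, hscale_mul, h.eq]

end

theorem tens_hscale (c : ℂ) (a b : (U M)⟦X⟧) : tens a (hscale c b) = hscale c (tens a b) := by
  rw [hscale_apply, ← X_mul_tens, tens_smul, hscale_apply]

theorem hscale_tens (c : ℂ) (a b : (U M)⟦X⟧) : tens (hscale c a) b = hscale c (tens a b) := by
  rw [hscale_apply, tens_X_mul, ← X_mul_tens, smul_tens, hscale_apply]

theorem sum_mul_sum_of_commutator {κ R : Type*} [DecidableEq κ] [Ring R] (W : Finset κ)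
    {a b e : κ → R}
    (h : ∀ i ∈ W, ∀ j ∈ W, a i * b j = b j * a i + if i = j then e i else 0) :
    (∑ i ∈ W, a i) * ∑ j ∈ W, b j = (∑ j ∈ W, b j) * ∑ i ∈ W, a i + ∑ i ∈ W, e i := by
  rw [Finset.sum_mul_sum, Finset.sum_mul_sum, Finset.sum_comm (s := W) (t := W) (f := fun j i => b j * a i),
    Finset.sum_congr rfl fun i hi => Finset.sum_congr rfl fun j hj => h i hi j hj]
  simp only [Finset.sum_add_distrib, Finset.sum_ite_eq, Finset.sum_ite_mem, Finset.inter_self]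

/-- Elements `X m`, `Z m` and mutually inverse `S`, `N` that satisfy the relations of an extension
factor `exp (∑ m, X m ⊗ Z m)` for the coproduct twisted by `F`. -/
structure ExtensionData {κ : Type*} [DecidableEq κ] (W : Finset κ) (F : (U2 M)⟦X⟧)
    (x z : κ → (U M)⟦X⟧) (S N : (U M)⟦X⟧) : Prop where
  S_mul_N : S * N = 1
  comm_x_S : ∀ m ∈ W, Commute (x m) S
  comm_x_N : ∀ m ∈ W, Commute (x m) N
  comm_z_S : ∀ m ∈ W, Commute (z m) S
  comm_z_N : ∀ m ∈ W, Commute (z m) N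
  comm_x_x : ∀ m ∈ W, ∀ n ∈ W, Commute (x m) (x n)
  comm_z_z : ∀ m ∈ W, ∀ n ∈ W, Commute (z m) (z n)
  z_mul_x : ∀ m ∈ W, ∀ n ∈ W, z m * x n = x n * z m + if m = n then N - S else 0
  constantCoeff_z : ∀ m ∈ W, constantCoeff (z m) = 0
  counit_x : ∀ m ∈ W, hExt (counit M) (x m) = 0
  counit_z : ∀ m ∈ W, hExt (counit M) (z m) = 0
  Delta_x : ∀ m ∈ W, SemiconjBy F (Delta M (x m)) (tens (x m) S + tens 1 (x m))
  Delta_z : ∀ m ∈ W, SemiconjBy F (Delta M (z m)) (tens (z m) 1 + tens N (z m))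

namespace ExtensionData

variable {κ : Type*} [DecidableEq κ] {W : Finset κ} {F : (U2 M)⟦X⟧} {x z : κ → (U M)⟦X⟧}
  {S N : (U M)⟦X⟧} (h : ExtensionData W F x z S N)
include h

theorem constantCoeff_sum : constantCoeff (∑ m ∈ W, tens (x m) (z m)) = 0 := by
  rw [map_sum]
  exact Finset.sum_eq_zero fun i hi => constantCoeff_tens (h.constantCoeff_z i hi)

/-- With exponents a = x⊗z⊗1, b = 1⊗x⊗z, c = x⊗S⊗z and d = x⊗N⊗z (summed over m), the relations give
[a,b] = d - c, with c commuting with a and b, and d with b. The equation to prove is e^a e^{b+c} =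
e^b e^{a+d}: conjugation by e^b sends a + d to a + c, so the right side is e^{a+c} e^b. -/
theorem isTwist (hF : IsTwist F) : IsTwist (fexp (∑ m ∈ W, tens (x m) (z m)) * F) := by
  have t0 := h.constantCoeff_sum
  set a := ∑ m ∈ W, tens3 (x m) (z m) 1 with ha
  set b := ∑ m ∈ W, tens3 1 (x m) (z m) with hb
  set c := ∑ m ∈ W, tens3 (x m) S (z m) with hc
  set d := ∑ m ∈ W, tens3 (x m) N (z m) with hd
  have a0 : constantCoeff a = 0 := by
    rw [ha, map_sum]
    exact Finset.sum_eq_zero fun i hi => constantCoeff_tens3_middle (h.constantCoeff_z i hi)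
  have b0 : constantCoeff b = 0 := by
    rw [hb, map_sum]
    exact Finset.sum_eq_zero fun i hi => constantCoeff_tens3 (h.constantCoeff_z i hi)
  have c0 : constantCoeff c = 0 := by
    rw [hc, map_sum]
    exact Finset.sum_eq_zero fun i hi => constantCoeff_tens3 (h.constantCoeff_z i hi)
  have d0 : constantCoeff d = 0 := by
    rw [hd, map_sum]
    exact Finset.sum_eq_zero fun i hi => constantCoeff_tens3 (h.constantCoeff_z i hi)
  have ac : Commute a c := Commute.sum_left _ _ _ fun i hi => Commute.sum_right _ _ _ fun j hj => by
    simp only [Commute, SemiconjBy, tens3_mul_tens3, (h.comm_x_x i hi j hj).eq,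
      (h.comm_z_S i hi).eq, mul_one, one_mul]
  have bc : Commute b c := Commute.sum_left _ _ _ fun i hi => Commute.sum_right _ _ _ fun j hj => by
    simp only [Commute, SemiconjBy, tens3_mul_tens3, (h.comm_z_z i hi j hj).eq,
      (h.comm_x_S i hi).eq, mul_one, one_mul]
  have bd : Commute b d := Commute.sum_left _ _ _ fun i hi => Commute.sum_right _ _ _ fun j hj => by
    simp only [Commute, SemiconjBy, tens3_mul_tens3, (h.comm_z_z i hi j hj).eq,
      (h.comm_x_N i hi).eq, mul_one, one_mul]
  have ab : a * b = b * a + (d - c) := by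
    have e : ∀ i ∈ W, ∀ j ∈ W, tens3 (x i) (z i) 1 * tens3 1 (x j) (z j) =
        tens3 1 (x j) (z j) * tens3 (x i) (z i) 1 +
          if i = j then tens3 (x i) N (z i) - tens3 (x i) S (z i) else 0 := by
      intro i hi j hj
      simp only [tens3_mul_tens3, mul_one, one_mul, h.z_mul_x i hi j hj]
      split_ifs with hij
      · subst hij
        rw [← tens3_sub_middle]
        simp [tens3, mul_add, add_mul]
      · simp
    rw [hd, hc, ← Finset.sum_sub_distrib]
    exact sum_mul_sum_of_commutator W e
  have l12 : leg12 M (fexp (∑ m ∈ W, tens (x m) (z m))) = fexp a := by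
    rw [leg12, map_fexp, ← leg12, map_sum]; simp only [leg12_tens, ha]
  have l23 : leg23 M (fexp (∑ m ∈ W, tens (x m) (z m))) = fexp b := by
    rw [leg23, map_fexp, ← leg23, map_sum]; simp only [leg23_tens, hb]
  refine hF.mul (isUnit_fexp t0) (D := fexp (b + c)) (E := fexp (a + d)) ?_ ?_ ?_ ?_ ?_
  · rw [DeltaId, map_fexp, ← DeltaId, map_sum]
    refine semiconjBy_fexp (by rw [← map_sum, DeltaId, constantCoeff_hExt, t0, map_zero])
      (by simp [b0, c0]) ?_
    rw [hb, hc, ← Finset.sum_add_distrib]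
    refine semiconjBy_sum W fun i hi => ?_
    have := semiconjBy_DeltaId_tens (b := z i) (h.Delta_x i hi)
    rw [add_comm]
    simpa only [map_add, leg12_tens, add_mul, tens3_mul_tens3, mul_one, one_mul] using this
  · rw [idDelta, map_fexp, ← idDelta, map_sum]
    refine semiconjBy_fexp (by rw [← map_sum, idDelta, constantCoeff_hExt, t0, map_zero])
      (by simp [a0, d0]) ?_
    rw [ha, hd, ← Finset.sum_add_distrib]
    refine semiconjBy_sum W fun i hi => ?_
    have := semiconjBy_idDelta_tens (a := x i) (h.Delta_z i hi)
    simpa only [map_add, leg23_tens, mul_add, tens3_mul_tens3, mul_one, one_mul] using this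
  · have h1 : SemiconjBy (fexp b) a (a + (c - d)) := by
      refine fexp_mul_of_commutator b0 ?_ (bc.sub_right bd)
      rw [ab]; abel
    have h2 : SemiconjBy (fexp b) (a + d) (a + c) := by
      have := h1.add_right (show SemiconjBy (fexp b) d d from (commute_fexp b0 bd.symm).symm)
      rwa [show a + (c - d) + d = a + c by abel] at this
    rw [l12, l23, (semiconjBy_fexp (by simp [a0, d0]) (by simp [a0, c0]) h2).eq,
      fexp_add a0 c0 ac, add_comm, fexp_add c0 b0 bc.symm, mul_assoc]
  · rw [epsId, map_fexp, ← epsId, map_sum,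
      Finset.sum_eq_zero fun i hi => epsId_tens (h.counit_x i hi) _, fexp_zero]
  · rw [idEps, map_fexp, ← idEps, map_sum,
      Finset.sum_eq_zero fun i hi => idEps_tens _ (h.counit_z i hi), fexp_zero]

theorem isPrim_of_commute {y : (U M)⟦X⟧} (hy : IsPrim F y)
    (hc : Commute (tens y 1 + tens 1 y) (∑ m ∈ W, tens (x m) (z m))) :
    IsPrim (fexp (∑ m ∈ W, tens (x m) (z m)) * F) y :=
  hy.mul_left (commute_fexp h.constantCoeff_sum hc).symm

/-- The spectators g and a serve two cases: both equal to 1 for the coproduct of x n, and g = x m, a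
= N for the second commutator in `isPrim_sub_hscale`. -/
theorem sum_mul_tens_x {n : κ} (hn : n ∈ W) (g : (U M)⟦X⟧)
    (hg : ∀ m ∈ W, Commute (x m) g) (a : (U M)⟦X⟧) (ha : ∀ m ∈ W, Commute (z m) a) :
    (∑ m ∈ W, tens (x m) (z m)) * tens g (x n * a) =
      tens g (x n * a) * (∑ m ∈ W, tens (x m) (z m)) + tens (x n * g) ((N - S) * a) := by
  have e : ∀ m ∈ W, tens (x m) (z m) * tens g (x n * a) =
      tens g (x n * a) * tens (x m) (z m) +
        if m = n then tens (x n * g) ((N - S) * a) else 0 := by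
    intro m hm
    rw [tens_mul_tens, ← mul_assoc, h.z_mul_x m hm n hn, tens_mul_tens, add_mul, tens_add,
      mul_assoc, (ha m hm).eq, (hg m hm).eq, mul_assoc]
    split_ifs with hmn
    · subst hmn; rw [(hg m hm).eq]
    · simp
  rw [Finset.sum_mul, Finset.sum_congr rfl e, Finset.sum_add_distrib, Finset.mul_sum,
    Finset.sum_ite_eq' W n, if_pos hn]

/-- The commutator of the exponent with 1 ⊗ x n is x n ⊗ (N - S) and commutes with the exponent, so
the extension merely replaces S by N. -/
theorem Delta_mul_x {n : κ} (hn : n ∈ W) :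
    SemiconjBy (fexp (∑ m ∈ W, tens (x m) (z m)) * F) (Delta M (x n))
      (tens (x n) N + tens 1 (x n)) := by
  have t0 := h.constantCoeff_sum
  have h1 : Commute (tens (x n) S) (∑ m ∈ W, tens (x m) (z m)) :=
    Commute.sum_right _ _ _ fun m hm => by
      simp only [Commute, SemiconjBy, tens_mul_tens, (h.comm_x_x n hn m hm).eq,
        (h.comm_z_S m hm).eq]
  have h1' : Commute (tens (x n) N) (∑ m ∈ W, tens (x m) (z m)) :=
    Commute.sum_right _ _ _ fun m hm => by
      simp only [Commute, SemiconjBy, tens_mul_tens, (h.comm_x_x n hn m hm).eq,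
        (h.comm_z_N m hm).eq]
  have h2 := h.sum_mul_tens_x hn 1 (fun m _ => Commute.one_right _) 1 fun m _ => Commute.one_right _
  simp only [mul_one, tens_sub] at h2
  have h3 := fexp_mul_of_commutator t0 h2 (h1'.symm.sub_right h1.symm)
  have h4 : SemiconjBy (fexp (∑ m ∈ W, tens (x m) (z m))) (tens (x n) S + tens 1 (x n))
      (tens (x n) S + (tens 1 (x n) + (tens (x n) N - tens (x n) S))) :=
    SemiconjBy.add_right (commute_fexp t0 h1).symm h3
  rw [show tens (x n) S + (tens 1 (x n) + (tens (x n) N - tens (x n) S)) =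
    tens (x n) N + tens 1 (x n) by abel] at h4
  exact h4.mul_left (h.Delta_x n hn)

/-- If `[z m, e] = h c x (r m) N`, then `e - h c / 2 ∑ m, x m x (r m)` becomes primitive. -/
theorem isPrim_sub_hscale {r : κ → κ} (hr : ∀ m ∈ W, r m ∈ W) (hrr : ∀ m, r (r m) = m) (c : ℂ)
    {e : (U M)⟦X⟧} (he : IsPrim F e) (hxe : ∀ m ∈ W, Commute (x m) e)
    (hze : ∀ m ∈ W, z m * e = e * z m + hscale c (x (r m) * N)) :
    IsPrim (fexp (∑ m ∈ W, tens (x m) (z m)) * F)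
      (e - (1 / 2 : ℂ) • hscale c (∑ m ∈ W, x m * x (r m))) := by
  have t0 := h.constantCoeff_sum
  set θ := ∑ m ∈ W, tens (x m) (z m) with hθ
  have reindex {R : Type _} [AddCommMonoid R] (f : κ → R) :
      ∑ m ∈ W, f (r m) = ∑ m ∈ W, f m :=
    Finset.sum_nbij' r r hr hr (fun m _ => hrr m) (fun m _ => hrr m) fun _ _ => rfl
  have h1 : Commute (tens e 1) (fexp θ) := commute_fexp t0 <|
    Commute.sum_right _ _ _ fun m hm => by
      simp only [Commute, SemiconjBy, tens_mul_tens, (hxe m hm).eq, one_mul, mul_one]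
  have h2 : θ * tens 1 e = tens 1 e * θ + hscale c (∑ m ∈ W, tens (x m) (x (r m) * N)) := by
    rw [hθ, Finset.sum_mul, Finset.mul_sum, map_sum, ← Finset.sum_add_distrib]
    refine Finset.sum_congr rfl fun m hm => ?_
    rw [tens_mul_tens, tens_mul_tens, hze m hm, tens_add, tens_hscale, mul_one, one_mul]
  -- Second commutator with the exponent: the factor N - S meets the N already present, and S N = 1
  -- turns it into N² - 1.
  have h3 : θ * hscale c (∑ m ∈ W, tens (x m) (x (r m) * N)) =
      hscale c (∑ m ∈ W, tens (x m) (x (r m) * N)) * θ +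
        hscale c (∑ m ∈ W, tens (x m * x (r m)) (N * N - 1)) := by
    rw [mul_hscale, hscale_mul, ← map_add, Finset.mul_sum, Finset.sum_mul,
      ← Finset.sum_add_distrib]
    congr 1
    refine Finset.sum_congr rfl fun m hm => ?_
    rw [hθ, h.sum_mul_tens_x (hr m hm) _ (fun n hn => h.comm_x_x n hn m hm) _ h.comm_z_N,
      (h.comm_x_x _ (hr m hm) m hm).eq, sub_mul, h.S_mul_N]
  have h4 : Commute θ (hscale c (∑ m ∈ W, tens (x m * x (r m)) (N * N - 1))) := by
    refine semiconjBy_hscale c (Commute.sum_right _ _ _ fun n hn => Commute.sum_left _ _ _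
      fun m hm => ?_)
    have e1 := (h.comm_x_x m hm n hn).mul_right (h.comm_x_x m hm _ (hr n hn))
    have e2 := ((h.comm_z_N m hm).mul_right (h.comm_z_N m hm)).sub_right (Commute.one_right _)
    simp only [Commute, SemiconjBy, tens_mul_tens, e1.eq, e2.eq]
  have h5 := fexp_mul_unipotent t0 h2 h3 h4
  have h6 : SemiconjBy (fexp θ * F) (Delta M e)
      (tens e 1 + (tens 1 e + hscale c (∑ m ∈ W, tens (x m) (x (r m) * N)) +
        (1 / 2 : ℂ) • hscale c (∑ m ∈ W, tens (x m * x (r m)) (N * N - 1)))) :=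
    SemiconjBy.mul_left (SemiconjBy.add_right h1.symm h5) he
  have h7 : SemiconjBy (fexp θ * F)
      (Delta M ((1 / 2 : ℂ) • hscale c (∑ m ∈ W, x m * x (r m))))
      ((1 / 2 : ℂ) • hscale c (∑ m ∈ W, (tens (x m) N + tens 1 (x m)) *
        (tens (x (r m)) N + tens 1 (x (r m))))) := by
    rw [map_smul, Delta, hExt_hscale, ← Delta, map_sum]
    rw [SemiconjBy, mul_smul_comm, smul_mul_assoc]
    congr 1
    refine semiconjBy_hscale c (semiconjBy_sum W fun m hm => ?_)
    rw [map_mul]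
    exact (h.Delta_mul_x hm).mul_right (h.Delta_mul_x (hr m hm))
  -- Reindexing by the involution identifies the two mixed sums, whence the factor 2. After
  -- multiplication by 1/2 the mixed part cancels the first commutator, and the N² part cancels that
  -- of the second, leaving x m x (r m) ⊗ 1.
  have h8 : ∑ m ∈ W, (tens (x m) N + tens 1 (x m)) * (tens (x (r m)) N + tens 1 (x (r m))) =
      (∑ m ∈ W, tens (x m * x (r m)) (N * N) + ∑ m ∈ W, tens 1 (x m * x (r m))) +
        (2 : ℂ) • ∑ m ∈ W, tens (x m) (x (r m) * N) := by
    have e1 : ∑ m ∈ W, tens (x (r m)) (x m * N) = ∑ m ∈ W, tens (x m) (x (r m) * N) := by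
      rw [← reindex]
      simp only [hrr]
    rw [two_smul]
    nth_rw 2 [← e1]
    rw [← Finset.sum_add_distrib, ← Finset.sum_add_distrib, ← Finset.sum_add_distrib]
    refine Finset.sum_congr rfl fun m hm => ?_
    simp only [mul_add, add_mul, tens_mul_tens, one_mul, mul_one, (h.comm_x_N _ (hr m hm)).eq]
    abel
  rw [h8] at h7
  have h9 := h6.sub_right h7
  rw [← map_sub] at h9
  rw [IsPrim, show tens (e - (1 / 2 : ℂ) • hscale c (∑ m ∈ W, x m * x (r m))) 1 +
      tens 1 (e - (1 / 2 : ℂ) • hscale c (∑ m ∈ W, x m * x (r m))) = _ from ?_]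
  · exact h9
  simp only [sub_tens, tens_sub, smul_tens, tens_smul, hscale_tens, tens_hscale, sum_tens,
    tens_sum, Finset.sum_sub_distrib, map_add, map_sub, map_smul]
  module

end ExtensionData

end Extension
-- Brackets in so(M), and invariance under the nested orthogonal subalgebras.
section OrthogonalBrackets

variable {M p : ℕ}

section

attribute [local instance 100] LieRing.ofAssociativeRing

theorem single_mul_single_eq_ite (i j k l : Fin M) :
    (Matrix.single i j 1 * Matrix.single k l 1 : Matrix (Fin M) (Fin M) ℂ) =
      if j = k then Matrix.single i l 1 else 0 := by
  split_ifs with h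
  · subst h; simp
  · simp [h]

theorem coe_lie (x y : so M) :
    ((⁅x, y⁆ : so M) : Matrix (Fin M) (Fin M) ℂ) = x.1 * y.1 - y.1 * x.1 := rfl

theorem A_rev_rev (i j : Fin M) : A (Fin.rev j) (Fin.rev i) = -A i j := by
  apply Subtype.ext
  simp [A]

theorem A_lie (i j k l : Fin M) : ⁅A i j, A k l⁆ =
    (if j = k then A i l else 0) - (if l = i then A k j else 0) -
      (if j = Fin.rev l then A i (Fin.rev k) else 0) +
      if i = Fin.rev k then A (Fin.rev l) j else 0 := by
  apply Subtype.ext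
  -- The index equalities are oriented in one way, so that the case split sees equal conditions on
  -- both sides.
  have h2 : Fin.rev i = k ↔ i = Fin.rev k := Fin.rev_eq_iff
  have h4 : l = Fin.rev j ↔ j = Fin.rev l := by rw [eq_comm, Fin.rev_eq_iff]
  have h5 : k = j ↔ j = k := eq_comm
  have h6 : i = l ↔ l = i := eq_comm
  have h7 : Fin.rev k = i ↔ i = Fin.rev k := eq_comm
  rw [coe_lie]
  simp only [A, mul_sub, sub_mul, single_mul_single_eq_ite, Fin.rev_inj, h2, h4, h5, h6, h7]
  split_ifs <;> simp <;> abel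

end

/-- Membership in the index set of `so(M - 4n)`. -/
def InWindow (M n : ℕ) (i : Fin M) : Prop := 2 * n ≤ i.val ∧ i.val + 2 * n < M

theorem mem_window {k : ℕ} {m : Fin M} : m ∈ window M k ↔ InWindow M (k + 1) m := by
  simp [window, InWindow, mul_add]

theorem InWindow.rev {n : ℕ} {i : Fin M} (h : InWindow M n i) : InWindow M n (Fin.rev i) := by
  obtain ⟨h1, h2⟩ := h
  constructor <;> (rw [Fin.val_rev]; omega)

theorem InWindow.mono {n n' : ℕ} (h : n ≤ n') {i : Fin M} (hi : InWindow M n' i) :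
    InWindow M n i := by
  obtain ⟨h1, h2⟩ := hi
  constructor <;> omega

theorem rev_mem_window {k : ℕ} {m : Fin M} (h : m ∈ window M k) : Fin.rev m ∈ window M k :=
  mem_window.2 (mem_window.1 h).rev

/-- A row index outside the window of `so(M - 4n)`. -/
def Outside (M n : ℕ) (a : Fin M) : Prop := a.val < 2 * n ∧ a.val + 2 * n < M

theorem InWindow.ne {n : ℕ} {i a : Fin M} (hi : InWindow M n i) (ha : Outside M n a) :
    i ≠ a ∧ i ≠ Fin.rev a ∧ a ≠ i ∧ a ≠ Fin.rev i ∧ Fin.rev a ≠ i ∧ Fin.rev i ≠ a := by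
  obtain ⟨h1, h2⟩ := hi
  obtain ⟨h3, h4⟩ := ha
  simp only [ne_eq, Fin.ext_iff, Fin.val_rev]
  omega

/-- Elements of the window act on a row outside of it. -/
theorem lie_A_rootVec {n : ℕ} {a i j m : Fin M} (ha : Outside M n a) (hi : InWindow M n i)
    (hj : InWindow M n j) :
    ⁅A i j, rootVec a m⁆ = (if j = Fin.rev m then rootVec a (Fin.rev i) else 0) -
      if m = i then rootVec a j else 0 := by
  have e1 := hi.ne ha
  have e2 := hj.ne ha
  rw [rootVec, lie_neg, A_lie, if_neg e2.1, if_neg e1.2.1, rootVec, rootVec]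
  have := A_rev_rev a (Fin.rev i)
  rw [Fin.rev_rev] at this
  rw [this]
  split_ifs <;> simp

theorem lie_A_A_outside {n : ℕ} {a b i j : Fin M} (ha : Outside M n a) (hb : Outside M n b)
    (hi : InWindow M n i) (hj : InWindow M n j) : ⁅A i j, A a b⁆ = 0 := by
  have e1 := hi.ne ha
  have e2 := hj.ne ha
  have e3 := hi.ne hb
  have e4 := hj.ne hb
  rw [A_lie, if_neg e2.1, if_neg e3.2.2.1, if_neg e4.2.1, if_neg e1.2.1]
  simp

theorem lie_A_A_outside_rev {n : ℕ} {a b i j : Fin M} (ha : Outside M n a) (hb : Outside M n b)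
    (hi : InWindow M n i) (hj : InWindow M n j) : ⁅A i j, A a (Fin.rev b)⁆ = 0 := by
  have e1 := hi.ne ha
  have e2 := hj.ne ha
  have e3 := hi.ne hb
  have e4 := hj.ne hb
  rw [A_lie, if_neg e2.1, if_neg e3.2.1.symm, Fin.rev_rev, if_neg e4.1, if_neg e1.2.1]
  simp

/-- Invariance of the sums `∑ m, X m ⊗ Y (rev m)` under the Lie algebra of the window. -/
theorem sum_window_invariant {V : Type*} [AddCommGroup V] [Module ℂ V]
    (B : so M →ₗ[ℂ] so M →ₗ[ℂ] V) {k : ℕ} {a b i j : Fin M} (ha : Outside M (k + 1) a)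
    (hb : Outside M (k + 1) b) (hi : InWindow M (k + 1) i) (hj : InWindow M (k + 1) j) :
    ∑ m ∈ window M k, (B ⁅A i j, rootVec a m⁆ (rootVec b (Fin.rev m)) +
      B (rootVec a m) ⁅A i j, rootVec b (Fin.rev m)⁆) = 0 := by
  have hi' := mem_window.2 hi
  have hj' := mem_window.2 hj
  have e (m : Fin M) : j = Fin.rev m ↔ m = Fin.rev j := by rw [eq_comm, Fin.rev_eq_iff]
  have e' (m : Fin M) : Fin.rev m = i ↔ m = Fin.rev i := Fin.rev_eq_iff
  have e'' (m : Fin M) : j = m ↔ m = j := eq_comm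
  have hB (c : Prop) [Decidable c] (x y : so M) :
      B (if c then x else 0) y = if c then B x y else 0 := by split_ifs <;> simp
  simp only [lie_A_rootVec ha hi hj, lie_A_rootVec hb hi hj, Fin.rev_rev, e, e', e'', map_sub,
    LinearMap.sub_apply, hB, apply_ite (B _), map_zero, Finset.sum_add_distrib, Finset.sum_sub_distrib, Finset.sum_ite_eq',
    rev_mem_window hi', rev_mem_window hj', hi', hj', if_true]
  abel

variable (hM : 4 * (p + 1) ≤ M) (k : Fin (p + 1))

theorem outside_row1 : Outside M (k + 1) (row1 hM k) := by
  constructor <;> simp only [row1] <;> omega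

theorem outside_row2 : Outside M (k + 1) (row2 hM k) := by
  constructor <;> simp only [row2] <;> omega

theorem inWindow_row1 : InWindow M k (row1 hM k) := by
  constructor <;> simp only [row1] <;> omega

theorem inWindow_row2 : InWindow M k (row2 hM k) := by
  constructor <;> simp only [row2] <;> omega

theorem row_ne : row1 hM k ≠ row2 hM k ∧ row2 hM k ≠ row1 hM k ∧ row1 hM k ≠ Fin.rev (row1 hM k) ∧
    row1 hM k ≠ Fin.rev (row2 hM k) ∧ row2 hM k ≠ Fin.rev (row2 hM k) ∧
    row2 hM k ≠ Fin.rev (row1 hM k) ∧ Fin.rev (row1 hM k) ≠ row1 hM k ∧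
    Fin.rev (row2 hM k) ≠ row1 hM k ∧ Fin.rev (row2 hM k) ≠ row2 hM k ∧
    Fin.rev (row1 hM k) ≠ row2 hM k := by
  simp only [row1, row2, ne_eq, Fin.ext_iff, Fin.val_rev]
  omega

theorem lie_H_H (i j : Fin M) : ⁅H i, H j⁆ = 0 := by
  rw [H, H, smul_lie, lie_smul, A_lie]
  by_cases h : i = j
  · subst h
    by_cases h : i = Fin.rev i
    · simp [← h]
    · simp [h]
  · by_cases h' : i = Fin.rev j
    · subst h'
      simp [h, Ne.symm h]
    · simp [h, h', Ne.symm h]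

section LinkBrackets

variable {hM k} {m n : Fin M}

theorem Hplus_lie_Hminus : ⁅Hplus hM k, Hminus hM k⁆ = 0 := by
  simp [Hplus, Hminus, lie_H_H]

theorem Hplus_lie_Eplus : ⁅Hplus hM k, Eplus hM k⁆ = Eplus hM k := by
  have h := row_ne hM k
  have h' := A_rev_rev (row1 hM k) (Fin.rev (row2 hM k))
  rw [Fin.rev_rev] at h'
  simp only [Hplus, Eplus, H, rootVec, lie_neg, add_lie, smul_lie, A_lie, Fin.rev_rev, h,
    if_false, if_true, h']
  module

theorem Hminus_lie_Eplus : ⁅Hminus hM k, Eplus hM k⁆ = 0 := by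
  have h := row_ne hM k
  have h' := A_rev_rev (row1 hM k) (Fin.rev (row2 hM k))
  rw [Fin.rev_rev] at h'
  simp only [Hminus, Eplus, H, rootVec, lie_neg, sub_lie, smul_lie, A_lie, Fin.rev_rev, h,
    if_false, if_true, h']
  module

theorem Hminus_lie_Eminus : ⁅Hminus hM k, Eminus hM k⁆ = Eminus hM k := by
  have h := row_ne hM k
  simp only [Hminus, Eminus, H, rootVec, lie_neg, sub_lie, smul_lie, A_lie, h,
    if_false, if_true]
  module

theorem Hplus_lie_Eminus : ⁅Hplus hM k, Eminus hM k⁆ = 0 := by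
  have h := row_ne hM k
  simp only [Hplus, Eminus, H, rootVec, lie_neg, add_lie, smul_lie, A_lie, h,
    if_false, if_true]
  module

theorem Eplus_lie_Eminus : ⁅Eplus hM k, Eminus hM k⁆ = 0 := by
  have h := row_ne hM k
  have h' := A_rev_rev (row1 hM k) (Fin.rev (row1 hM k))
  simp only [Eplus, Eminus, rootVec, lie_neg, neg_lie, A_lie, Fin.rev_rev, h,
    if_false, if_true] at h' ⊢
  -- By the reflection symmetry this generator equals its own negative.
  have h2 : A (row1 hM k) (Fin.rev (row1 hM k)) = 0 := by
    have : (2 : ℂ) • A (row1 hM k) (Fin.rev (row1 hM k)) = 0 := by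
      rw [two_smul]; nth_rw 1 [h']; simp
    simpa using this
  rw [h2]
  simp

variable (hm : m ∈ window M k)
include hm

theorem window_ne : m ≠ row1 hM k ∧ m ≠ row2 hM k ∧ m ≠ Fin.rev (row1 hM k) ∧
    m ≠ Fin.rev (row2 hM k) ∧ row1 hM k ≠ m ∧ row2 hM k ≠ m ∧
    row1 hM k ≠ Fin.rev m ∧ row2 hM k ≠ Fin.rev m ∧ Fin.rev m ≠ row1 hM k ∧
    Fin.rev m ≠ row2 hM k ∧ Fin.rev (row1 hM k) ≠ m ∧ Fin.rev (row2 hM k) ≠ m := by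
  have h1 := (mem_window.1 hm).ne (outside_row1 hM k)
  have h2 := (mem_window.1 hm).ne (outside_row2 hM k)
  tauto

theorem Hplus_lie_x : ⁅Hplus hM k, rootVec (row1 hM k) m⁆ = (1 / 2 : ℂ) • rootVec (row1 hM k) m := by
  have h := row_ne hM k
  have h' := window_ne (hM := hM) hm
  simp only [Hplus, H, rootVec, lie_neg, add_lie, smul_lie, A_lie, h, h', if_false, if_true]
  module

theorem Hplus_lie_y : ⁅Hplus hM k, rootVec (row2 hM k) m⁆ = (1 / 2 : ℂ) • rootVec (row2 hM k) m := by
  have h := row_ne hM k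
  have h' := window_ne (hM := hM) hm
  simp only [Hplus, H, rootVec, lie_neg, add_lie, smul_lie, A_lie, h, h', if_false, if_true]
  module

theorem Hminus_lie_x : ⁅Hminus hM k, rootVec (row1 hM k) m⁆ = (1 / 2 : ℂ) • rootVec (row1 hM k) m := by
  have h := row_ne hM k
  have h' := window_ne (hM := hM) hm
  simp only [Hminus, H, rootVec, lie_neg, sub_lie, smul_lie, A_lie, h, h', if_false, if_true]
  module

theorem Hminus_lie_y :
    ⁅Hminus hM k, rootVec (row2 hM k) m⁆ = (-(1 / 2) : ℂ) • rootVec (row2 hM k) m := by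
  have h := row_ne hM k
  have h' := window_ne (hM := hM) hm
  simp only [Hminus, H, rootVec, lie_neg, sub_lie, smul_lie, A_lie, h, h', if_false, if_true]
  module

theorem Eplus_lie_x : ⁅Eplus hM k, rootVec (row1 hM k) m⁆ = 0 := by
  have h := row_ne hM k
  have h' := window_ne (hM := hM) hm
  simp only [Eplus, rootVec, lie_neg, neg_lie, A_lie, h, h', if_false, Fin.rev_inj]
  simp

theorem Eplus_lie_y : ⁅Eplus hM k, rootVec (row2 hM k) m⁆ = 0 := by
  have h := row_ne hM k
  have h' := window_ne (hM := hM) hm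
  simp only [Eplus, rootVec, lie_neg, neg_lie, A_lie, h, h', if_false, Fin.rev_inj]
  simp

theorem Eminus_lie_x : ⁅Eminus hM k, rootVec (row1 hM k) m⁆ = 0 := by
  have h := row_ne hM k
  have h' := window_ne (hM := hM) hm
  simp only [Eminus, rootVec, lie_neg, neg_lie, A_lie, h, h', if_false]
  simp

theorem Eminus_lie_y : ⁅Eminus hM k, rootVec (row2 hM k) m⁆ = -rootVec (row1 hM k) m := by
  have h := row_ne hM k
  have h' := window_ne (hM := hM) hm
  simp only [Eminus, rootVec, lie_neg, neg_lie, A_lie, h, h', if_false, if_true]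
  simp

theorem x_lie_y (hn : n ∈ window M k) : ⁅rootVec (row1 hM k) m, rootVec (row2 hM k) n⁆ =
    if m = Fin.rev n then Eplus hM k else 0 := by
  have h := row_ne hM k
  have h' := window_ne (hM := hM) hm
  have h'' := window_ne (hM := hM) hn
  simp only [Eplus, rootVec, lie_neg, neg_lie, A_lie, h, h', h'', if_false]
  split_ifs <;> simp

theorem lie_rootVec_rootVec_self {a : Fin M} (ha : Outside M (k + 1) a) (hn : n ∈ window M k) :
    ⁅rootVec a m, rootVec a n⁆ = 0 := by
  have h1 := (mem_window.1 hm).ne ha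
  have h2 := (mem_window.1 hn).ne ha
  have h3 : a ≠ Fin.rev a := by
    obtain ⟨h3, h4⟩ := ha
    simp only [ne_eq, Fin.ext_iff, Fin.val_rev]
    omega
  have h' := A_rev_rev a (Fin.rev a)
  rw [Fin.rev_rev] at h'
  have h4 : A a (Fin.rev a) = 0 := by
    have : (2 : ℂ) • A a (Fin.rev a) = 0 := by
      rw [two_smul]; nth_rw 1 [h']; simp
    simpa using this
  simp only [rootVec, lie_neg, neg_lie, A_lie, h1, h2, h3, h4, if_false]
  simp

end LinkBrackets

section WindowAction

variable {hM k} {i j : Fin M} (hi : InWindow M (k + 1) i) (hj : InWindow M (k + 1) j)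
include hi hj

theorem lie_A_Hplus : ⁅A i j, Hplus hM k⁆ = 0 := by
  rw [Hplus, H, H, lie_add, lie_smul, lie_smul,
    lie_A_A_outside (outside_row1 hM k) (outside_row1 hM k) hi hj,
    lie_A_A_outside (outside_row2 hM k) (outside_row2 hM k) hi hj]
  simp

theorem lie_A_Hminus : ⁅A i j, Hminus hM k⁆ = 0 := by
  rw [Hminus, H, H, lie_sub, lie_smul, lie_smul,
    lie_A_A_outside (outside_row1 hM k) (outside_row1 hM k) hi hj,
    lie_A_A_outside (outside_row2 hM k) (outside_row2 hM k) hi hj]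
  simp

theorem lie_A_Eplus : ⁅A i j, Eplus hM k⁆ = 0 := by
  rw [Eplus, rootVec, lie_neg, lie_A_A_outside_rev (outside_row1 hM k) (outside_row2 hM k) hi hj,
    neg_zero]

theorem lie_A_Eminus : ⁅A i j, Eminus hM k⁆ = 0 := by
  rw [Eminus, rootVec, lie_neg, lie_A_A_outside (outside_row1 hM k) (outside_row2 hM k) hi hj,
    neg_zero]

end WindowAction

end OrthogonalBrackets
-- One link of the chain: Jordanian factor, extension and deformed Jordanian factor.
section Links

open PowerSeries

variable {M p : ℕ}

theorem gen_add (x y : so M) : gen (x + y) = gen x + gen y := by simp [gen]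

theorem gen_sub (x y : so M) : gen (x - y) = gen x - gen y := by simp [gen]

theorem gen_neg (x : so M) : gen (-x) = -gen x := by simp [gen]

@[simp] theorem gen_zero : gen (0 : so M) = 0 := by simp [gen]

theorem gen_smul (c : ℂ) (x : so M) : gen (c • x) = c • gen x := by
  rw [gen, map_smul]
  ext n
  rw [coeff_smul_complex, gen, coeff_C, coeff_C]
  split_ifs <;> simp

theorem gen_mul_gen (x y : so M) : gen x * gen y = gen y * gen x + gen ⁅x, y⁆ := by
  simp only [gen, ← map_mul, ← map_add, ← ι_mul_ι_sub]
  congr 1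
  abel

theorem commute_gen {x y : so M} (h : ⁅x, y⁆ = 0) : Commute (gen x) (gen y) := by
  rw [Commute, SemiconjBy, gen_mul_gen, h, gen_zero, add_zero]

theorem commute_gen' {x y : so M} (h : ⁅y, x⁆ = 0) : Commute (gen x) (gen y) :=
  (commute_gen h).symm

theorem IsPrim.gen_smul {F : (U2 M)⟦X⟧} {x : so M} (h : IsPrim F (gen x)) (c : ℂ) :
    IsPrim F (gen (c • x)) := by
  rw [FullChain.gen_smul]; exact h.smul c

theorem IsPrim.gen_neg {F : (U2 M)⟦X⟧} {x : so M} (h : IsPrim F (gen x)) :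
    IsPrim F (gen (-x)) := by
  rw [← neg_one_smul ℂ]; exact h.gen_smul _

theorem IsPrim.gen_add {F : (U2 M)⟦X⟧} {x y : so M} (h : IsPrim F (gen x))
    (h' : IsPrim F (gen y)) : IsPrim F (gen (x + y)) := by
  rw [FullChain.gen_add]; exact h.add h'

/-- The bilinear map `(x, y) ↦ x ⊗ y`. -/
noncomputable def genTens : so M →ₗ[ℂ] so M →ₗ[ℂ] (U2 M)⟦X⟧ :=
  LinearMap.mk₂ ℂ (fun x y => tens (gen x) (gen y))
    (fun _ _ _ => by rw [gen_add, add_tens]) (fun _ _ _ => by rw [gen_smul, smul_tens])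
    (fun _ _ _ => by rw [gen_add, tens_add]) (fun _ _ _ => by rw [gen_smul, tens_smul])

/-- The bilinear map `(x, y) ↦ x y`. -/
noncomputable def genMul : so M →ₗ[ℂ] so M →ₗ[ℂ] (U M)⟦X⟧ :=
  LinearMap.mk₂ ℂ (fun x y => gen x * gen y)
    (fun _ _ _ => by rw [gen_add, add_mul]) (fun _ _ _ => by rw [gen_smul, smul_mul_assoc])
    (fun _ _ _ => by rw [gen_add, mul_add]) (fun _ _ _ => by rw [gen_smul, mul_smul_comm])

theorem genTens_apply (x y : so M) : genTens x y = tens (gen x) (gen y) := rfl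

theorem genMul_apply (x y : so M) : genMul x y = gen x * gen y := rfl

section Link

variable (hM : 4 * (p + 1) ≤ M) (η ϑ : Fin (p + 1) → ℂ) (k : Fin (p + 1))

/-- The generator `X m` of the `k`-th link. -/
noncomputable def xgen (m : Fin M) : (U M)⟦X⟧ := gen (rootVec (row1 hM k) m)

/-- The generator `Y m` of the `k`-th link. -/
noncomputable def ygen (m : Fin M) : (U M)⟦X⟧ := gen (rootVec (row2 hM k) m)

/-- `exp (w σ_{1+2})`. -/
noncomputable def expPlus (w : ℂ) : (U M)⟦X⟧ := fexp (w • sigmaPlus hM η k)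

/-- The second tensor factors of the exponent of the extension. -/
noncomputable def zgen (m : Fin M) : (U M)⟦X⟧ :=
  hscale (η k) (ygen hM k (Fin.rev m) * expPlus hM η k (-(1 / 2)))

theorem sigmaPlus_eq : sigmaPlus hM η k = jlog (η k) (gen (Eplus hM k)) := rfl

theorem sigmaG_eq : sigmaG hM η ϑ k = jlog (ϑ k) (G hM η k) := rfl

theorem deformedJordanian_eq :
    deformedJordanian hM η ϑ k = fexp (tens (gen (Hminus hM k)) (jlog (ϑ k) (G hM η k))) := rfl

theorem tens_gen_gen (x y : so M) : tens (gen x) (gen y) = PowerSeries.C (ι x ⊗ₜ[ℂ] ι y) := by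
  rw [tens_eq, gen, gen, inc1, inc2, hExt_C, hExt_C, ← map_mul]
  simp

/-- Moving h, η and e^{-σ/2} into the second leg puts the exponent in the form treated by
`ExtensionData`. -/
theorem extension_eq :
    extension hM η k = fexp (∑ m ∈ window M k, tens (xgen hM k m) (zgen hM η k m)) := by
  rw [extension]
  congr 1
  rw [← hscale_apply, hscale_mul]
  simp only [zgen, tens_hscale, ← map_sum]
  congr 1
  rw [I12, map_sum, Finset.sum_mul]
  refine Finset.sum_congr rfl fun m _ => ?_
  rw [← tens_gen_gen, tens_mul_tens, mul_one]
  rfl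

theorem G_eq : G hM η k = gen (Eminus hM k) - (1 / 2 : ℂ) • hscale (η k)
    (∑ m ∈ window M k, xgen hM k m * xgen hM k (Fin.rev m)) := by
  rw [G, ← hscale_apply, ← map_smul]
  congr 2
  rw [I1]
  ext n
  simp only [xgen, gen, ← map_mul, ← map_sum, coeff_C, coeff_smul_complex]
  split_ifs <;> simp

variable {hM η ϑ k}

theorem constantCoeff_sigmaPlus : constantCoeff (sigmaPlus hM η k) = 0 := by
  simp [sigmaPlus]

theorem commute_expPlus {g : (U M)⟦X⟧} (h : Commute g (gen (Eplus hM k))) (w : ℂ) :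
    Commute g (expPlus hM η k w) :=
  commute_fexp (by simp [constantCoeff_sigmaPlus]) ((commute_jlog h (η k)).smul_right w)

theorem expPlus_mul (w w' : ℂ) :
    expPlus hM η k w * expPlus hM η k w' = expPlus hM η k (w + w') := by
  rw [expPlus, expPlus, expPlus, add_smul, fexp_add (by simp [constantCoeff_sigmaPlus])
    (by simp [constantCoeff_sigmaPlus]) (((Commute.refl _).smul_left _).smul_right _)]

theorem expPlus_zero : expPlus hM η k 0 = 1 := by
  rw [expPlus, zero_smul, fexp_zero]

theorem expPlus_one : expPlus hM η k 1 = 1 + hscale (η k) (gen (Eplus hM k)) := by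
  rw [expPlus, one_smul, sigmaPlus_eq, fexp_jlog, hscale_apply]

/-- Since hηE = e^σ - 1, the bracket of Y with X, which is proportional to E, becomes a difference
of e^{±σ/2} once e^{-σ/2} is attached to Y. This is the term N - S of the extension relations, up to
sign. -/
theorem hscale_Eplus_mul :
    hscale (η k) (gen (Eplus hM k) * expPlus hM η k (-(1 / 2))) =
      expPlus hM η k (1 / 2) - expPlus hM η k (-(1 / 2)) := by
  have h : hscale (η k) (gen (Eplus hM k)) = expPlus hM η k 1 - 1 := by rw [expPlus_one]; abel
  rw [← hscale_mul, h, sub_mul, expPlus_mul, one_mul]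
  norm_num

theorem commute_Eplus_x {m : Fin M} (hm : m ∈ window M k) :
    Commute (xgen hM k m) (gen (Eplus hM k)) := commute_gen' (Eplus_lie_x hm)

theorem commute_Eplus_y {m : Fin M} (hm : m ∈ window M k) :
    Commute (ygen hM k m) (gen (Eplus hM k)) := commute_gen' (Eplus_lie_y hm)

theorem commute_x_x {m n : Fin M} (hm : m ∈ window M k) (hn : n ∈ window M k) :
    Commute (xgen hM k m) (xgen hM k n) :=
  commute_gen (lie_rootVec_rootVec_self hm (outside_row1 hM k) hn)

theorem commute_y_y {m n : Fin M} (hm : m ∈ window M k) (hn : n ∈ window M k) :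
    Commute (ygen hM k m) (ygen hM k n) :=
  commute_gen (lie_rootVec_rootVec_self hm (outside_row2 hM k) hn)

theorem commute_zgen {g : (U M)⟦X⟧} {m : Fin M} (h : Commute g (ygen hM k (Fin.rev m)))
    (h' : Commute g (gen (Eplus hM k))) : Commute g (zgen hM η k m) :=
  semiconjBy_hscale _ (h.mul_right (commute_expPlus h' _))

/-- An element that commutes with `E_{1-2}` and with `I^1` commutes with `G`. -/
theorem commute_G {g : (U M)⟦X⟧} (h : Commute g (gen (Eminus hM k)))
    (h' : Commute g (∑ m ∈ window M k, xgen hM k m * xgen hM k (Fin.rev m))) :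
    Commute g (G hM η k) := by
  rw [G_eq]
  exact h.sub_right ((show Commute _ _ from semiconjBy_hscale _ h').smul_right _)

theorem commute_Eplus_G : Commute (gen (Eplus hM k)) (G hM η k) :=
  commute_G (commute_gen Eplus_lie_Eminus) (Commute.sum_right _ _ _ fun _ hm =>
    (commute_Eplus_x hm).symm.mul_right (commute_Eplus_x (rev_mem_window hm)).symm)

section Window

variable {i j : Fin M} (hi : InWindow M (k + 1) i) (hj : InWindow M (k + 1) j)
include hi hj

/-- The quadratic element I^1 is invariant under the orthogonal algebra of the window:
`sum_window_invariant` applied to the product map, with the first row in both slots. -/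
theorem commute_A_G : Commute (gen (A i j)) (G hM η k) := by
  refine commute_G (commute_gen (lie_A_Eminus hi hj)) ?_
  have h := sum_window_invariant genMul (outside_row1 hM k) (outside_row1 hM k) hi hj
  rw [Finset.sum_add_distrib] at h
  simp only [genMul_apply] at h
  rw [Commute, SemiconjBy, Finset.mul_sum, Finset.sum_mul, ← sub_eq_zero, ← h,
    ← Finset.sum_sub_distrib, ← Finset.sum_add_distrib]
  refine Finset.sum_congr rfl fun m _ => ?_
  rw [xgen, xgen, ← mul_assoc, gen_mul_gen (A i j), add_mul, mul_assoc, gen_mul_gen (A i j)]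
  noncomm_ring

/-- The same invariance for the tensor map and the two different rows; the factor e^{-σ/2} is
harmless because E_{1+2} commutes with the window. -/
theorem commute_A_sigma_extension :
    Commute (tens (gen (A i j)) 1 + tens 1 (gen (A i j)))
      (∑ m ∈ window M k, tens (xgen hM k m) (zgen hM η k m)) := by
  have h := sum_window_invariant genTens (outside_row1 hM k) (outside_row2 hM k) hi hj
  simp only [genTens_apply] at h
  have e : ∑ m ∈ window M k, tens (xgen hM k m) (zgen hM η k m) =
      hscale (η k) ((∑ m ∈ window M k, tens (xgen hM k m) (ygen hM k (Fin.rev m))) *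
        tens 1 (expPlus hM η k (-(1 / 2)))) := by
    simp only [zgen, tens_hscale, ← map_sum, Finset.sum_mul, tens_mul_tens, mul_one]
  have h1 : Commute (tens (gen (A i j)) 1 + tens 1 (gen (A i j)))
      (∑ m ∈ window M k, tens (xgen hM k m) (ygen hM k (Fin.rev m))) := by
    rw [Commute, SemiconjBy, Finset.mul_sum, Finset.sum_mul, ← sub_eq_zero, ← h,
      ← Finset.sum_sub_distrib]
    refine Finset.sum_congr rfl fun m _ => ?_
    simp only [add_mul, mul_add, tens_mul_tens, one_mul, mul_one, xgen, ygen,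
      gen_mul_gen (A i j), add_tens, tens_add]
    abel
  have h2 : Commute (tens (gen (A i j)) 1 + tens 1 (gen (A i j)))
      (tens 1 (expPlus hM η k (-(1 / 2)))) := by
    have := (commute_expPlus (η := η) (commute_gen (lie_A_Eplus (hM := hM) hi hj)) (-(1 / 2))).eq
    simp only [Commute, SemiconjBy, add_mul, mul_add, tens_mul_tens, one_mul, mul_one, this]
  rw [e]
  exact semiconjBy_hscale _ (h1.mul_right h2)

theorem commute_A_sigmaPlus : Commute (gen (A i j)) (sigmaPlus hM η k) :=
  commute_jlog (commute_gen (lie_A_Eplus hi hj)) _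

theorem commute_A_sigmaG : Commute (gen (A i j)) (sigmaG hM η ϑ k) :=
  commute_jlog (commute_A_G hi hj) _

end Window

/-- All `A i j` in the window of the `n`-th link are primitive for the coproduct twisted by `F`. -/
def PrimOnWindow (n : ℕ) (F : (U2 M)⟦X⟧) : Prop :=
  ∀ i j : Fin M, InWindow M n i → InWindow M n j → IsPrim F (gen (A i j))

namespace PrimOnWindow

variable {F : (U2 M)⟦X⟧} (h : PrimOnWindow k F)
include h

theorem Hplus : IsPrim F (gen (Hplus hM k)) :=
  ((h _ _ (inWindow_row1 hM k) (inWindow_row1 hM k)).gen_smul _).gen_add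
    ((h _ _ (inWindow_row2 hM k) (inWindow_row2 hM k)).gen_smul _)

theorem Hminus : IsPrim F (gen (Hminus hM k)) := by
  rw [FullChain.Hminus, sub_eq_add_neg]
  exact ((h _ _ (inWindow_row1 hM k) (inWindow_row1 hM k)).gen_smul _).gen_add
    ((h _ _ (inWindow_row2 hM k) (inWindow_row2 hM k)).gen_smul _).gen_neg

theorem Eplus : IsPrim F (gen (Eplus hM k)) :=
  (h _ _ (inWindow_row1 hM k) (inWindow_row2 hM k).rev).gen_neg

theorem Eminus : IsPrim F (gen (Eminus hM k)) :=
  (h _ _ (inWindow_row1 hM k) (inWindow_row2 hM k)).gen_neg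

theorem x {m : Fin M} (hm : m ∈ window M k) : IsPrim F (xgen hM k m) :=
  (h _ _ (inWindow_row1 hM k) ((mem_window.1 hm).mono (Nat.le_succ _))).gen_neg

theorem y {m : Fin M} (hm : m ∈ window M k) : IsPrim F (ygen hM k m) :=
  (h _ _ (inWindow_row2 hM k) ((mem_window.1 hm).mono (Nat.le_succ _))).gen_neg

theorem jordanianPair : JordanianPair F (gen (FullChain.Hplus hM k)) (gen (FullChain.Eplus hM k)) :=
  ⟨h.Hplus, h.Eplus, by rw [gen_mul_gen, Hplus_lie_Eplus], counit_gen _, counit_gen _⟩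

end PrimOnWindow

theorem counit_hscale {c : ℂ} {f : (U M)⟦X⟧} (hf : hExt (counit M) f = 0) :
    hExt (counit M) (hscale c f) = 0 := by
  rw [hExt_hscale, hf, map_zero]

/-- X and Y have weight 1/2 under H_{1+2} and commute with E_{1+2}, so S = e^{σ/2}. In z the factor
e^{-σ/2}, group-like after the Jordanian twist, cancels this S in the first term of the coproduct
and contributes N to the second. -/
theorem extensionData {F : (U2 M)⟦X⟧} (hF : IsTwist F) (h : PrimOnWindow k F) :
    ExtensionData (window M k) (jordanian hM η k * F) (xgen hM k) (zgen hM η k)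
      (expPlus hM η k (1 / 2)) (expPlus hM η k (-(1 / 2))) := by
  have hzE {m : Fin M} (hm : m ∈ window M k) : Commute (gen (Eplus hM k)) (zgen hM η k m) :=
    commute_zgen (commute_Eplus_y (rev_mem_window hm)).symm (Commute.refl _)
  have hDx {g : (U M)⟦X⟧} (hp : IsPrim F g)
      (hH : gen (Hplus hM k) * g = g * gen (Hplus hM k) + (1 / 2 : ℂ) • g)
      (hE : Commute (gen (Eplus hM k)) g) :
      SemiconjBy (jordanian hM η k * F) (Delta M g)
        (tens g (expPlus hM η k (1 / 2)) + tens 1 g) :=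
    jordanian_semiconjBy (η k) hp hH hE
  refine
    { S_mul_N := by rw [expPlus_mul, add_neg_cancel, expPlus_zero]
      comm_x_S := fun m hm => commute_expPlus (commute_Eplus_x hm) _
      comm_x_N := fun m hm => commute_expPlus (commute_Eplus_x hm) _
      comm_z_S := fun m hm => commute_expPlus (hzE hm).symm _
      comm_z_N := fun m hm => commute_expPlus (hzE hm).symm _
      comm_x_x := fun m hm n hn => commute_x_x hm hn
      comm_z_z := fun m hm n hn => ?_
      z_mul_x := fun m hm n hn => ?_
      constantCoeff_z := fun m hm => by simp [zgen]
      counit_x := fun m hm => counit_gen _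
      counit_z := fun m hm => counit_hscale (by rw [map_mul, ygen, counit_gen, zero_mul])
      Delta_x := fun m hm => ?_
      Delta_z := fun m hm => ?_ }
  · have hm' := rev_mem_window hm
    have hn' := rev_mem_window hn
    refine commute_zgen (Commute.symm (commute_zgen (commute_y_y hn' hm') (commute_Eplus_y hn'))) ?_
    exact (hzE hm).symm
  · have hm' := rev_mem_window hm
    -- The bracket [X_n, Y_{rev m}] is E_{1+2} exactly when n = m; the reversed order gives the
    -- minus sign that makes the result N - S.
    have e : ygen hM k (Fin.rev m) * xgen hM k n = xgen hM k n * ygen hM k (Fin.rev m) -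
        if m = n then gen (Eplus hM k) else 0 := by
      have := gen_mul_gen (rootVec (row1 hM k) n) (rootVec (row2 hM k) (Fin.rev m))
      rw [x_lie_y hn hm', Fin.rev_rev, apply_ite gen, gen_zero] at this
      rw [xgen, ygen, this]
      by_cases hmn : m = n
      · simp [hmn]
      · simp [hmn, Ne.symm hmn]
    rw [zgen, hscale_mul, mul_hscale, mul_assoc,
      ← (commute_expPlus (commute_Eplus_x hn) _).eq, ← mul_assoc, e, sub_mul, map_sub, mul_assoc]
    split_ifs
    · rw [hscale_Eplus_mul]; abel
    · simp
  · refine hDx (h.x hm) ?_ (commute_Eplus_x hm).symm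
    rw [xgen, gen_mul_gen, Hplus_lie_x hm, gen_smul]
  · have hm' := rev_mem_window hm
    have h1 := hDx (h.y hm') (by rw [ygen, gen_mul_gen, Hplus_lie_y hm', gen_smul])
      (commute_Eplus_y hm').symm
    have h2 : SemiconjBy (jordanian hM η k * F) (Delta M (expPlus hM η k (-(1 / 2))))
        (tens (expPlus hM η k (-(1 / 2))) (expPlus hM η k (-(1 / 2)))) := by
      have hs0 : constantCoeff (sigmaPlus hM η k) = 0 := constantCoeff_sigmaPlus
      have h3 := (h.jordanianPair (hM := hM)).isPrim_jlog (η k) hF.isUnit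
      have h4 := h3.smul (-(1 / 2))
      have h5 := semiconjBy_fexp (by simp [Delta, hs0, ← sigmaPlus_eq])
        (by simp [constantCoeff_tens, constantCoeff_tens_left]) h4
      have h6 : fexp (tens ((-(1 / 2) : ℂ) • sigmaPlus hM η k) 1 +
          tens 1 ((-(1 / 2) : ℂ) • sigmaPlus hM η k)) =
          tens (expPlus hM η k (-(1 / 2))) (expPlus hM η k (-(1 / 2))) := by
        rw [fexp_add (constantCoeff_tens_left (by simp [hs0])) (constantCoeff_tens (by simp [hs0]))
          (by simp only [Commute, SemiconjBy, tens_mul_tens, one_mul, mul_one]), ← inc1_fexp,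
          ← inc2_fexp, tens_mul_tens, mul_one, one_mul]
        rfl
      rw [← sigmaPlus_eq, h6] at h5
      rw [expPlus, Delta, map_fexp]
      exact h5
    have h7 := semiconjBy_hscale (η k) (h1.mul_right h2)
    rw [zgen, Delta, hExt_hscale, map_mul, ← Delta]
    convert h7 using 1
    rw [add_mul, tens_mul_tens, tens_mul_tens, expPlus_mul, add_neg_cancel, expPlus_zero, one_mul,
      map_add, hscale_tens, tens_hscale]

theorem commute_fexp_tens {s a b : (U M)⟦X⟧} (hb : constantCoeff b = 0) (ha : Commute s a)
    (hsb : Commute s b) : Commute (fexp (tens a b)) (tens s 1 + tens 1 s) := by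
  refine (commute_fexp (constantCoeff_tens hb) ?_).symm
  simp only [Commute, SemiconjBy, add_mul, mul_add, tens_mul_tens, one_mul, mul_one, ha.eq, hsb.eq]

/-- An element that commutes with the generators of the `k`-th link is not affected by it. -/
theorem commute_link {s : (U M)⟦X⟧} (h1 : Commute s (gen (Hplus hM k)))
    (h2 : Commute s (gen (Hminus hM k))) (h3 : Commute s (gen (Eplus hM k)))
    (h4 : Commute s (gen (Eminus hM k))) (h5 : ∀ m ∈ window M k, Commute s (xgen hM k m))
    (h6 : ∀ m ∈ window M k, Commute s (ygen hM k m)) :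
    Commute (link hM η ϑ k) (tens s 1 + tens 1 s) := by
  rw [link]
  refine Commute.mul_left (Commute.mul_left ?_ ?_) ?_
  · refine commute_fexp_tens (by simp [sigmaG_eq]) h2 (commute_jlog (commute_G h4 ?_) _)
    exact Commute.sum_right _ _ _ fun m hm => (h5 m hm).mul_right (h5 _ (rev_mem_window hm))
  · rw [extension_eq]
    refine (commute_fexp ?_ (Commute.sum_right _ _ _ fun m hm => ?_)).symm
    · rw [map_sum]
      exact Finset.sum_eq_zero fun m hm => constantCoeff_tens (by simp [zgen])
    · have e1 := (h5 m hm).eq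
      have e2 := (commute_zgen (η := η) (h6 _ (rev_mem_window hm)) h3).eq
      simp only [Commute, SemiconjBy, add_mul, mul_add, tens_mul_tens, one_mul, mul_one, e1, e2]
  · exact commute_fexp_tens constantCoeff_sigmaPlus h1 (commute_jlog h3 _)

/-- The inductive step. Primitivity of the generators of so(M-4k) is all the input that a link
needs, and besides the twist property and the new primitive σ's it returns the same statement for
so(M-4(k+1)). -/
theorem isTwist_link_mul {F : (U2 M)⟦X⟧} (hF : IsTwist F) (h : PrimOnWindow k F) :
    IsTwist (link hM η ϑ k * F) ∧ IsPrim (link hM η ϑ k * F) (sigmaPlus hM η k) ∧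
      IsPrim (link hM η ϑ k * F) (sigmaG hM η ϑ k) ∧
      PrimOnWindow (k + 1) (link hM η ϑ k * F) := by
  have hJ := h.jordanianPair (hM := hM)
  set F1 := jordanian hM η k * F with hF1
  have t1 : IsTwist F1 := hJ.isTwist (η k) hF
  have hD := extensionData (hM := hM) (η := η) hF h
  rw [← hF1] at hD
  set F2 := extension hM η k * F1 with hF2
  have hext := extension_eq hM η k
  have t2 : IsTwist F2 := by rw [hF2, hext]; exact hD.isTwist t1
  have link_eq : link hM η ϑ k * F = deformedJordanian hM η ϑ k * F2 := by
    rw [link, hF2, hF1]; noncomm_ring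
  -- E_{1-2} survives the Jordanian factor, having weight 0 and commuting with E_{1+2}. In the
  -- extension [E_{1-2}, Y] = -X gives the commutator hηX e^{-σ/2} required by `isPrim_sub_hscale`.
  have hEmG : IsPrim F2 (G hM η k) := by
    rw [hF2, hext, G_eq]
    refine hD.isPrim_sub_hscale (fun m hm => rev_mem_window hm) Fin.rev_rev (η k) ?_ ?_ ?_
    · exact isPrim_jordanian_mul (η k) h.Eminus (commute_gen Hplus_lie_Eminus)
        (commute_gen Eplus_lie_Eminus)
    · exact fun m hm => commute_gen' (Eminus_lie_x hm)
    · intro m hm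
      have hm' := rev_mem_window hm
      have e : ygen hM k (Fin.rev m) * gen (Eminus hM k) =
          gen (Eminus hM k) * ygen hM k (Fin.rev m) + xgen hM k (Fin.rev m) := by
        have := gen_mul_gen (Eminus hM k) (rootVec (row2 hM k) (Fin.rev m))
        rw [Eminus_lie_y hm', gen_neg] at this
        rw [ygen, this, xgen]
        abel
      rw [zgen, hscale_mul, mul_hscale, mul_assoc,
        ← (commute_expPlus (commute_gen' Eplus_lie_Eminus) _).eq, ← mul_assoc, e, add_mul, map_add,
        mul_assoc]
  have prim2 {y : (U M)⟦X⟧} (hy : IsPrim F1 y) (hc : Commute (tens y 1 + tens 1 y)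
      (∑ m ∈ window M k, tens (xgen hM k m) (zgen hM η k m))) : IsPrim F2 y := by
    rw [hF2, hext]; exact hD.isPrim_of_commute hy hc
  -- The weights 1/2 on X and -1/2 on Y cancel in X ⊗ z, so the exponent of the extension is
  -- invariant.
  have hHm : IsPrim F2 (gen (Hminus hM k)) := by
    refine prim2 (isPrim_jordanian_mul (η k) h.Hminus (commute_gen Hplus_lie_Hminus)
      (commute_gen' Hminus_lie_Eplus)) (Commute.sum_right _ _ _ fun m hm => ?_)
    have hm' := rev_mem_window hm
    have e1 : gen (Hminus hM k) * xgen hM k m =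
        xgen hM k m * gen (Hminus hM k) + (1 / 2 : ℂ) • xgen hM k m := by
      rw [xgen, gen_mul_gen, Hminus_lie_x hm, gen_smul]
    have e2 : gen (Hminus hM k) * zgen hM η k m =
        zgen hM η k m * gen (Hminus hM k) + (-(1 / 2) : ℂ) • zgen hM η k m := by
      rw [zgen, mul_hscale, hscale_mul, ← map_smul, ← map_add, mul_assoc,
        ← (commute_expPlus (commute_gen Hminus_lie_Eplus) _).eq, ← mul_assoc, ← mul_assoc, ygen,
        gen_mul_gen, Hminus_lie_y hm', gen_smul, add_mul, smul_mul_assoc]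
    simp only [Commute, SemiconjBy, add_mul, mul_add, tens_mul_tens, one_mul, mul_one, e1, e2,
      add_tens, tens_add, smul_tens, tens_smul]
    module
  -- I^1 is quadratic in vectors of weight 1/2, hence of weight 1 like E_{1-2}; so [H_{1-2}, G] = G.
  have hJ' : JordanianPair F2 (gen (Hminus hM k)) (G hM η k) := by
    refine ⟨hHm, hEmG, ?_, counit_gen _, ?_⟩
    · have e : gen (Hminus hM k) * (∑ m ∈ window M k, xgen hM k m * xgen hM k (Fin.rev m)) =
          (∑ m ∈ window M k, xgen hM k m * xgen hM k (Fin.rev m)) * gen (Hminus hM k) +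
            ∑ m ∈ window M k, xgen hM k m * xgen hM k (Fin.rev m) := by
        rw [Finset.mul_sum, Finset.sum_mul, ← Finset.sum_add_distrib]
        refine Finset.sum_congr rfl fun m hm => ?_
        rw [xgen, xgen, ← mul_assoc, gen_mul_gen, Hminus_lie_x hm, gen_smul, add_mul, mul_assoc,
          gen_mul_gen, Hminus_lie_x (rev_mem_window hm), gen_smul, mul_add, smul_mul_assoc,
          mul_smul_comm, mul_assoc]
        module
      rw [G_eq, mul_sub, sub_mul, gen_mul_gen, Hminus_lie_Eminus, mul_smul_comm, mul_hscale, e,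
        map_add, smul_mul_assoc, hscale_mul]
      module
    · rw [G_eq, map_sub, counit_gen, map_smul, counit_hscale, smul_zero, sub_zero]
      rw [map_sum]
      exact Finset.sum_eq_zero fun m _ => by rw [map_mul, xgen, counit_gen, zero_mul]
  rw [link_eq, deformedJordanian_eq]
  refine ⟨hJ'.isTwist (ϑ k) t2, ?_, ?_, ?_⟩
  · rw [sigmaPlus_eq]
    refine isPrim_jordanian_mul (ϑ k) (prim2 (hJ.isPrim_jlog (η k) hF.isUnit) ?_) ?_ ?_
    · refine Commute.sum_right _ _ _ fun m hm => ?_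
      have e1 := (commute_jlog (commute_Eplus_x (hM := hM) hm) (η k)).eq
      have e2 := (commute_jlog (commute_zgen (η := η)
        (commute_Eplus_y (hM := hM) (rev_mem_window hm)).symm (Commute.refl _)).symm (η k)).eq
      simp only [Commute, SemiconjBy, add_mul, mul_add, tens_mul_tens, one_mul, mul_one, e1, e2]
    · exact commute_jlog (commute_gen Hminus_lie_Eplus) _
    · exact commute_jlog commute_Eplus_G.symm _
  · exact hJ'.isPrim_jlog (ϑ k) t2.isUnit
  · intro i j hi hj
    refine isPrim_jordanian_mul (ϑ k) (prim2 (isPrim_jordanian_mul (η k) (h i j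
      (hi.mono (Nat.le_succ _)) (hj.mono (Nat.le_succ _))) ?_ ?_) ?_) ?_ ?_
    · exact commute_gen' (lie_A_Hplus hi hj)
    · exact commute_gen' (lie_A_Eplus hi hj)
    · exact commute_A_sigma_extension hi hj
    · exact commute_gen' (lie_A_Hminus hi hj)
    · exact (commute_A_G hi hj).symm

end Link

end Links
-- The full chain, by induction on the links, and the Reshetikhin factor.
section Chain

open PowerSeries

variable {M p : ℕ} {hM : 4 * (p + 1) ≤ M} {η ϑ : Fin (p + 1) → ℂ} {k : Fin (p + 1)}

/-- The element `s` commutes with all generators of the `k`-th link. -/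
structure CommutesWithLink (hM : 4 * (p + 1) ≤ M) (k : Fin (p + 1)) (s : (U M)⟦X⟧) : Prop where
  Hplus : Commute s (gen (Hplus hM k))
  Hminus : Commute s (gen (Hminus hM k))
  Eplus : Commute s (gen (Eplus hM k))
  Eminus : Commute s (gen (Eminus hM k))
  x : ∀ m ∈ window M k, Commute s (xgen hM k m)
  y : ∀ m ∈ window M k, Commute s (ygen hM k m)

/-- All generators of link k are combinations of the `A i j` with indices in the window of any
earlier level n ≤ k. -/
theorem commutesWithLink {s : (U M)⟦X⟧} {n : ℕ} (hn : n ≤ k)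
    (h : ∀ i j : Fin M, InWindow M n i → InWindow M n j → Commute (gen (A i j)) s) :
    CommutesWithLink hM k s := by
  have h1 := (inWindow_row1 hM k).mono hn
  have h2 := (inWindow_row2 hM k).mono hn
  have hw {m : Fin M} (hm : m ∈ window M k) : InWindow M n m :=
    (mem_window.1 hm).mono (hn.trans (Nat.le_succ _))
  have hA {i j : Fin M} (hi : InWindow M n i) (hj : InWindow M n j) :
      Commute s (gen (rootVec i j)) := by
    rw [rootVec, gen_neg]; exact (h i j hi hj).symm.neg_right
  have hH {i : Fin M} (hi : InWindow M n i) : Commute s (gen (H i)) := by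
    rw [H, gen_smul]; exact (h i i hi hi).symm.smul_right _
  refine ⟨?_, ?_, hA h1 h2.rev, hA h1 h2, fun m hm => hA h1 (hw hm), fun m hm => hA h2 (hw hm)⟩
  · rw [Hplus, gen_add]; exact (hH h1).add_right (hH h2)
  · rw [Hminus, gen_sub]; exact (hH h1).sub_right (hH h2)

theorem CommutesWithLink.link {s : (U M)⟦X⟧} (h : CommutesWithLink hM k s) :
    Commute (link hM η ϑ k) (tens s 1 + tens 1 s) :=
  commute_link h.Hplus h.Hminus h.Eplus h.Eminus h.x h.y

theorem CommutesWithLink.sigma {s : (U M)⟦X⟧} (h : CommutesWithLink hM k s) :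
    Commute s (sigmaPlus hM η k) ∧ Commute s (sigmaG hM η ϑ k) := by
  refine ⟨commute_jlog h.Eplus _, commute_jlog (commute_G h.Eminus ?_) _⟩
  exact Commute.sum_right _ _ _ fun m hm => (h.x m hm).mul_right (h.x _ (rev_mem_window hm))

/-- The link to which a label belongs. -/
def linkIndex : Idx p → Fin (p + 1) := Sum.elim id id

/-- The σ's of link j commute with so(M-4(j+1)), which contains every later link. -/
theorem commutesWithLink_sigma {i : Idx p} (h : linkIndex i < k) :
    CommutesWithLink hM k (sigma hM η ϑ i) := by
  cases i with
  | inl j => exact commutesWithLink (n := j + 1) (Nat.succ_le_of_lt h) fun a b ha hb =>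
      commute_A_sigmaPlus ha hb
  | inr j => exact commutesWithLink (n := j + 1) (Nat.succ_le_of_lt h) fun a b ha hb =>
      commute_A_sigmaG ha hb

theorem commute_sigma_of_lt {i j : Idx p} (h : linkIndex i < linkIndex j) :
    Commute (sigma hM η ϑ i) (sigma hM η ϑ j) := by
  have := (commutesWithLink_sigma (hM := hM) (η := η) (ϑ := ϑ) h).sigma (η := η) (ϑ := ϑ)
  cases j with
  | inl j => exact this.1
  | inr j => exact this.2

theorem commute_sigmaPlus_sigmaG : Commute (sigmaPlus hM η k) (sigmaG hM η ϑ k) :=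
  commute_jlog (commute_jlog commute_Eplus_G.symm _).symm _

theorem commute_sigma (i j : Idx p) : Commute (sigma hM η ϑ i) (sigma hM η ϑ j) := by
  rcases lt_trichotomy (linkIndex i) (linkIndex j) with h | h | h
  · exact commute_sigma_of_lt h
  · cases i <;> cases j <;> simp only [linkIndex, Sum.elim_inl, Sum.elim_inr, id] at h <;> subst h
    · exact Commute.refl _
    · exact commute_sigmaPlus_sigmaG
    · exact commute_sigmaPlus_sigmaG.symm
    · exact Commute.refl _
  · exact (commute_sigma_of_lt h).symm

/-- Three facts must be carried together: the next link needs primitivity on the window, and the σ's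
already produced must survive it. -/
theorem partialChain (n : ℕ) (hn : n ≤ p + 1) (F : (U2 M)⟦X⟧)
    (hF : F = (List.ofFn fun i : Fin n => link hM η ϑ (Fin.castLE hn i)).reverse.prod) :
    IsTwist F ∧ PrimOnWindow n F ∧
      ∀ i : Idx p, (linkIndex i).val < n → IsPrim F (sigma hM η ϑ i) := by
  induction n generalizing F with
  | zero =>
    simp only [List.ofFn_zero, List.reverse_nil, List.prod_nil] at hF
    subst hF
    exact ⟨isTwist_one, fun i j _ _ => isPrim_one_gen _, fun i hi => absurd hi (Nat.not_lt_zero _)⟩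
  | succ n ih =>
    obtain ⟨h1, h2, h3⟩ := ih (Nat.le_of_succ_le hn) _ rfl
    -- The last link is split off; after reversal it is the leftmost factor, the form expected by
    -- `isTwist_link_mul`.
    rw [List.ofFn_succ', List.concat_eq_append, List.reverse_append, List.reverse_singleton,
      List.singleton_append, List.prod_cons] at hF
    set k : Fin (p + 1) := ⟨n, hn⟩ with hk
    have hF' : F = link hM η ϑ k *
      (List.ofFn fun i : Fin n => link hM η ϑ (Fin.castLE (Nat.le_of_succ_le hn) i)).reverse.prod :=
      hF
    obtain ⟨s1, s2, s3, s4⟩ := isTwist_link_mul (hM := hM) (η := η) (ϑ := ϑ) (k := k) h1 h2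
    rw [← hF'] at s1 s2 s3 s4
    refine ⟨s1, s4, fun i hi => ?_⟩
    rcases Nat.lt_succ_iff_lt_or_eq.1 hi with h | h
    · rw [hF']
      -- A σ of an earlier link commutes with all generators of the new one, so σ⊗1 + 1⊗σ commutes
      -- with the new factor.
      exact (h3 i h).mul_left (commutesWithLink_sigma (k := k) h).link
    · have hik : linkIndex i = k := Fin.ext h
      cases i with
      | inl j => simp only [linkIndex, Sum.elim_inl, id] at hik; subst hik; exact s2
      | inr j => simp only [linkIndex, Sum.elim_inr, id] at hik; subst hik; exact s3

theorem isTwist_fullChain : IsTwist (fullChain hM η ϑ) :=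
  (partialChain (p + 1) le_rfl _ rfl).1

theorem isPrim_fullChain_sigma (i : Idx p) : IsPrim (fullChain hM η ϑ) (sigma hM η ϑ i) :=
  (partialChain (p + 1) le_rfl _ rfl).2.2 i (linkIndex i).isLt

section Reshetikhin

theorem X_mul_divX {B : Type*} [Ring B] {f : B⟦X⟧} (hf : constantCoeff f = 0) :
    X * divX f = f := by
  ext n
  cases n with
  | zero => simp [hf]
  | succ n => simp [divX, coeff_succ_X_mul]

theorem commute_of_X_mul {B : Type*} [Ring B] {f g : B⟦X⟧} (h : Commute (X * f) g) :
    Commute f g := by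
  refine X_mul_injective ?_
  rw [← mul_assoc, h.eq, X_mul (φ := f), X_mul (φ := g * f), mul_assoc]

theorem constantCoeff_sigma (i : Idx p) : constantCoeff (sigma hM η ϑ i) = 0 := by
  cases i <;> simp [sigma, sigmaPlus, sigmaG]

theorem counit_sigma (i : Idx p) : hExt (counit M) (sigma hM η ϑ i) = 0 := by
  cases i with
  | inl k =>
    exact hExt_counit_flog1p (by rw [map_mul, map_smul, counit_gen, smul_zero, mul_zero])
  | inr k =>
    refine hExt_counit_flog1p ?_
    rw [map_mul, map_smul, G_eq, map_sub, counit_gen, map_smul, counit_hscale, smul_zero, sub_zero,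
      smul_zero, mul_zero]
    rw [map_sum]
    exact Finset.sum_eq_zero fun m _ => by rw [map_mul, xgen, counit_gen, zero_mul]

variable (hM η ϑ) in
/-- The series `σ_i / h`. -/
noncomputable def tau (i : Idx p) : (U M)⟦X⟧ := divX (sigma hM η ϑ i)

theorem X_mul_tau (i : Idx p) : X * tau hM η ϑ i = sigma hM η ϑ i :=
  X_mul_divX (constantCoeff_sigma i)

variable (ζ : Idx p → Idx p → ℂ)

/-- The factor h⁻¹ is absorbed into the first leg as σ_i / h, and the sum over j into the second
leg, giving one tensor per label. -/
theorem reshetikhin_eq : reshetikhin hM η ϑ ζ =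
    fexp (∑ i, tens (tau hM η ϑ i) (∑ j, ζ i j • sigma hM η ϑ j)) := by
  rw [reshetikhin]
  congr 1
  refine X_mul_injective ?_
  have h0 : constantCoeff (∑ i, ∑ j, ζ i j • tens (sigma hM η ϑ i) (sigma hM η ϑ j)) = 0 := by
    simp [constantCoeff_tens, constantCoeff_sigma]
  rw [X_mul_divX h0, Finset.mul_sum]
  refine Finset.sum_congr rfl fun i _ => ?_
  rw [X_mul_tens, ← tens_X_mul, X_mul_tau, tens_sum]
  simp only [tens_smul]

theorem isTwist_reshetikhin_mul : IsTwist (reshetikhin hM η ϑ ζ * fullChain hM η ϑ) := by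
  have hc : ∀ i j, Commute (tau hM η ϑ i) (sigma hM η ϑ j) := fun i j =>
    commute_of_X_mul (by rw [X_mul_tau]; exact commute_sigma i j)
  rw [reshetikhin_eq]
  refine isTwist_mul_of_commute_prim Finset.univ isTwist_fullChain ?_ ?_ ?_ ?_ ?_ ?_ ?_ ?_
  · exact fun i _ => IsPrim.of_X_mul (by rw [X_mul_tau]; exact isPrim_fullChain_sigma i)
  · exact fun i _ => IsPrim.sum _ fun j _ => (isPrim_fullChain_sigma j).smul _
  · exact fun i _ j _ => (commute_of_X_mul (by rw [X_mul_tau]; exact (hc i j).symm)).symm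
  · exact fun i _ j _ => Commute.sum_right _ _ _ fun l _ => (hc i l).smul_right _
  · exact fun i _ j _ => Commute.sum_right _ _ _ fun l _ => Commute.sum_left _ _ _ fun l' _ =>
      ((commute_sigma l' l).smul_right _).smul_left _
  · intro i _
    simp [constantCoeff_sigma]
  · intro i _
    refine X_mul_injective ?_
    rw [mul_zero, ← counit_sigma (hM := hM) (η := η) (ϑ := ϑ) i, ← X_mul_tau, map_mul, hExt_X]
  · intro i _
    rw [map_sum]
    exact Finset.sum_eq_zero fun j _ => by rw [map_smul, counit_sigma, smul_zero]

end Reshetikhin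

end Chain
-- First-order terms and the classical r-matrix.
section ClassicalLimit

open PowerSeries

variable {M p : ℕ} {hM : 4 * (p + 1) ≤ M} {η ϑ : Fin (p + 1) → ℂ} {k : Fin (p + 1)}

/-- `F = 1 + h f + O(h²)`. -/
structure FirstOrder {B : Type*} [Ring B] (F : B⟦X⟧) (f : B) : Prop where
  zero : constantCoeff F = 1
  one : coeff 1 F = f

section

variable {B : Type*} [Ring B] {F G : B⟦X⟧} {f g : B}

theorem coeff_one_mul' (F G : B⟦X⟧) :
    coeff 1 (F * G) = constantCoeff F * coeff 1 G + coeff 1 F * constantCoeff G := by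
  rw [coeff_mul, Finset.Nat.sum_antidiagonal_eq_sum_range_succ_mk, Finset.sum_range_succ,
    Finset.sum_range_one]
  simp

theorem FirstOrder.mul (hF : FirstOrder F f) (hG : FirstOrder G g) :
    FirstOrder (F * G) (f + g) := by
  refine ⟨by rw [map_mul, hF.zero, hG.zero, one_mul], ?_⟩
  rw [coeff_one_mul', hF.zero, hG.zero, hF.one, hG.one, one_mul, mul_one, add_comm]

theorem FirstOrder.inverse (hF : FirstOrder F f) (h : IsUnit F) :
    FirstOrder (Ring.inverse F) (-f) := by
  have e := Ring.mul_inverse_cancel F h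
  have e0 : constantCoeff (Ring.inverse F) = 1 := by
    simpa [hF.zero] using congrArg constantCoeff e
  refine ⟨e0, ?_⟩
  have := congrArg (coeff 1) e
  rw [coeff_one_mul', hF.zero, hF.one, e0, one_mul, mul_one, coeff_one, if_neg one_ne_zero] at this
  exact eq_neg_of_add_eq_zero_left this

theorem FirstOrder.list_prod {n : ℕ} {F : Fin n → B⟦X⟧} {f : Fin n → B}
    (h : ∀ i, FirstOrder (F i) (f i)) :
    FirstOrder (List.ofFn F).reverse.prod (∑ i, f i) := by
  induction n with
  | zero =>
    simp only [List.ofFn_zero, List.reverse_nil, List.prod_nil, Finset.univ_eq_empty,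
      Finset.sum_empty]
    exact ⟨by simp, by simp [coeff_one]⟩
  | succ n ih =>
    rw [List.ofFn_succ, List.reverse_cons, List.prod_append, List.prod_singleton,
      Fin.sum_univ_succ, add_comm (f 0)]
    exact (ih fun i => h i.succ).mul (h 0)

theorem firstOrder_fexp [Algebra ℂ B] (f : B⟦X⟧) : FirstOrder (fexp f) (coeff 1 f) :=
  ⟨constantCoeff_fexp f, coeff_one_fexp f⟩

end

theorem coeff_one_tens {a b : (U M)⟦X⟧} (hb : constantCoeff b = 0) :
    coeff 1 (tens a b) = constantCoeff a ⊗ₜ[ℂ] coeff 1 b := by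
  rw [tens_eq, coeff_one_mul', constantCoeff_inc1, constantCoeff_inc2, hb, inc2, coeff_hExt]
  simp

theorem coeff_one_hscale {B : Type*} [Ring B] [Algebra ℂ B] (c : ℂ) (f : B⟦X⟧) :
    coeff 1 (hscale c f) = c • constantCoeff f := by
  rw [hscale_apply, coeff_one_mul']
  simp

theorem constantCoeff_gen (x : so M) : constantCoeff (gen x) = ι x := by simp [gen]

/-- The scalar `c_i`. -/
theorem coeff_one_sigma (i : Idx p) :
    coeff 1 (sigma hM η ϑ i) = ι (Sum.elim η ϑ i • Egen hM i) := by
  cases i with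
  | inl k =>
    change coeff 1 (flog1p (hscale (η k) (gen (Eplus hM k)))) = _
    rw [coeff_one_flog1p, coeff_one_hscale, constantCoeff_gen, map_smul]
    rfl
  | inr k =>
    change coeff 1 (flog1p (hscale (ϑ k) (G hM η k))) = _
    rw [coeff_one_flog1p, coeff_one_hscale, G_eq, map_sub, constantCoeff_gen,
      constantCoeff_smul_complex, constantCoeff_hscale, smul_zero, sub_zero, map_smul]
    rfl

/-- The generator `H_i` of a label `i`. -/
noncomputable def Hgen (hM : 4 * (p + 1) ≤ M) : Idx p → so M := Sum.elim (Hplus hM) (Hminus hM)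

variable (hM η ϑ) in
/-- The first order term of the full chain, as a tensor over `so(M)`. -/
noncomputable def chainTensor : so M ⊗[ℂ] so M :=
  ∑ k, (Hminus hM k ⊗ₜ[ℂ] (ϑ k • Eminus hM k) +
    (∑ m ∈ window M k, rootVec (row1 hM k) m ⊗ₜ[ℂ] (η k • rootVec (row2 hM k) (Fin.rev m))) +
    Hplus hM k ⊗ₜ[ℂ] (η k • Eplus hM k))

theorem firstOrder_link : FirstOrder (link hM η ϑ k) (TensorProduct.map ι ι
    (Hminus hM k ⊗ₜ[ℂ] (ϑ k • Eminus hM k) +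
      (∑ m ∈ window M k, rootVec (row1 hM k) m ⊗ₜ[ℂ] (η k • rootVec (row2 hM k) (Fin.rev m))) +
      Hplus hM k ⊗ₜ[ℂ] (η k • Eplus hM k))) := by
  have h1 := firstOrder_fexp (tens (gen (Hminus hM k)) (sigmaG hM η ϑ k))
  have h2 := firstOrder_fexp (∑ m ∈ window M k, tens (xgen hM k m) (zgen hM η k m))
  have h3 := firstOrder_fexp (tens (gen (Hplus hM k)) (sigmaPlus hM η k))
  rw [← extension_eq] at h2
  have h := (h1.mul h2).mul h3
  have e1 : coeff 1 (sigmaG hM η ϑ k) = ι (ϑ k • Eminus hM k) :=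
    coeff_one_sigma (hM := hM) (η := η) (ϑ := ϑ) (Sum.inr k)
  have e2 : coeff 1 (sigmaPlus hM η k) = ι (η k • Eplus hM k) :=
    coeff_one_sigma (hM := hM) (η := η) (ϑ := ϑ) (Sum.inl k)
  rw [coeff_one_tens (by simp [sigmaG]), coeff_one_tens constantCoeff_sigmaPlus, e1, e2,
    constantCoeff_gen, constantCoeff_gen, map_sum] at h
  have e3 : ∀ m ∈ window M k, coeff 1 (tens (xgen hM k m) (zgen hM η k m)) =
      TensorProduct.map ι ι
        (rootVec (row1 hM k) m ⊗ₜ[ℂ] (η k • rootVec (row2 hM k) (Fin.rev m))) := fun m _ => by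
    rw [coeff_one_tens (by simp [zgen]), xgen, constantCoeff_gen, zgen, coeff_one_hscale,
      map_mul, ygen, constantCoeff_gen, expPlus, constantCoeff_fexp, mul_one,
      TensorProduct.map_tmul, map_smul]
  rw [Finset.sum_congr rfl e3, ← map_sum] at h
  rw [map_add, map_add]
  exact h

variable (ζ : Idx p → Idx p → ℂ)

variable (hM η ϑ) in
/-- The first order term of the Reshetikhin factor. -/
noncomputable def reshetikhinTensor : so M ⊗[ℂ] so M :=
  ∑ i, ∑ j, ζ i j • ((Sum.elim η ϑ i • Egen hM i) ⊗ₜ[ℂ] (Sum.elim η ϑ j • Egen hM j))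

theorem firstOrder_reshetikhin : FirstOrder (reshetikhin hM η ϑ ζ)
    (TensorProduct.map ι ι (reshetikhinTensor hM η ϑ ζ)) := by
  rw [reshetikhin_eq]
  convert firstOrder_fexp _ using 1
  rw [map_sum, reshetikhinTensor, map_sum]
  refine Finset.sum_congr rfl fun i _ => ?_
  have h0 : constantCoeff (∑ j, ζ i j • sigma hM η ϑ j) = 0 := by simp [constantCoeff_sigma]
  have h1 : constantCoeff (tau hM η ϑ i) = ι (Sum.elim η ϑ i • Egen hM i) := by
    rw [← coeff_one_sigma, tau, divX, ← coeff_zero_eq_constantCoeff_apply, coeff_mk]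
  rw [coeff_one_tens h0, h1, map_sum, map_sum, TensorProduct.tmul_sum]
  refine Finset.sum_congr rfl fun j _ => ?_
  rw [coeff_smul_complex, coeff_one_sigma, map_smul, TensorProduct.map_tmul,
    TensorProduct.tmul_smul]

/-- r is the antisymmetrisation of the first-order term of the twist; the diagonal terms ζ_ii are
symmetric and drop out. -/
theorem classicalR_eq : classicalR hM η ϑ ζ =
    (reshetikhinTensor hM η ϑ ζ + chainTensor hM η ϑ) -
      TensorProduct.comm ℂ (so M) (so M) (reshetikhinTensor hM η ϑ ζ + chainTensor hM η ϑ) := by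
  have h1 : (∑ i, ∑ j, if i ≠ j then
      ζ i j • wedge (Sum.elim η ϑ i • Egen hM i) (Sum.elim η ϑ j • Egen hM j) else 0) =
      reshetikhinTensor hM η ϑ ζ -
        TensorProduct.comm ℂ (so M) (so M) (reshetikhinTensor hM η ϑ ζ) := by
    simp only [reshetikhinTensor, map_sum, map_smul, TensorProduct.comm_tmul,
      ← Finset.sum_sub_distrib]
    refine Finset.sum_congr rfl fun i _ => Finset.sum_congr rfl fun j _ => ?_
    split_ifs with h
    · rw [wedge, smul_sub]
    · rw [not_not] at h
      subst h
      rw [sub_self]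
  have h2 : (∑ k, (η k • (wedge (Hplus hM k) (Eplus hM k) + Iwedge hM k) +
      ϑ k • wedge (Hminus hM k) (Eminus hM k))) = chainTensor hM η ϑ -
        TensorProduct.comm ℂ (so M) (so M) (chainTensor hM η ϑ) := by
    simp only [chainTensor, map_sum, map_add, TensorProduct.comm_tmul, ← Finset.sum_sub_distrib]
    refine Finset.sum_congr rfl fun k _ => ?_
    simp only [Iwedge, wedge, TensorProduct.tmul_smul, ← TensorProduct.smul_tmul',
      Finset.sum_sub_distrib, ← Finset.smul_sum]
    module
  rw [classicalR, h1, h2, map_add]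
  abel

/-- First-order terms add under multiplication and change sign under inversion, so F₂₁F⁻¹
contributes t₂₁ - t. -/
theorem firstOrder_universalR : FirstOrder (universalR (reshetikhin hM η ϑ ζ * fullChain hM η ϑ))
    (-TensorProduct.map ι ι (classicalR hM η ϑ ζ)) := by
  have hc : FirstOrder (fullChain hM η ϑ) (TensorProduct.map ι ι (chainTensor hM η ϑ)) := by
    rw [chainTensor, map_sum]
    exact FirstOrder.list_prod fun k => firstOrder_link
  have h := (firstOrder_reshetikhin (hM := hM) (η := η) (ϑ := ϑ) ζ).mul hc
  rw [← map_add] at h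
  have hflip : FirstOrder (flip21 M (reshetikhin hM η ϑ ζ * fullChain hM η ϑ))
      (TensorProduct.map ι ι (TensorProduct.comm ℂ (so M) (so M)
        (reshetikhinTensor hM η ϑ ζ + chainTensor hM η ϑ))) := by
    refine ⟨by rw [flip21, constantCoeff_hExt, h.zero, map_one], ?_⟩
    rw [flip21, coeff_hExt, h.one]
    generalize reshetikhinTensor hM η ϑ ζ + chainTensor hM η ϑ = t
    induction t using TensorProduct.induction_on with
    | zero => simp
    | tmul x y => simp
    | add x y hx hy => rw [map_add, map_add, map_add, map_add, hx, hy]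
  have := hflip.mul (h.inverse (isTwist_reshetikhin_mul ζ).isUnit)
  rw [universalR, classicalR_eq, map_sub]
  convert this using 1
  abel

end ClassicalLimit
-- The carrier algebra, its brackets and its coordinate functionals.
section Carrier

variable {M p : ℕ} {hM : 4 * (p + 1) ≤ M} {η ϑ : Fin (p + 1) → ℂ} {k : Fin (p + 1)}

/-! ### Brackets of the carrier generators -/

/-- The two rows of the `k`-th link. -/
def rowOf (hM : 4 * (p + 1) ≤ M) (s : Bool) (k : Fin (p + 1)) : Fin M :=
  if s then row1 hM k else row2 hM k

theorem outside_rowOf (s : Bool) : Outside M (k + 1) (rowOf hM s k) := by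
  cases s
  · exact outside_row2 hM k
  · exact outside_row1 hM k

theorem inWindow_rowOf (s : Bool) : InWindow M k (rowOf hM s k) := by
  cases s
  · exact inWindow_row2 hM k
  · exact inWindow_row1 hM k

/-- The constituent root vectors of the `k`-th link. -/
def linkRoots (hM : 4 * (p + 1) ≤ M) (k : Fin (p + 1)) : Set (so M) :=
  {x | ∃ s, ∃ m ∈ window M k, x = rootVec (rowOf hM s k) m}

theorem rootVec_mem_linkRoots (s : Bool) {m : Fin M} (hm : m ∈ window M k) :
    rootVec (rowOf hM s k) m ∈ linkRoots hM k := ⟨s, m, hm, rfl⟩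

/-- The subalgebra `so(M - 4n)`, as a subspace. -/
def windowSpan (M n : ℕ) : Submodule ℂ (so M) :=
  Submodule.span ℂ {x | ∃ i j, InWindow M n i ∧ InWindow M n j ∧ x = A i j}

theorem A_mem_windowSpan {n : ℕ} {i j : Fin M} (hi : InWindow M n i) (hj : InWindow M n j) :
    A i j ∈ windowSpan M n := Submodule.subset_span ⟨i, j, hi, hj, rfl⟩

theorem windowSpan_mono {n n' : ℕ} (h : n ≤ n') : windowSpan M n' ≤ windowSpan M n := by
  refine Submodule.span_mono ?_
  rintro x ⟨i, j, hi, hj, rfl⟩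
  exact ⟨i, j, hi.mono h, hj.mono h, rfl⟩

theorem Hgen_mem_windowSpan (i : Idx p) : Hgen hM i ∈ windowSpan M (linkIndex i) := by
  cases i with
  | inl k =>
    exact add_mem (Submodule.smul_mem _ _ (A_mem_windowSpan (inWindow_row1 hM k) (inWindow_row1 hM k)))
      (Submodule.smul_mem _ _ (A_mem_windowSpan (inWindow_row2 hM k) (inWindow_row2 hM k)))
  | inr k =>
    exact sub_mem (Submodule.smul_mem _ _ (A_mem_windowSpan (inWindow_row1 hM k) (inWindow_row1 hM k)))
      (Submodule.smul_mem _ _ (A_mem_windowSpan (inWindow_row2 hM k) (inWindow_row2 hM k)))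

theorem Egen_mem_windowSpan (i : Idx p) : Egen hM i ∈ windowSpan M (linkIndex i) := by
  cases i with
  | inl k => exact neg_mem (A_mem_windowSpan (inWindow_row1 hM k) (inWindow_row2 hM k).rev)
  | inr k => exact neg_mem (A_mem_windowSpan (inWindow_row1 hM k) (inWindow_row2 hM k))

theorem linkRoots_subset_windowSpan : linkRoots hM k ⊆ windowSpan M k := by
  rintro _ ⟨s, m, hm, rfl⟩
  exact neg_mem (A_mem_windowSpan (inWindow_rowOf s) ((mem_window.1 hm).mono (Nat.le_succ _)))

theorem lie_mem_of_windowSpan {n : ℕ} {P : Submodule ℂ (so M)} {x y : so M}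
    (hy : y ∈ windowSpan M n)
    (h : ∀ i j, InWindow M n i → InWindow M n j → ⁅A i j, x⁆ ∈ P) : ⁅y, x⁆ ∈ P := by
  induction hy using Submodule.span_induction with
  | mem y hy => obtain ⟨i, j, hi, hj, rfl⟩ := hy; exact h i j hi hj
  | zero => simp
  | add y y' _ _ h1 h2 => rw [add_lie]; exact add_mem h1 h2
  | smul c y _ h1 => rw [smul_lie]; exact P.smul_mem c h1

theorem lie_linkRoots_mem {x y : so M} (hy : y ∈ windowSpan M (k + 1)) (hx : x ∈ linkRoots hM k) :
    ⁅y, x⁆ ∈ Submodule.span ℂ (linkRoots hM k) := by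
  obtain ⟨s, m, hm, rfl⟩ := hx
  refine lie_mem_of_windowSpan hy fun i j hi hj => ?_
  rw [lie_A_rootVec (outside_rowOf s) hi hj]
  refine sub_mem ?_ ?_ <;> split_ifs
  · exact Submodule.subset_span (rootVec_mem_linkRoots s (mem_window.2 hi.rev))
  · exact zero_mem _
  · exact Submodule.subset_span (rootVec_mem_linkRoots s (mem_window.2 hj))
  · exact zero_mem _

theorem lie_Hgen_eq_zero {y : so M} {i : Idx p} (hy : y ∈ windowSpan M (linkIndex i + 1)) :
    ⁅y, Hgen hM i⁆ = 0 := by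
  rw [← Submodule.mem_bot ℂ]
  refine lie_mem_of_windowSpan hy fun a b ha hb => (Submodule.mem_bot ℂ).2 ?_
  cases i with
  | inl k => exact lie_A_Hplus ha hb
  | inr k => exact lie_A_Hminus ha hb

theorem lie_Egen_eq_zero {y : so M} {i : Idx p} (hy : y ∈ windowSpan M (linkIndex i + 1)) :
    ⁅y, Egen hM i⁆ = 0 := by
  rw [← Submodule.mem_bot ℂ]
  refine lie_mem_of_windowSpan hy fun a b ha hb => (Submodule.mem_bot ℂ).2 ?_
  cases i with
  | inl k => exact lie_A_Eplus ha hb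
  | inr k => exact lie_A_Eminus ha hb

theorem lie_eq_zero_symm {x y : so M} (h : ⁅x, y⁆ = 0) : ⁅y, x⁆ = 0 := by
  rw [← lie_skew, h, neg_zero]

theorem Hgen_lie_Hgen (i j : Idx p) : ⁅Hgen hM i, Hgen hM j⁆ = 0 := by
  cases i <;> cases j <;> simp [Hgen, Hplus, Hminus, lie_H_H]

/-- Distinct links decouple: the generators of the later link lie in the window algebra, which
annihilates every H_i and E_i of the earlier one. -/
theorem Hgen_lie_Egen (i j : Idx p) :
    ⁅Hgen hM i, Egen hM j⁆ = if i = j then Egen hM j else 0 := by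
  rcases lt_trichotomy (linkIndex i) (linkIndex j) with h | h | h
  · rw [if_neg (by rintro rfl; exact lt_irrefl _ h)]
    exact lie_eq_zero_symm (lie_Hgen_eq_zero (windowSpan_mono (Nat.succ_le_of_lt h)
      (Egen_mem_windowSpan j)))
  · cases i <;> cases j <;> simp only [linkIndex, Sum.elim_inl, Sum.elim_inr, id] at h <;> subst h
    · rw [if_pos rfl]; exact Hplus_lie_Eplus
    · rw [if_neg (by simp)]; exact Hplus_lie_Eminus
    · rw [if_neg (by simp)]; exact Hminus_lie_Eplus
    · rw [if_pos rfl]; exact Hminus_lie_Eminus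
  · rw [if_neg (by rintro rfl; exact lt_irrefl _ h)]
    exact lie_Egen_eq_zero (windowSpan_mono (Nat.succ_le_of_lt h) (Hgen_mem_windowSpan i))

theorem Egen_lie_Egen (i j : Idx p) : ⁅Egen hM i, Egen hM j⁆ = 0 := by
  rcases lt_trichotomy (linkIndex i) (linkIndex j) with h | h | h
  · exact lie_eq_zero_symm (lie_Egen_eq_zero (windowSpan_mono (Nat.succ_le_of_lt h)
      (Egen_mem_windowSpan j)))
  · cases i <;> cases j <;> simp only [linkIndex, Sum.elim_inl, Sum.elim_inr, id] at h <;> subst h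
    · exact lie_self _
    · exact Eplus_lie_Eminus
    · exact lie_eq_zero_symm Eplus_lie_Eminus
    · exact lie_self _
  · exact lie_Egen_eq_zero (windowSpan_mono (Nat.succ_le_of_lt h) (Egen_mem_windowSpan i))

theorem Hgen_lie_linkRoots (i : Idx p) {x : so M} (hx : x ∈ linkRoots hM k) :
    ⁅Hgen hM i, x⁆ ∈ Submodule.span ℂ (linkRoots hM k) := by
  rcases lt_trichotomy (linkIndex i) k with h | h | h
  · rw [lie_eq_zero_symm (lie_Hgen_eq_zero (windowSpan_mono (Nat.succ_le_of_lt h)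
      (linkRoots_subset_windowSpan hx)))]
    exact zero_mem _
  · subst h
    have hx' := Submodule.subset_span (R := ℂ) hx
    obtain ⟨s, m, hm, rfl⟩ := hx
    cases i <;> cases s
    · exact (Hplus_lie_y hm).symm ▸ Submodule.smul_mem _ _ hx'
    · exact (Hplus_lie_x hm).symm ▸ Submodule.smul_mem _ _ hx'
    · exact (Hminus_lie_y hm).symm ▸ Submodule.smul_mem _ _ hx'
    · exact (Hminus_lie_x hm).symm ▸ Submodule.smul_mem _ _ hx'
  · exact lie_linkRoots_mem (windowSpan_mono (Nat.succ_le_of_lt h) (Hgen_mem_windowSpan i)) hx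

theorem Egen_lie_linkRoots (i : Idx p) {x : so M} (hx : x ∈ linkRoots hM k) :
    ⁅Egen hM i, x⁆ ∈ Submodule.span ℂ (linkRoots hM k) := by
  rcases lt_trichotomy (linkIndex i) k with h | h | h
  · rw [lie_eq_zero_symm (lie_Egen_eq_zero (windowSpan_mono (Nat.succ_le_of_lt h)
      (linkRoots_subset_windowSpan hx)))]
    exact zero_mem _
  · subst h
    obtain ⟨s, m, hm, rfl⟩ := hx
    cases i <;> cases s
    · exact (Eplus_lie_y hm).symm ▸ zero_mem _
    · exact (Eplus_lie_x hm).symm ▸ zero_mem _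
    · exact (Eminus_lie_y hm).symm ▸
        neg_mem (Submodule.subset_span (rootVec_mem_linkRoots true hm))
    · exact (Eminus_lie_x hm).symm ▸ zero_mem _
  · exact lie_linkRoots_mem (windowSpan_mono (Nat.succ_le_of_lt h) (Egen_mem_windowSpan i)) hx

theorem linkRoots_lie_linkRoots_of_lt {k' : Fin (p + 1)} (h : k < k') {x y : so M}
    (hx : x ∈ linkRoots hM k) (hy : y ∈ linkRoots hM k') :
    ⁅x, y⁆ ∈ Submodule.span ℂ (linkRoots hM k) := by
  rw [← lie_skew]
  exact neg_mem (lie_linkRoots_mem (windowSpan_mono (Nat.succ_le_of_lt h)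
    (linkRoots_subset_windowSpan hy)) hx)

/-- The Heisenberg relation for both rows at once (`true` is the first row): the scalar is 0 for
equal rows and ±1 otherwise. -/
theorem rootVec_lie_rootVec_same (s t : Bool) {m n : Fin M} (hm : m ∈ window M k)
    (hn : n ∈ window M k) : ⁅rootVec (rowOf hM s k) m, rootVec (rowOf hM t k) n⁆ =
      if m = Fin.rev n then ((if s then 1 else 0) - (if t then 1 else 0) : ℂ) • Eplus hM k
      else 0 := by
  cases s <;> cases t
  · rw [lie_rootVec_rootVec_self hm (outside_rowOf false) hn]; simp
  · have := x_lie_y (hM := hM) hn hm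
    rw [← lie_skew]
    have e : n = Fin.rev m ↔ m = Fin.rev n := by rw [eq_comm, Fin.rev_eq_iff]
    simp only [e] at this
    exact (congrArg Neg.neg this).trans (by by_cases hmn : m = Fin.rev n <;> simp [hmn])
  · exact (x_lie_y (hM := hM) hm hn).trans (by simp)
  · rw [lie_rootVec_rootVec_self hm (outside_rowOf true) hn]; simp

/-! ### The carrier and its derived algebra -/

/-- `c_i`. -/
def cgen (η ϑ : Fin (p + 1) → ℂ) : Idx p → ℂ := Sum.elim η ϑ

/-- The nilpotent generators of the carrier. -/
def nilGens (hM : 4 * (p + 1) ≤ M) (η ϑ : Fin (p + 1) → ℂ) : Set (so M) :=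
  {x | ∃ i, cgen η ϑ i ≠ 0 ∧ x = Egen hM i} ∪ {x | ∃ k, η k ≠ 0 ∧ x ∈ linkRoots hM k}

/-- The Cartan generators of the carrier. -/
def cartanGens (hM : 4 * (p + 1) ≤ M) (η ϑ : Fin (p + 1) → ℂ) : Set (so M) :=
  {x | ∃ i, cgen η ϑ i ≠ 0 ∧ x = Hgen hM i}

theorem carrier_eq : carrier hM η ϑ = Submodule.span ℂ (cartanGens hM η ϑ ∪ nilGens hM η ϑ) := by
  rw [carrier]
  congr 1
  ext x
  constructor
  · rintro (⟨k, hk, rfl | rfl | ⟨m, hm, rfl | rfl⟩⟩ | ⟨k, hk, rfl | rfl⟩)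
    · exact Or.inl ⟨Sum.inl k, hk, rfl⟩
    · exact Or.inr (Or.inl ⟨Sum.inl k, hk, rfl⟩)
    · exact Or.inr (Or.inr ⟨k, hk, rootVec_mem_linkRoots true hm⟩)
    · exact Or.inr (Or.inr ⟨k, hk, rootVec_mem_linkRoots false hm⟩)
    · exact Or.inl ⟨Sum.inr k, hk, rfl⟩
    · exact Or.inr (Or.inl ⟨Sum.inr k, hk, rfl⟩)
  · rintro (⟨i | i, hi, rfl⟩ | ⟨i | i, hi, rfl⟩ | ⟨k, hk, s, m, hm, rfl⟩)
    · exact Or.inl ⟨i, hi, Or.inl rfl⟩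
    · exact Or.inr ⟨i, hi, Or.inl rfl⟩
    · exact Or.inl ⟨i, hi, Or.inr (Or.inl rfl)⟩
    · exact Or.inr ⟨i, hi, Or.inr rfl⟩
    · cases s
      · exact Or.inl ⟨k, hk, Or.inr (Or.inr ⟨m, hm, Or.inr rfl⟩)⟩
      · exact Or.inl ⟨k, hk, Or.inr (Or.inr ⟨m, hm, Or.inl rfl⟩)⟩

theorem span_nilGens_le : Submodule.span ℂ (nilGens hM η ϑ) ≤ carrier hM η ϑ := by
  rw [carrier_eq]; exact Submodule.span_mono Set.subset_union_right

theorem Hgen_mem_carrier {i : Idx p} (h : cgen η ϑ i ≠ 0) : Hgen hM i ∈ carrier hM η ϑ := by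
  rw [carrier_eq]; exact Submodule.subset_span (Or.inl ⟨i, h, rfl⟩)

theorem Egen_mem_nil {i : Idx p} (h : cgen η ϑ i ≠ 0) :
    Egen hM i ∈ Submodule.span ℂ (nilGens hM η ϑ) :=
  Submodule.subset_span (Or.inl ⟨i, h, rfl⟩)

theorem span_linkRoots_le (hk : η k ≠ 0) :
    Submodule.span ℂ (linkRoots hM k) ≤ Submodule.span ℂ (nilGens hM η ϑ) :=
  Submodule.span_mono fun _ hx => Or.inr ⟨k, hk, hx⟩

theorem lie_mem_of_gens {S : Set (so M)} {P : Submodule ℂ (so M)}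
    (h : ∀ x ∈ S, ∀ y ∈ S, ⁅x, y⁆ ∈ P) {x y : so M} (hx : x ∈ Submodule.span ℂ S)
    (hy : y ∈ Submodule.span ℂ S) : ⁅x, y⁆ ∈ P := by
  induction hx using Submodule.span_induction with
  | mem x hx =>
    induction hy using Submodule.span_induction with
    | mem y hy => exact h x hx y hy
    | zero => simp
    | add y y' _ _ h1 h2 => rw [lie_add]; exact add_mem h1 h2
    | smul c y _ h1 => rw [lie_smul]; exact P.smul_mem c h1
  | zero => simp
  | add y y' _ _ h1 h2 => rw [add_lie]; exact add_mem h1 h2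
  | smul c y _ h1 => rw [smul_lie]; exact P.smul_mem c h1

theorem lie_symm_mem {P : Submodule ℂ (so M)} {x y : so M} (h : ⁅x, y⁆ ∈ P) : ⁅y, x⁆ ∈ P := by
  rw [← lie_skew]; exact neg_mem h

/-- More than closure: brackets have no Cartan part, so every H_i^* vanishes on them. Brackets
between links stay in the root vectors of the earlier link, on which the later one acts. -/
theorem carrier_lie_mem {x y : so M} (hx : x ∈ carrier hM η ϑ) (hy : y ∈ carrier hM η ϑ) :
    ⁅x, y⁆ ∈ Submodule.span ℂ (nilGens hM η ϑ) := by
  rw [carrier_eq] at hx hy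
  refine lie_mem_of_gens ?_ hx hy
  have hHE {i j : Idx p} (hj : cgen η ϑ j ≠ 0) :
      ⁅Hgen hM i, Egen hM j⁆ ∈ Submodule.span ℂ (nilGens hM η ϑ) := by
    rw [Hgen_lie_Egen]; split_ifs
    · exact Egen_mem_nil hj
    · exact zero_mem _
  rintro _ (⟨i, hi, rfl⟩ | ⟨i, hi, rfl⟩ | ⟨k, hk, hx⟩) _ (⟨j, hj, rfl⟩ | ⟨j, hj, rfl⟩ | ⟨k', hk', hy⟩)
  · rw [Hgen_lie_Hgen]; exact zero_mem _
  · exact hHE hj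
  · exact span_linkRoots_le hk' (Hgen_lie_linkRoots i hy)
  · exact lie_symm_mem (hHE hi)
  · rw [Egen_lie_Egen]; exact zero_mem _
  · exact span_linkRoots_le hk' (Egen_lie_linkRoots i hy)
  · exact lie_symm_mem (span_linkRoots_le hk (Hgen_lie_linkRoots j hx))
  · exact lie_symm_mem (span_linkRoots_le hk (Egen_lie_linkRoots j hx))
  · rcases lt_trichotomy k k' with h | h | h
    · exact span_linkRoots_le hk (linkRoots_lie_linkRoots_of_lt h hx hy)
    · subst h
      obtain ⟨s, m, hm, rfl⟩ := hx
      obtain ⟨t, n, hn, rfl⟩ := hy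
      rw [rootVec_lie_rootVec_same s t hm hn]
      split_ifs
      all_goals first
        | exact zero_mem _
        | exact Submodule.smul_mem _ _ (Egen_mem_nil (i := Sum.inl k) hk)
    · exact lie_symm_mem (span_linkRoots_le hk' (linkRoots_lie_linkRoots_of_lt h hy hx))

/-! ### The coordinate functionals -/

theorem entry_A (i j r s : Fin M) : entry r s (A i j) =
    (if i = r ∧ j = s then 1 else 0) - if Fin.rev j = r ∧ Fin.rev i = s then 1 else 0 := by
  change (Matrix.single i j 1 - Matrix.single (Fin.rev j) (Fin.rev i) 1 :
    Matrix (Fin M) (Fin M) ℂ) r s = _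
  rw [Matrix.sub_apply, Matrix.single_apply, Matrix.single_apply]

theorem entry_diag_rootVec {i m r : Fin M} (h : i ≠ m) : entry r r (rootVec i m) = 0 := by
  rw [rootVec, map_neg, entry_A, if_neg, if_neg]
  · simp
  · rintro ⟨h1, h2⟩
    exact h (Fin.rev_injective (h2.trans h1.symm))
  · rintro ⟨h1, h2⟩
    exact h (h1.trans h2.symm)

theorem Hdual_rootVec (l : Idx p) {i m : Fin M} (h : i ≠ m) : Hdual hM l (rootVec i m) = 0 := by
  cases l <;> simp [Hdual, entry_diag_rootVec h]

theorem Hdual_Egen (l i : Idx p) : Hdual hM l (Egen hM i) = 0 := by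
  cases i with
  | inl k => exact Hdual_rootVec l (row_ne hM k).2.2.2.1
  | inr k => exact Hdual_rootVec l (row_ne hM k).1

theorem Hdual_linkRoots (l : Idx p) {x : so M} (hx : x ∈ linkRoots hM k) : Hdual hM l x = 0 := by
  obtain ⟨s, m, hm, rfl⟩ := hx
  exact Hdual_rootVec l ((mem_window.1 hm).ne (outside_rowOf s)).2.2.1

theorem Hdual_nil (l : Idx p) {x : so M} (hx : x ∈ Submodule.span ℂ (nilGens hM η ϑ)) :
    Hdual hM l x = 0 := by
  have : Submodule.span ℂ (nilGens hM η ϑ) ≤ LinearMap.ker (Hdual hM l) := by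
    rw [Submodule.span_le]
    rintro _ (⟨i, _, rfl⟩ | ⟨k, _, hx⟩)
    · exact Hdual_Egen l i
    · exact Hdual_linkRoots l hx
  exact this hx

theorem entry_diag_H (i r : Fin M) (h : r ≠ Fin.rev i) :
    entry r r (H i) = if i = r then 1 / 2 else 0 := by
  rw [H, map_smul, entry_A]
  by_cases hir : i = r
  · subst hir
    simp [h.symm]
  · simp [hir, h.symm]

theorem Hdual_Hgen (i j : Idx p) : Hdual hM i (Hgen hM j) = if i = j then 1 else 0 := by
  have e11 (k l : Fin (p + 1)) : entry (row1 hM k) (row1 hM k) (H (row1 hM l)) =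
      if k = l then 1 / 2 else 0 := by
    rw [entry_diag_H _ _ (by simp only [row1, ne_eq, Fin.ext_iff, Fin.val_rev]; omega)]
    simp only [row1, Fin.ext_iff]
    congr 1
    simp only [eq_iff_iff]; omega
  have e22 (k l : Fin (p + 1)) : entry (row2 hM k) (row2 hM k) (H (row2 hM l)) =
      if k = l then 1 / 2 else 0 := by
    rw [entry_diag_H _ _ (by simp only [row2, ne_eq, Fin.ext_iff, Fin.val_rev]; omega)]
    simp only [row2, Fin.ext_iff]
    congr 1
    simp only [eq_iff_iff]; omega
  have e12 (k l : Fin (p + 1)) : entry (row1 hM k) (row1 hM k) (H (row2 hM l)) = 0 := by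
    rw [entry_diag_H _ _ (by simp only [row1, row2, ne_eq, Fin.ext_iff, Fin.val_rev]; omega),
      if_neg (by simp only [row1, row2, Fin.ext_iff]; omega)]
  have e21 (k l : Fin (p + 1)) : entry (row2 hM k) (row2 hM k) (H (row1 hM l)) = 0 := by
    rw [entry_diag_H _ _ (by simp only [row1, row2, ne_eq, Fin.ext_iff, Fin.val_rev]; omega),
      if_neg (by simp only [row1, row2, Fin.ext_iff]; omega)]
  cases i <;> cases j <;>
    simp only [Hdual, Hgen, Sum.elim_inl, Sum.elim_inr, Hplus, Hminus, LinearMap.add_apply,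
      LinearMap.sub_apply, map_add, map_sub, e11, e22, e12, e21, Sum.inl.injEq, Sum.inr.injEq,
      reduceCtorEq, if_false] <;> split_ifs <;> norm_num

/-- The functional `∑_k (γ_k (E_{1+2}^k)^* - δ_k (E_{1-2}^k)^*)`. -/
noncomputable def frobenius (hM : 4 * (p + 1) ≤ M) (η ϑ : Fin (p + 1) → ℂ) : so M →ₗ[ℂ] ℂ :=
  ∑ k, (-(η k)⁻¹ • EplusDual hM k - (ϑ k)⁻¹ • EminusDual hM k)

theorem EplusDual_Eplus (k l : Fin (p + 1)) :
    EplusDual hM k (Eplus hM l) = if k = l then 1 else 0 := by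
  rw [EplusDual, Eplus, rootVec, LinearMap.neg_apply, map_neg, neg_neg, entry_A]
  simp only [row1, row2, Fin.ext_iff, Fin.val_rev]
  split_ifs <;> first | omega | norm_num

theorem EplusDual_Eminus (k l : Fin (p + 1)) : EplusDual hM k (Eminus hM l) = 0 := by
  rw [EplusDual, Eminus, rootVec, LinearMap.neg_apply, map_neg, neg_neg, entry_A]
  simp only [row1, row2, Fin.ext_iff, Fin.val_rev]
  split_ifs <;> first | omega | norm_num

theorem EminusDual_Eminus (k l : Fin (p + 1)) :
    EminusDual hM k (Eminus hM l) = if k = l then 1 else 0 := by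
  rw [EminusDual, Eminus, rootVec, LinearMap.neg_apply, map_neg, neg_neg, entry_A]
  simp only [row1, row2, Fin.ext_iff, Fin.val_rev]
  split_ifs <;> first | omega | norm_num

theorem EminusDual_Eplus (k l : Fin (p + 1)) : EminusDual hM k (Eplus hM l) = 0 := by
  rw [EminusDual, Eplus, rootVec, LinearMap.neg_apply, map_neg, neg_neg, entry_A]
  simp only [row1, row2, Fin.ext_iff, Fin.val_rev]
  split_ifs <;> first | omega | norm_num

theorem dual_linkRoots (l : Fin (p + 1)) {x : so M} (hx : x ∈ linkRoots hM k) :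
    EplusDual hM l x = 0 ∧ EminusDual hM l x = 0 := by
  obtain ⟨s, m, hm, rfl⟩ := hx
  obtain ⟨h1, h2⟩ := mem_window.1 hm
  rw [EplusDual, EminusDual, rootVec, LinearMap.neg_apply, LinearMap.neg_apply, map_neg, map_neg,
    neg_neg, neg_neg, entry_A, entry_A]
  cases s <;> simp only [rowOf, row1, row2, Fin.ext_iff, Fin.val_rev, if_true, if_false,
    Bool.false_eq_true] <;>
  constructor <;> split_ifs <;> first | omega | norm_num

/-- The signs of γ and δ are chosen so that both kinds of generators take the same value -1/c_i;
with inverse of zero equal to zero this needs no case distinction. -/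
theorem frobenius_Egen (i : Idx p) : frobenius hM η ϑ (Egen hM i) = -(cgen η ϑ i)⁻¹ := by
  cases i <;> simp [frobenius, Egen, cgen, LinearMap.sum_apply, EplusDual_Eplus, EplusDual_Eminus,
    EminusDual_Eplus, EminusDual_Eminus]

theorem frobenius_span_linkRoots {x : so M} (hx : x ∈ Submodule.span ℂ (linkRoots hM k)) :
    frobenius hM η ϑ x = 0 := by
  have : Submodule.span ℂ (linkRoots hM k) ≤ LinearMap.ker (frobenius hM η ϑ) := by
    rw [Submodule.span_le]
    intro x hx
    simp [frobenius, LinearMap.sum_apply, dual_linkRoots _ hx]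
  exact this hx

end Carrier
-- The cocycle on the carrier and its inverse r.
section Cocycle

variable {M p : ℕ} {hM : 4 * (p + 1) ≤ M} {η ϑ : Fin (p + 1) → ℂ} {k : Fin (p + 1)}
  {ζ : Idx p → Idx p → ℂ}

/-! ### The values of the cocycle on the generators -/

/-- The form `ω` for `γ_k = -1/η_k` and `δ_k = 1/ϑ_k`. -/
noncomputable def carrierForm (hM : 4 * (p + 1) ≤ M) (η ϑ : Fin (p + 1) → ℂ)
    (ζ : Idx p → Idx p → ℂ) : so M →ₗ[ℂ] so M →ₗ[ℂ] ℂ :=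
  omega hM (fun k => -(η k)⁻¹) (fun k => (ϑ k)⁻¹) ζ

/-- Only the antisymmetric part of ζ matters, which removes the restriction i ≠ j from the sum. -/
theorem carrierForm_apply (x y : so M) : carrierForm hM η ϑ ζ x y =
    frobenius hM η ϑ ⁅x, y⁆ +
      ∑ i, ∑ j, (ζ i j - ζ j i) * (Hdual hM i x * Hdual hM j y) := by
  have h : ∀ i j, (if i ≠ j then ζ i j • wedgeForm (Hdual hM i) (Hdual hM j) else 0) x y =
      ζ i j * (Hdual hM i x * Hdual hM j y) - ζ i j * (Hdual hM j x * Hdual hM i y) := by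
    intro i j
    by_cases hij : i = j
    · subst hij; simp
    · simp only [ne_eq, hij, not_false_eq_true, if_true, LinearMap.smul_apply, wedgeForm,
        LinearMap.mk₂_apply, smul_eq_mul]
      ring
  simp only [carrierForm, omega, LinearMap.add_apply, LinearMap.sum_apply, h, coboundary,
    LinearMap.mk₂_apply, sub_mul, Finset.sum_sub_distrib]
  rw [Finset.sum_comm (f := fun i j => ζ i j * (Hdual hM j x * Hdual hM i y))]
  congr 1
  simp [frobenius, LinearMap.sum_apply]

theorem carrierForm_of_nil_left {x y : so M} (h : ∀ i, Hdual hM i x = 0) :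
    carrierForm hM η ϑ ζ x y = frobenius hM η ϑ ⁅x, y⁆ := by
  simp [carrierForm_apply, h]

theorem carrierForm_of_nil_right {x y : so M} (h : ∀ i, Hdual hM i y = 0) :
    carrierForm hM η ϑ ζ x y = frobenius hM η ϑ ⁅x, y⁆ := by
  simp [carrierForm_apply, h]

theorem carrierForm_Hgen_Hgen (i j : Idx p) :
    carrierForm hM η ϑ ζ (Hgen hM i) (Hgen hM j) = ζ i j - ζ j i := by
  simp [carrierForm_apply, Hgen_lie_Hgen, Hdual_Hgen]

theorem carrierForm_Hgen_Egen (i j : Idx p) :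
    carrierForm hM η ϑ ζ (Hgen hM i) (Egen hM j) = if i = j then -(cgen η ϑ j)⁻¹ else 0 := by
  rw [carrierForm_of_nil_right fun l => Hdual_Egen l j, Hgen_lie_Egen]
  split_ifs
  · exact frobenius_Egen j
  · exact map_zero _

theorem carrierForm_Egen_Hgen (i j : Idx p) :
    carrierForm hM η ϑ ζ (Egen hM i) (Hgen hM j) = if j = i then (cgen η ϑ i)⁻¹ else 0 := by
  rw [carrierForm_of_nil_left fun l => Hdual_Egen l i, ← lie_skew, Hgen_lie_Egen]
  split_ifs
  · rw [map_neg, frobenius_Egen, neg_neg]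
  · rw [neg_zero, map_zero]

theorem carrierForm_Egen_Egen (i j : Idx p) :
    carrierForm hM η ϑ ζ (Egen hM i) (Egen hM j) = 0 := by
  rw [carrierForm_of_nil_right fun l => Hdual_Egen l j, Egen_lie_Egen, map_zero]

theorem carrierForm_Hgen_root (i : Idx p) {x : so M} (hx : x ∈ linkRoots hM k) :
    carrierForm hM η ϑ ζ (Hgen hM i) x = 0 := by
  rw [carrierForm_of_nil_right fun l => Hdual_linkRoots l hx]
  exact frobenius_span_linkRoots (Hgen_lie_linkRoots i hx)

theorem carrierForm_root_Hgen (i : Idx p) {x : so M} (hx : x ∈ linkRoots hM k) :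
    carrierForm hM η ϑ ζ x (Hgen hM i) = 0 := by
  rw [carrierForm_of_nil_left fun l => Hdual_linkRoots l hx]
  exact frobenius_span_linkRoots (lie_symm_mem (Hgen_lie_linkRoots i hx))

theorem carrierForm_Egen_root (i : Idx p) {x : so M} (hx : x ∈ linkRoots hM k) :
    carrierForm hM η ϑ ζ (Egen hM i) x = 0 := by
  rw [carrierForm_of_nil_right fun l => Hdual_linkRoots l hx]
  exact frobenius_span_linkRoots (Egen_lie_linkRoots i hx)

theorem carrierForm_root_Egen (i : Idx p) {x : so M} (hx : x ∈ linkRoots hM k) :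
    carrierForm hM η ϑ ζ x (Egen hM i) = 0 := by
  rw [carrierForm_of_nil_left fun l => Hdual_linkRoots l hx]
  exact frobenius_span_linkRoots (lie_symm_mem (Egen_lie_linkRoots i hx))

theorem carrierForm_root_root_of_ne {k' : Fin (p + 1)} (h : k ≠ k') {x y : so M}
    (hx : x ∈ linkRoots hM k) (hy : y ∈ linkRoots hM k') : carrierForm hM η ϑ ζ x y = 0 := by
  rw [carrierForm_of_nil_left fun l => Hdual_linkRoots l hx]
  rcases lt_or_gt_of_ne h with h | h
  · exact frobenius_span_linkRoots (linkRoots_lie_linkRoots_of_lt h hx hy)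
  · exact frobenius_span_linkRoots (lie_symm_mem (linkRoots_lie_linkRoots_of_lt h hy hx))

theorem carrierForm_root_root (s t : Bool) {m n : Fin M} (hm : m ∈ window M k)
    (hn : n ∈ window M k) :
    carrierForm hM η ϑ ζ (rootVec (rowOf hM s k) m) (rootVec (rowOf hM t k) n) =
      if m = Fin.rev n then
        ((if t then 1 else 0) - (if s then 1 else 0) : ℂ) * (η k)⁻¹ else 0 := by
  rw [carrierForm_of_nil_left fun l => Hdual_linkRoots l (rootVec_mem_linkRoots s hm),
    rootVec_lie_rootVec_same s t hm hn]
  by_cases h : m = Fin.rev n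
  · rw [if_pos h, if_pos h, map_smul, show Eplus hM k = Egen hM (Sum.inl k) from rfl, frobenius_Egen, smul_eq_mul]
    simp only [cgen, Sum.elim_inl]
    ring
  · rw [if_neg h, if_neg h, map_zero]

/-! ### The classical r-matrix as the inverse of the cocycle -/

/-- The same normal form for r: both kinds of labels treated uniformly, with the antisymmetric part
of ζ on E ⊗ E. -/
theorem classicalR_eq_sum : classicalR hM η ϑ ζ =
    ∑ i, cgen η ϑ i • wedge (Hgen hM i) (Egen hM i) + ∑ k, η k • Iwedge hM k +
      ∑ i, ∑ j, ((ζ i j - ζ j i) * (cgen η ϑ i * cgen η ϑ j)) •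
        (Egen hM i ⊗ₜ[ℂ] Egen hM j) := by
  have h : ∀ i j, (if i ≠ j then
      ζ i j • wedge (Sum.elim η ϑ i • Egen hM i) (Sum.elim η ϑ j • Egen hM j) else 0) =
      (ζ i j * (cgen η ϑ i * cgen η ϑ j)) • (Egen hM i ⊗ₜ[ℂ] Egen hM j) -
      (ζ i j * (cgen η ϑ j * cgen η ϑ i)) • (Egen hM j ⊗ₜ[ℂ] Egen hM i) := by
    intro i j
    by_cases hij : i = j
    · subst hij; simp
    · simp only [ne_eq, hij, not_false_eq_true, if_true, wedge, TensorProduct.smul_tmul_smul,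
        smul_sub, smul_smul]
      rfl
  simp only [classicalR, h, Finset.sum_sub_distrib, sub_mul, sub_smul]
  rw [Finset.sum_comm (f := fun i j =>
    (ζ i j * (cgen η ϑ j * cgen η ϑ i)) • (Egen hM j ⊗ₜ[ℂ] Egen hM i))]
  congr 1
  simp only [Fintype.sum_sum_type, smul_add, Finset.sum_add_distrib, cgen, Hgen, Egen,
    Sum.elim_inl, Sum.elim_inr]
  abel

/-- The contraction of the first tensor factor with a functional. -/
noncomputable def contract (f : so M →ₗ[ℂ] ℂ) : so M ⊗[ℂ] so M →ₗ[ℂ] so M :=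
  (TensorProduct.lid ℂ (so M)).toLinearMap.comp (LinearMap.rTensor (so M) f)

theorem contract_tmul (f : so M →ₗ[ℂ] ℂ) (a b : so M) :
    contract f (a ⊗ₜ[ℂ] b) = f a • b := by simp [contract]

theorem contract_wedge (f : so M →ₗ[ℂ] ℂ) (a b : so M) :
    contract f (wedge a b) = f a • b - f b • a := by simp [wedge, contract_tmul]

theorem contract_classicalR (f : so M →ₗ[ℂ] ℂ) : contract f (classicalR hM η ϑ ζ) =
    ∑ i, cgen η ϑ i • (f (Hgen hM i) • Egen hM i - f (Egen hM i) • Hgen hM i) +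
    ∑ k, η k • ∑ m ∈ window M k,
      (f (rootVec (rowOf hM true k) m) • rootVec (rowOf hM false k) (Fin.rev m) -
        f (rootVec (rowOf hM false k) (Fin.rev m)) • rootVec (rowOf hM true k) m) +
    ∑ i, ∑ j, ((ζ i j - ζ j i) * (cgen η ϑ i * cgen η ϑ j)) • (f (Egen hM i) • Egen hM j) := by
  simp only [classicalR_eq_sum, map_add, map_sum, map_smul, contract_wedge, contract_tmul, Iwedge]
  rfl

/-- ω(H_l, E_l) = -1/c_l returns H_l. The terms ω(H_l, H_j) = ζ_lj - ζ_jl produce multiples of E_j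
that cancel against the E ⊗ E part of r. -/
theorem contract_form_Hgen {l : Idx p} (hl : cgen η ϑ l ≠ 0) :
    contract (carrierForm hM η ϑ ζ (Hgen hM l)) (classicalR hM η ϑ ζ) = Hgen hM l := by
  have h2 : ∑ k, η k • ∑ m ∈ window M k,
      (carrierForm hM η ϑ ζ (Hgen hM l) (rootVec (rowOf hM true k) m) •
          rootVec (rowOf hM false k) (Fin.rev m) -
        carrierForm hM η ϑ ζ (Hgen hM l) (rootVec (rowOf hM false k) (Fin.rev m)) •
          rootVec (rowOf hM true k) m) = 0 := by
    refine Finset.sum_eq_zero fun k _ => ?_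
    rw [Finset.sum_eq_zero, smul_zero]
    intro m hm
    rw [carrierForm_Hgen_root l (rootVec_mem_linkRoots true hm),
      carrierForm_Hgen_root l (rootVec_mem_linkRoots false (rev_mem_window hm)),
      zero_smul, zero_smul, sub_zero]
  rw [contract_classicalR, h2, add_zero]
  simp only [carrierForm_Hgen_Hgen, carrierForm_Hgen_Egen, smul_sub, Finset.sum_sub_distrib,
    ite_smul, smul_ite, smul_zero, zero_smul, smul_smul, Finset.sum_ite_irrel,
    Finset.sum_const_zero, Finset.sum_ite_eq, Finset.mem_univ, if_true]
  have e1 : cgen η ϑ l * -(cgen η ϑ l)⁻¹ = -1 := by field_simp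
  have e2 (j : Idx p) : (ζ l j - ζ j l) * (cgen η ϑ l * cgen η ϑ j) * -(cgen η ϑ l)⁻¹ =
      -(cgen η ϑ j * (ζ l j - ζ j l)) := by field_simp
  simp only [e1, e2, neg_smul, Finset.sum_neg_distrib, one_smul]
  abel

theorem contract_form_Egen {l : Idx p} (hl : cgen η ϑ l ≠ 0) :
    contract (carrierForm hM η ϑ ζ (Egen hM l)) (classicalR hM η ϑ ζ) = Egen hM l := by
  have h2 : ∑ k, η k • ∑ m ∈ window M k,
      (carrierForm hM η ϑ ζ (Egen hM l) (rootVec (rowOf hM true k) m) •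
          rootVec (rowOf hM false k) (Fin.rev m) -
        carrierForm hM η ϑ ζ (Egen hM l) (rootVec (rowOf hM false k) (Fin.rev m)) •
          rootVec (rowOf hM true k) m) = 0 := by
    refine Finset.sum_eq_zero fun k _ => ?_
    rw [Finset.sum_eq_zero, smul_zero]
    intro m hm
    rw [carrierForm_Egen_root l (rootVec_mem_linkRoots true hm),
      carrierForm_Egen_root l (rootVec_mem_linkRoots false (rev_mem_window hm)),
      zero_smul, zero_smul, sub_zero]
  rw [contract_classicalR, h2, add_zero]
  simp [carrierForm_Egen_Hgen, carrierForm_Egen_Egen, smul_smul, hl]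

/-- Under ω a root vector pairs only with the vector of the other row and the reversed index, in the
same link, so one summand of I^{1∧2} survives and η cancels 1/η. -/
theorem contract_form_root (hk : η k ≠ 0) {x : so M} (hx : x ∈ linkRoots hM k) :
    contract (carrierForm hM η ϑ ζ x) (classicalR hM η ϑ ζ) = x := by
  rw [contract_classicalR]
  simp only [carrierForm_root_Hgen _ hx, carrierForm_root_Egen _ hx, zero_smul, sub_zero,
    smul_zero, Finset.sum_const_zero, add_zero, zero_add]
  rw [Finset.sum_eq_single k]
  · obtain ⟨s, n, hn, rfl⟩ := hx
    have hsum : ∑ m ∈ window M k,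
        (carrierForm hM η ϑ ζ (rootVec (rowOf hM s k) n) (rootVec (rowOf hM true k) m) •
            rootVec (rowOf hM false k) (Fin.rev m) -
          carrierForm hM η ϑ ζ (rootVec (rowOf hM s k) n)
            (rootVec (rowOf hM false k) (Fin.rev m)) • rootVec (rowOf hM true k) m) =
        (η k)⁻¹ • rootVec (rowOf hM s k) n := by
      cases s
      -- For a second-row vector the surviving index is the reversed one, since I^{1∧2} pairs X_m
      -- with Y_{rev m}; for a first-row vector it is n itself.
      · rw [Finset.sum_eq_single_of_mem _ (rev_mem_window hn)]
        · rw [carrierForm_root_root _ _ hn (rev_mem_window hn),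
            carrierForm_root_root _ _ hn (rev_mem_window (rev_mem_window hn))]
          simp
        · intro m hm hne
          have : n ≠ Fin.rev m := fun h => hne (by rw [h, Fin.rev_rev])
          rw [carrierForm_root_root _ _ hn hm,
            carrierForm_root_root _ _ hn (rev_mem_window hm)]
          simp [this]
      · rw [Finset.sum_eq_single_of_mem _ hn]
        · rw [carrierForm_root_root _ _ hn hn, carrierForm_root_root _ _ hn (rev_mem_window hn)]
          simp
        · intro m hm hne
          rw [carrierForm_root_root _ _ hn hm,
            carrierForm_root_root _ _ hn (rev_mem_window hm)]
          simp [hne.symm]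
    rw [hsum, smul_smul, mul_inv_cancel₀ hk, one_smul]
  · intro k' _ hne
    rw [Finset.sum_eq_zero, smul_zero]
    intro m hm
    rw [carrierForm_root_root_of_ne hne.symm hx (rootVec_mem_linkRoots true hm),
      carrierForm_root_root_of_ne hne.symm hx (rootVec_mem_linkRoots false (rev_mem_window hm)),
      zero_smul, zero_smul, sub_zero]
  · intro h; exact absurd (Finset.mem_univ k) h

theorem contract_form {x : so M} (hx : x ∈ carrier hM η ϑ) :
    contract (carrierForm hM η ϑ ζ x) (classicalR hM η ϑ ζ) = x := by
  rw [carrier_eq] at hx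
  induction hx using Submodule.span_induction with
  | mem x hx =>
    rcases hx with ⟨i, hi, rfl⟩ | ⟨i, hi, rfl⟩ | ⟨k, hk, hx⟩
    · exact contract_form_Hgen hi
    · exact contract_form_Egen hi
    · exact contract_form_root hk hx
  | zero => simp [contract]
  | add x y _ _ h1 h2 =>
    have : ∀ t, contract (carrierForm hM η ϑ ζ (x + y)) t =
        contract (carrierForm hM η ϑ ζ x) t + contract (carrierForm hM η ϑ ζ y) t := by
      intro t; simp [contract, LinearMap.rTensor_add]
    rw [this, h1, h2]
  | smul c x _ h1 =>
    have : ∀ t, contract (carrierForm hM η ϑ ζ (c • x)) t =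
        c • contract (carrierForm hM η ϑ ζ x) t := by
      intro t; simp [contract, LinearMap.rTensor_smul]
    rw [this, h1]

theorem tmul_mem_range {L : Submodule ℂ (so M)} {x y : so M} (hx : x ∈ L) (hy : y ∈ L) :
    x ⊗ₜ[ℂ] y ∈ LinearMap.range (TensorProduct.map L.subtype L.subtype) :=
  ⟨(⟨x, hx⟩ : L) ⊗ₜ[ℂ] (⟨y, hy⟩ : L), rfl⟩

theorem wedge_mem_range {L : Submodule ℂ (so M)} {x y : so M} (hx : x ∈ L) (hy : y ∈ L) :
    wedge x y ∈ LinearMap.range (TensorProduct.map L.subtype L.subtype) :=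
  sub_mem (tmul_mem_range hx hy) (tmul_mem_range hy hx)

theorem Egen_mem_carrier {i : Idx p} (h : cgen η ϑ i ≠ 0) : Egen hM i ∈ carrier hM η ϑ :=
  span_nilGens_le (Egen_mem_nil h)

theorem root_mem_carrier (hk : η k ≠ 0) {x : so M} (hx : x ∈ linkRoots hM k) :
    x ∈ carrier hM η ϑ :=
  span_nilGens_le (span_linkRoots_le hk (Submodule.subset_span hx))

theorem smul_mem_of_ne_zero {V : Type*} [AddCommGroup V] [Module ℂ V] {P : Submodule ℂ V} {c : ℂ}
    {v : V} (h : c ≠ 0 → v ∈ P) : c • v ∈ P := by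
  by_cases hc : c = 0
  · rw [hc, zero_smul]; exact zero_mem _
  · exact P.smul_mem c (h hc)

theorem classicalR_mem_range : classicalR hM η ϑ ζ ∈
    LinearMap.range (TensorProduct.map (carrier hM η ϑ).subtype (carrier hM η ϑ).subtype) := by
  rw [classicalR_eq_sum]
  refine add_mem (add_mem ?_ ?_) ?_
  · exact sum_mem fun i _ => smul_mem_of_ne_zero fun h =>
      wedge_mem_range (Hgen_mem_carrier h) (Egen_mem_carrier h)
  · refine sum_mem fun k _ => smul_mem_of_ne_zero fun h => sum_mem fun m hm => ?_
    exact wedge_mem_range (root_mem_carrier h (rootVec_mem_linkRoots true hm))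
      (root_mem_carrier h (rootVec_mem_linkRoots false (rev_mem_window hm)))
  · refine sum_mem fun i _ => sum_mem fun j _ => smul_mem_of_ne_zero fun h => ?_
    have h' := right_ne_zero_of_mul h
    exact tmul_mem_range (Egen_mem_carrier (left_ne_zero_of_mul h'))
      (Egen_mem_carrier (right_ne_zero_of_mul h'))

theorem contract_eq_zero {L : Submodule ℂ (so M)} {f : so M →ₗ[ℂ] ℂ} (hf : ∀ y ∈ L, f y = 0)
    {t : so M ⊗[ℂ] so M} (ht : t ∈ LinearMap.range (TensorProduct.map L.subtype L.subtype)) :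
    contract f t = 0 := by
  obtain ⟨s, rfl⟩ := ht
  induction s using TensorProduct.induction_on with
  | zero => simp
  | tmul a b => rw [TensorProduct.map_tmul, contract_tmul, L.subtype_apply, hf _ a.2, zero_smul]
  | add a b h1 h2 => rw [map_add, map_add, h1, h2, add_zero]

/-- On brackets ω is the coboundary part alone, so the cocycle identity is the Jacobi identity. If
ω(x, ·) vanishes on L, contracting it with r ∈ L ⊗ L gives 0, but by `contract_form` it gives x. -/
theorem isNondegenerateCocycle_carrierForm :
    IsNondegenerateCocycle (carrier hM η ϑ) (carrierForm hM η ϑ ζ) where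
  lie_mem x hx y hy := span_nilGens_le (carrier_lie_mem hx hy)
  alternating x _ := by
    rw [carrierForm_apply, lie_self, map_zero, zero_add]
    simp only [sub_mul, Finset.sum_sub_distrib]
    rw [sub_eq_zero, Finset.sum_comm]
    exact Finset.sum_congr rfl fun i _ => Finset.sum_congr rfl fun j _ => by ring
  cocycle x hx y hy z hz := by
    rw [carrierForm_of_nil_left fun l => Hdual_nil l (carrier_lie_mem hx hy),
      carrierForm_of_nil_left fun l => Hdual_nil l (carrier_lie_mem hy hz),
      carrierForm_of_nil_left fun l => Hdual_nil l (carrier_lie_mem hz hx), ← map_add, ← map_add]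
    have h := lie_jacobi x y z
    rw [← lie_skew x ⁅y, z⁆, ← lie_skew y ⁅z, x⁆, ← lie_skew z ⁅x, y⁆] at h
    have h' : ⁅⁅x, y⁆, z⁆ + ⁅⁅y, z⁆, x⁆ + ⁅⁅z, x⁆, y⁆ = 0 := by
      rw [← neg_eq_zero, ← h]; abel
    rw [h', map_zero]
  nondegenerate x hx h := by
    rw [← contract_form (ζ := ζ) hx]
    exact contract_eq_zero h classicalR_mem_range

/-- A coboundary vanishes on the commuting pair H_i, H_j, where ω takes the value ζ_ij - ζ_ji. -/
theorem not_isCoboundaryOn_carrierForm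
    (h : ∃ i j, Sum.elim η ϑ i ≠ 0 ∧ Sum.elim η ϑ j ≠ 0 ∧ ζ i j ≠ ζ j i) :
    ¬ IsCoboundaryOn (carrier hM η ϑ) (carrierForm hM η ϑ ζ) := by
  rintro ⟨f, hf⟩
  obtain ⟨i, j, hi, hj, hij⟩ := h
  have := hf _ (Hgen_mem_carrier hi) _ (Hgen_mem_carrier hj)
  rw [carrierForm_Hgen_Hgen, Hgen_lie_Hgen, map_zero, sub_eq_zero] at this
  exact hij this

end Cocycle
end FullChain

theorem mainTheorem4 (M p : ℕ) (hM : 4 * (p + 1) ≤ M) (η ϑ : Fin (p + 1) → ℂ)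
    (ζ : Idx p → Idx p → ℂ) :
    -- after twisting by the full chain, the `σ_i` are pairwise commuting primitive elements
    IsTwist (fullChain hM η ϑ) ∧
    (∀ i, twistedDelta (fullChain hM η ϑ) (sigma hM η ϑ i) =
      tens (sigma hM η ϑ i) 1 + tens 1 (sigma hM η ϑ i)) ∧
    (∀ i j, Commute (sigma hM η ϑ i) (sigma hM η ϑ j)) ∧
    -- the Reshetikhin-extended chain is a twist, with a triangular universal R-matrix
    IsTwist (reshetikhin hM η ϑ ζ * fullChain hM η ϑ) ∧
    IsTriangular (reshetikhin hM η ϑ ζ * fullChain hM η ϑ)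
      (universalR (reshetikhin hM η ϑ ζ * fullChain hM η ϑ)) ∧
    -- whose classical limit is the r-matrix with the additional terms, `R = 1 - h r + O(h²)`
    PowerSeries.coeff 0 (universalR (reshetikhin hM η ϑ ζ * fullChain hM η ϑ)) = 1 ∧
    PowerSeries.coeff 1 (universalR (reshetikhin hM η ϑ ζ * fullChain hM η ϑ)) =
      -TensorProduct.map ι ι (classicalR hM η ϑ ζ) ∧
    -- this r-matrix lies in `L ⊗ L` and is inverse to the Frobenius cocycle on the carrier `L`
    IsNondegenerateCocycle (carrier hM η ϑ)
      (omega hM (fun k => -(η k)⁻¹) (fun k => (ϑ k)⁻¹) ζ) ∧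
    classicalR hM η ϑ ζ ∈
      LinearMap.range (TensorProduct.map (carrier hM η ϑ).subtype (carrier hM η ϑ).subtype) ∧
    (∀ x ∈ carrier hM η ϑ,
      TensorProduct.lid ℂ (so M) (LinearMap.rTensor (so M)
        (omega hM (fun k => -(η k)⁻¹) (fun k => (ϑ k)⁻¹) ζ x) (classicalR hM η ϑ ζ)) = x) ∧
    -- and the cocycle is not a coboundary if `ζ` is not symmetric on the carrier
    ((∃ i j, Sum.elim η ϑ i ≠ 0 ∧ Sum.elim η ϑ j ≠ 0 ∧ ζ i j ≠ ζ j i) →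
      ¬ IsCoboundaryOn (carrier hM η ϑ)
        (omega hM (fun k => -(η k)⁻¹) (fun k => (ϑ k)⁻¹) ζ)) := by
  refine ⟨isTwist_fullChain, fun i => ?_, commute_sigma, isTwist_reshetikhin_mul ζ,
    isTriangular_universalR (isTwist_reshetikhin_mul ζ), ?_, (firstOrder_universalR ζ).one,
    isNondegenerateCocycle_carrierForm, classicalR_mem_range, fun x hx => contract_form hx,
    not_isCoboundaryOn_carrierForm⟩
  · exact (isPrim_fullChain_sigma i).twistedDelta_eq isTwist_fullChain.isUnit
  · rw [PowerSeries.coeff_zero_eq_constantCoeff_apply]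
    exact (firstOrder_universalR ζ).zero
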